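/- **Theorem.** Let $T$ be a tree with $n$ vertices, let $u$ and $v$ be vertices of $T$, and let $k\ge 1$. A *walk* of a robot is a non-empty finite sequence of vertices of $T$ in which consecutive vertices are adjacent or equal; its *length* is the number of consecutive pairs that are different. A *covering strategy* assigns a walk to each robot so that every vertex of $T$ lies on at least one of the walks; its *length* (cost) is the sum of the lengths of its walks. For integers $s,t\ge 0$ let $\mathrm{Two\text{-}sources}[T,u,v,s,t]$ be the minimum length of a covering strategy for $T$ - in which $s$ robots start at $u$ and $t$ robots start at $v$, if $s,t\ge 1$; - in which one robot starts and ends at $u$ and $t$ robots start at $v$, if $s=0$; - in which one robot starts and ends at $v$ and $s$ robots start at $u$, if $t=0$ (for $s=t=0$ the last two descriptions give the same value). Then the values $$\mathrm{Two\text{-}sources}[T,u,v,s,t],\qquad 0\le s,t\le k,$$ can be computed in $O(k^4 n)$ time: there is an algorithm for the word RAM with words of $O(\log(n+k))$ bits and unit-cost operations that, given $k$, $u$, $v$ and the adjacency lists of $T$, outputs all these values after at most $c\,k^4 n$ steps, where $c$ is an absolute constant. -/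

import Mathlib

namespace TreeCover

/-! ## Walks of robots and covering strategies -/

section Strategies

variable {V : Type*} [DecidableEq V] (G : SimpleGraph V)

/-- A walk of a robot on `G`: a nonempty sequence of vertices in which two consecutive
vertices are either adjacent or equal (the robot may wait at a vertex). -/
def IsWalk (W : List V) : Prop :=
  W ≠ [] ∧ W.IsChain (fun x y => G.Adj x y ∨ x = y)

/-- The length of a walk: the number of times the robot changes its position. -/
def walkLength : List V → ℕ
  | [] => 0
  | [_] => 0
  | x :: y :: W => (if x = y then 0 else 1) + walkLength (y :: W)

/-- The walk starts at `x`. -/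
def StartsAt (x : V) (W : List V) : Prop := W.head? = some x

/-- The walk ends at `x`. -/
def EndsAt (x : V) (W : List V) : Prop := W.getLast? = some x

/-- A covering strategy for the robots indexed by `ι`: a walk on `G` for each robot, such that
every vertex is visited by at least one robot. -/
def IsCoveringStrategy {ι : Type*} (S : ι → List V) : Prop :=
  (∀ i, IsWalk G (S i)) ∧ ∀ x, ∃ i, x ∈ S i

/-- The length of a strategy: the sum of the lengths of its walks. -/
def strategyLength {ι : Type*} [Fintype ι] (S : ι → List V) : ℕ := ∑ i, walkLength (S i)

/-- The lengths of the covering strategies over which the two-source optimum is taken.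
If `s, t ≥ 1`: `s` robots start at `u` and `t` robots start at `v`.
If `s = 0`: one robot starts and ends at `u`, and `t` robots start at `v`.
If `t = 0` and `s ≥ 1`: one robot starts and ends at `v`, and `s` robots start at `u`. -/
def twoSourcesLengths (u v : V) (s t : ℕ) : Set ℕ :=
  if s = 0 then
    {l | ∃ S : Fin 1 ⊕ Fin t → List V, IsCoveringStrategy G S ∧
      (∀ i, StartsAt u (S (Sum.inl i)) ∧ EndsAt u (S (Sum.inl i))) ∧
      (∀ j, StartsAt v (S (Sum.inr j))) ∧ strategyLength S = l}
  else if t = 0 then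
    {l | ∃ S : Fin s ⊕ Fin 1 → List V, IsCoveringStrategy G S ∧
      (∀ i, StartsAt u (S (Sum.inl i))) ∧
      (∀ j, StartsAt v (S (Sum.inr j)) ∧ EndsAt v (S (Sum.inr j))) ∧ strategyLength S = l}
  else
    {l | ∃ S : Fin s ⊕ Fin t → List V, IsCoveringStrategy G S ∧
      (∀ i, StartsAt u (S (Sum.inl i))) ∧
      (∀ j, StartsAt v (S (Sum.inr j))) ∧ strategyLength S = l}

/-- `l` is the cost of an optimal covering strategy with sources `u`, `v` and `s`, `t` robots. -/
def IsTwoSources (u v : V) (s t l : ℕ) : Prop :=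
  IsLeast (twoSourcesLengths G u v s t) l

end Strategies

/-! ## A word RAM

A machine state consists of registers and of arrays of words (a program mentions only finitely
many of either). Every number that is computed, and every array index that is used, has to fit
into a word of `w` bits; otherwise the program is stuck. Each elementary operation costs one
unit. -/

/-- The state of the machine: `reg x` is the content of register `x`, and `arr a i` is the
content of the `i`-th cell of array `a`. -/
structure State where
  reg : ℕ → ℕ
  arr : ℕ → ℕ → ℕ

/-- Assign a value to a register. -/
def State.setReg (σ : State) (x val : ℕ) : State :=
  { σ with reg := Function.update σ.reg x val }

/-- Assign a value to an array cell. -/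
def State.setArr (σ : State) (a i val : ℕ) : State :=
  { σ with arr := Function.update σ.arr a (Function.update (σ.arr a) i val) }

/-- Expressions: constants, registers, array cells (with a computed index), and arithmetic. -/
inductive Expr where
  | const (m : ℕ)
  | reg (x : ℕ)
  | cell (a : ℕ) (index : Expr)
  | add (e₁ e₂ : Expr)
  | sub (e₁ e₂ : Expr)
  | mul (e₁ e₂ : Expr)

/-- The value of an expression (subtraction is truncated at zero). -/
def Expr.eval (σ : State) : Expr → ℕ
  | const m => m
  | reg x => σ.reg x
  | cell a e => σ.arr a (e.eval σ)
  | add e₁ e₂ => e₁.eval σ + e₂.eval σ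
  | sub e₁ e₂ => e₁.eval σ - e₂.eval σ
  | mul e₁ e₂ => e₁.eval σ * e₂.eval σ

/-- All values that occur in the evaluation of the expression fit into a word of `w` bits. -/
def Expr.Fits (w : ℕ) (σ : State) : Expr → Prop
  | const m => m < 2 ^ w
  | reg x => σ.reg x < 2 ^ w
  | cell a e => e.Fits w σ ∧ σ.arr a (e.eval σ) < 2 ^ w
  | add e₁ e₂ => e₁.Fits w σ ∧ e₂.Fits w σ ∧ e₁.eval σ + e₂.eval σ < 2 ^ w
  | sub e₁ e₂ => e₁.Fits w σ ∧ e₂.Fits w σ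
  | mul e₁ e₂ => e₁.Fits w σ ∧ e₂.Fits w σ ∧ e₁.eval σ * e₂.eval σ < 2 ^ w

/-- The cost of evaluating an expression: the number of its constants, reads and operations. -/
def Expr.cost : Expr → ℕ
  | const _ => 1
  | reg _ => 1
  | cell _ e => e.cost + 1
  | add e₁ e₂ => e₁.cost + e₂.cost + 1
  | sub e₁ e₂ => e₁.cost + e₂.cost + 1
  | mul e₁ e₂ => e₁.cost + e₂.cost + 1

/-- Programs. `ifLt` and `whileLt` test whether the first expression is less than the second. -/
inductive Program where
  | skip
  | set (x : ℕ) (e : Expr)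
  | write (a : ℕ) (index e : Expr)
  | seq (p q : Program)
  | ifLt (e₁ e₂ : Expr) (p q : Program)
  | whileLt (e₁ e₂ : Expr) (p : Program)

/-- `Exec w p σ τ σ'`: on words of `w` bits, the program `p` started in the state `σ` halts after
exactly `τ` time units in the state `σ'`. -/
inductive Exec (w : ℕ) : Program → State → ℕ → State → Prop
  | skip (σ : State) : Exec w .skip σ 1 σ
  | set (σ : State) (x : ℕ) (e : Expr) : e.Fits w σ →
      Exec w (.set x e) σ (e.cost + 1) (σ.setReg x (e.eval σ))
  | write (σ : State) (a : ℕ) (i e : Expr) : i.Fits w σ → e.Fits w σ →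
      Exec w (.write a i e) σ (i.cost + e.cost + 1) (σ.setArr a (i.eval σ) (e.eval σ))
  | seq (σ₁ σ₂ σ₃ : State) (p q : Program) (τ₁ τ₂ : ℕ) :
      Exec w p σ₁ τ₁ σ₂ → Exec w q σ₂ τ₂ σ₃ → Exec w (.seq p q) σ₁ (τ₁ + τ₂) σ₃
  | if_true (σ₁ σ₂ : State) (e₁ e₂ : Expr) (p q : Program) (τ : ℕ) :
      e₁.Fits w σ₁ → e₂.Fits w σ₁ → e₁.eval σ₁ < e₂.eval σ₁ → Exec w p σ₁ τ σ₂ →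
      Exec w (.ifLt e₁ e₂ p q) σ₁ (e₁.cost + e₂.cost + 1 + τ) σ₂
  | if_false (σ₁ σ₂ : State) (e₁ e₂ : Expr) (p q : Program) (τ : ℕ) :
      e₁.Fits w σ₁ → e₂.Fits w σ₁ → ¬ e₁.eval σ₁ < e₂.eval σ₁ → Exec w q σ₁ τ σ₂ →
      Exec w (.ifLt e₁ e₂ p q) σ₁ (e₁.cost + e₂.cost + 1 + τ) σ₂
  | while_true (σ₁ σ₂ σ₃ : State) (e₁ e₂ : Expr) (p : Program) (τ₁ τ₂ : ℕ) :
      e₁.Fits w σ₁ → e₂.Fits w σ₁ → e₁.eval σ₁ < e₂.eval σ₁ → Exec w p σ₁ τ₁ σ₂ →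
      Exec w (.whileLt e₁ e₂ p) σ₂ τ₂ σ₃ →
      Exec w (.whileLt e₁ e₂ p) σ₁ (e₁.cost + e₂.cost + 1 + τ₁ + τ₂) σ₃
  | while_false (σ : State) (e₁ e₂ : Expr) (p : Program) :
      e₁.Fits w σ → e₂.Fits w σ → ¬ e₁.eval σ < e₂.eval σ →
      Exec w (.whileLt e₁ e₂ p) σ (e₁.cost + e₂.cost + 1) σ

/-! ## Input of the algorithm -/

/-- `adj` is an adjacency-list representation of `T`: for each vertex, its neighbours in an
arbitrary order and without repetition. -/
def IsAdjacencyLists {n : ℕ} (T : SimpleGraph (Fin n)) (adj : Fin n → List (Fin n)) : Prop :=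
  ∀ x, (adj x).Nodup ∧ ∀ y, y ∈ adj x ↔ T.Adj x y

/-- The initial state. Registers `0, 1, 2, 3` hold `n, k, u, v`. Array `1` holds the adjacency
lists of the vertices `0, 1, …, n - 1` one after the other, and array `0` holds in its cells
`0, 1, …, n` the offsets of these lists in array `1` (cell `n` holds their total length).
Everything else is zero. -/
def inputState (n k : ℕ) (u v : Fin n) (adj : Fin n → List (Fin n)) : State where
  reg x := if x = 0 then n else if x = 1 then k else if x = 2 then u.val
    else if x = 3 then v.val else 0
  arr a i :=
    if a = 0 then (if i ≤ n then (((List.finRange n).take i).flatMap adj).length else 0)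
    else if a = 1 then (((List.finRange n).flatMap adj).map Fin.val).getD i 0
    else 0

end TreeCover

namespace TreeCover

/-! ## Rooted trees on an initial segment of the natural numbers -/

/-! Root `T` at `u` and number the vertices so that parents precede children. Once it is fixed how
many robots end at each vertex, the net flow through the edge above `j` is fixed too: it is the
difference between the numbers of robots that start and that end below `j`. A used edge is crossed
at least that often and with the same parity, hence at least `wt` times, which is twice when the
flow is zero. An unused edge has flow zero and separates `u` from `v`, because both of its sides
have to be visited. There is at most one such edge, since nobody reaches the vertices between two of
them.

All these bounds are attained at once: peeling off leaves one at a time builds a strategy that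
crosses each edge exactly as often as required (`Rooting.achievable`). So the optimum is the
minimum, over all distributions `E` of end points and all omissible edges `r`, of the sum of
`linkCost` (`Rooting.linkCost_mem` and `Rooting.exists_linkCost_le`). The round-trip robot demanded
for `s = 0` or `t = 0` does not change any net flow; it only provides a robot on the side of the
omitted edge that would otherwise have none. For `s = t = 0` there is a single robot, no edge can be
omitted, and the value is `2 * (n - 1)`.

The minimum is found by a knapsack on the tree. The entry of a vertex `x` for `a` robots and `b ≤ 1`
permissions to skip an edge is the cheapest cost inside the part already merged into `x`; merging a
child into its parent is a min-plus convolution. One permission is distributed in total, and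
`edgeCost` makes it effective only where skipping is legitimate, so that legitimacy need not be a
constraint (`dpTable_spec`, `dpValue_le`, `exists_le_dpValue`). A merge takes `O(k ^ 2)` steps,
there are `n - 1` merges for each pair, and there are `(k + 1) ^ 2` pairs.

On the machine, breadth-first search yields the numbering and the parents, and climbing from `v`
marks the edges between `u` and `v`. The predicate `Runs` carries correctness, running time and a
bound on all stored numbers through the program; as that bound is a power of `n + k`, words of
`O(log (n + k))` bits suffice. -/

/-- `anc pp x y` is `1` if `x` lies on the path from `y` to the root `0` in the tree with parent
function `pp`, and `0` otherwise. -/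
def anc (pp : ℕ → ℕ) (x : ℕ) : ℕ → ℕ
  | 0 => if x = 0 then 1 else 0
  | y + 1 => (if x = y + 1 then 1 else 0) + anc pp x (min (pp (y + 1)) y)
termination_by y => y
decreasing_by omega

section anc

variable {pp : ℕ → ℕ}

theorem anc_zero (x : ℕ) : anc pp x 0 = if x = 0 then 1 else 0 := by
  rw [anc]

theorem anc_of_pos {x y : ℕ} (hy : 0 < y) (h : pp y < y) :
    anc pp x y = (if x = y then 1 else 0) + anc pp x (pp y) := by
  obtain ⟨y, rfl⟩ := Nat.exists_eq_add_of_lt hy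
  simp only [zero_add] at *
  rw [anc, min_eq_left (by omega)]

theorem anc_of_lt {x : ℕ} : ∀ {y : ℕ}, y < x → anc pp x y = 0 := by
  intro y
  induction y using Nat.strong_induction_on with
  | _ y ih =>
    intro h
    cases y with
    | zero => rw [anc_zero, if_neg (by omega)]
    | succ y => rw [anc, if_neg (by omega), ih _ (by omega) (by omega)]

theorem anc_self (x : ℕ) : anc pp x x = 1 := by
  cases x with
  | zero => simp [anc_zero]
  | succ x => rw [anc, if_pos rfl, anc_of_lt (by omega)]

theorem anc_le_one (x y : ℕ) : anc pp x y ≤ 1 := by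
  induction y using Nat.strong_induction_on with
  | _ y ih =>
    cases y with
    | zero => rw [anc_zero]; split_ifs <;> simp
    | succ y =>
      by_cases h : x = y + 1
      · rw [h, anc_self]
      · rw [anc, if_neg h, zero_add]
        exact ih _ (by omega)

end anc

/-- The vertices of the graph are enumerated as `q 0, …, q (n - 1)` (with inverse `pos`) in such a
way that `u` comes first and that every edge joins some `q j` with `0 < j` to `q (pp j)`, where
`pp j < j`. -/
structure Rooting {n : ℕ} (T : SimpleGraph (Fin n)) (u : Fin n) (q : ℕ → Fin n)
    (pos : Fin n → ℕ) (pp : ℕ → ℕ) : Prop where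
  pos_lt : ∀ x, pos x < n
  q_pos : ∀ x, q (pos x) = x
  pos_q : ∀ i < n, pos (q i) = i
  pos_root : pos u = 0
  pp_lt : ∀ j, 0 < j → j < n → pp j < j
  adj : ∀ j, 0 < j → j < n → T.Adj (q j) (q (pp j))
  parent : ∀ x y, T.Adj x y →
    (0 < pos x ∧ pp (pos x) = pos y) ∨ (0 < pos y ∧ pp (pos y) = pos x)

/-- The distance of two natural numbers. -/
def gap (a b : ℕ) : ℕ := (a - b) + (b - a)

/-- The number of times an edge has to be crossed if the net flow through it is `d` and the edge
must be used. -/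
def wt (d : ℕ) : ℕ := d + 2 * (1 - d)

theorem wt_zero : wt 0 = 2 := rfl

theorem wt_of_pos {d : ℕ} (h : 0 < d) : wt d = d := by
  unfold wt; omega

/-- Robots that stay put or return to their source contribute equally to both arguments, and hence
drop out of the net flow. -/
theorem gap_add_left (a b c : ℕ) : gap (a + b) (a + c) = gap b c := by
  unfold gap; omega

/-! ## Operations on strategies -/

section Walks

variable {V : Type*} {G : SimpleGraph V}

theorem IsWalk.singleton (x : V) : IsWalk G [x] := ⟨by simp, by simp⟩

theorem isWalk_append {A B : List V} {x : V} :
    IsWalk G (A ++ x :: B) ↔ IsWalk G (A ++ [x]) ∧ IsWalk G (x :: B) := by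
  simp only [IsWalk, ne_eq, List.append_eq_nil_iff, reduceCtorEq, and_false, not_false_eq_true,
    true_and]
  constructor
  · intro h
    rw [List.isChain_append] at h ⊢
    refine ⟨⟨h.1, by simp, ?_⟩, h.2.1⟩
    simpa using h.2.2
  · rintro ⟨h, h'⟩
    rw [List.isChain_append] at h ⊢
    refine ⟨h.1, h', ?_⟩
    simpa using h.2.2

theorem isWalk_pair {x y : V} (h : G.Adj x y) : IsWalk G [x, y] := by
  simp [IsWalk, h]

theorem exists_eq_append_of_getLast? {W : List V} {p : V} (h : W.getLast? = some p) :
    ∃ A, W = A ++ [p] := by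
  rw [List.getLast?_eq_some_iff] at h
  exact h

variable [DecidableEq V]

theorem walkLength_append (A B : List V) (x : V) :
    walkLength (A ++ x :: B) = walkLength (A ++ [x]) + walkLength (x :: B) := by
  induction A with
  | nil => simp [walkLength]
  | cons a A ih =>
    cases A with
    | nil => simp [walkLength]
    | cons b A =>
      simp only [List.cons_append, walkLength] at ih ⊢
      rw [ih, add_assoc]

/-- There are walks with the multiset `S` of starting points, the multiset `E` of end points and
total length `c` that visit all vertices in `C`. -/
def Achievable (G : SimpleGraph V) (S E : Multiset V) (c : ℕ) (C : Set V) : Prop :=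
  ∃ M : Multiset (List V), (∀ W ∈ M, IsWalk G W) ∧ M.map List.head? = S.map some ∧
    M.map List.getLast? = E.map some ∧ (M.map walkLength).sum = c ∧ ∀ x ∈ C, ∃ W ∈ M, x ∈ W

theorem Achievable.empty : Achievable G 0 0 0 ∅ := ⟨0, by simp⟩

theorem Achievable.mono {S E : Multiset V} {c : ℕ} {C D : Set V} (h : Achievable G S E c C)
    (hD : D ⊆ C) : Achievable G S E c D := by
  obtain ⟨M, h1, h2, h3, h4, h5⟩ := h
  exact ⟨M, h1, h2, h3, h4, fun x hx => h5 x (hD hx)⟩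

theorem Achievable.stay {S E : Multiset V} {c : ℕ} {C : Set V} (x : V)
    (h : Achievable G S E c C) : Achievable G (x ::ₘ S) (x ::ₘ E) c (insert x C) := by
  obtain ⟨M, h1, h2, h3, h4, h5⟩ := h
  refine ⟨[x] ::ₘ M, ?_, by simp [h2], by simp [h3], by simp [h4, walkLength], ?_⟩
  · intro W hW
    rcases Multiset.mem_cons.1 hW with rfl | hW
    · exact IsWalk.singleton x
    · exact h1 W hW
  · rintro y (rfl | hy)
    · exact ⟨[y], by simp⟩
    · obtain ⟨W, hW, hy⟩ := h5 y hy
      exact ⟨W, by simp [hW], hy⟩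

/-- Replace one walk of a strategy. -/
theorem achievable_replace {M : Multiset (List V)} {W W' : List V} {S E : Multiset V} {c : ℕ}
    {C : Set V} (hW : ∀ x ∈ W, x ∈ W') (hM : ∀ U ∈ M, IsWalk G U) (hW' : IsWalk G W')
    (hS : (W' ::ₘ M).map List.head? = S.map some)
    (hE : (W' ::ₘ M).map List.getLast? = E.map some)
    (hc : ((W' ::ₘ M).map walkLength).sum = c)
    (hC : ∀ x ∈ C, x ∈ W' ∨ ∃ U ∈ W ::ₘ M, x ∈ U) : Achievable G S E c C := by
  refine ⟨W' ::ₘ M, ?_, hS, hE, hc, ?_⟩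
  · intro U hU
    rcases Multiset.mem_cons.1 hU with rfl | hU
    exacts [hW', hM U hU]
  · intro x hx
    rcases hC x hx with h | ⟨U, hU, h⟩
    · exact ⟨W', by simp, h⟩
    · rcases Multiset.mem_cons.1 hU with rfl | hU
      · exact ⟨W', by simp, hW x h⟩
      · exact ⟨U, by simp [hU], h⟩

/-- Together with `Achievable.snoc_end` and `Achievable.loop`, this attaches a leaf `x` to a
strategy for the rest of the tree: a robot leaves the leaf, enters it for good, or visits it on a
detour. -/
theorem Achievable.cons_start {S E : Multiset V} {c : ℕ} {C : Set V} {x p : V} (hx : G.Adj x p)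
    (h : Achievable G (p ::ₘ S) E c C) : Achievable G (x ::ₘ S) E (c + 1) (insert x C) := by
  obtain ⟨M, h1, h2, h3, h4, h5⟩ := h
  rw [Multiset.map_cons] at h2
  obtain ⟨W, hWM, hWp, hM⟩ := (Multiset.map_eq_cons _ _ _ _).2 h2
  obtain ⟨M, rfl⟩ := Multiset.exists_cons_of_mem hWM
  rw [Multiset.erase_cons_head] at hM
  obtain ⟨B, rfl⟩ : ∃ B, W = p :: B := by
    cases W with
    | nil => simp at hWp
    | cons a B => simp at hWp; exact ⟨B, by rw [hWp]⟩
  have hne : x ≠ p := hx.ne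
  refine achievable_replace (W := p :: B) (W' := x :: p :: B) (M := M) ?_ ?_ ?_ ?_ ?_ ?_ ?_
  · intro y hy; exact List.mem_cons_of_mem _ hy
  · intro U hU; exact h1 U (by simp [hU])
  · exact isWalk_append (A := [x]).2 ⟨isWalk_pair hx, h1 _ (by simp)⟩
  · simp [hM]
  · simpa using h3
  · rw [← h4]; simp [walkLength, hne]; omega
  · rintro y (rfl | hy)
    · simp
    · exact Or.inr (h5 y hy)

theorem Achievable.snoc_end {S E : Multiset V} {c : ℕ} {C : Set V} {x p : V} (hx : G.Adj p x)
    (h : Achievable G S (p ::ₘ E) c C) : Achievable G S (x ::ₘ E) (c + 1) (insert x C) := by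
  obtain ⟨M, h1, h2, h3, h4, h5⟩ := h
  rw [Multiset.map_cons] at h3
  obtain ⟨W, hWM, hWp, hM⟩ := (Multiset.map_eq_cons _ _ _ _).2 h3
  obtain ⟨M, rfl⟩ := Multiset.exists_cons_of_mem hWM
  rw [Multiset.erase_cons_head] at hM
  obtain ⟨A, rfl⟩ := exists_eq_append_of_getLast? hWp
  have hne : p ≠ x := hx.ne
  refine achievable_replace (W := A ++ [p]) (W' := A ++ p :: [x]) (M := M) ?_ ?_ ?_ ?_ ?_ ?_ ?_
  · intro y; simp; tauto
  · intro U hU; exact h1 U (by simp [hU])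
  · exact isWalk_append.2 ⟨h1 _ (by simp), isWalk_pair hx⟩
  · rw [← h2]; cases A <;> simp
  · simp [hM]
  · rw [← h4, Multiset.map_cons, Multiset.sum_cons, walkLength_append]; simp [walkLength, hne]
    omega
  · rintro y (rfl | hy)
    · simp
    · exact Or.inr (h5 y hy)

/-- The detour `p, x, p` is spliced into a walk through `p`. It leaves all end points unchanged, and
is how an edge with zero flow gets used twice. -/
theorem Achievable.loop {S E : Multiset V} {c : ℕ} {C : Set V} {x p : V} (hx : G.Adj p x)
    (hp : p ∈ C) (h : Achievable G S E c C) : Achievable G S E (c + 2) (insert x C) := by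
  obtain ⟨M, h1, h2, h3, h4, h5⟩ := h
  obtain ⟨W, hWM, hWp⟩ := h5 p hp
  obtain ⟨M, rfl⟩ := Multiset.exists_cons_of_mem hWM
  obtain ⟨A, B, rfl⟩ := List.append_of_mem hWp
  have hne : p ≠ x := hx.ne
  have hW := isWalk_append.1 (h1 _ (Multiset.mem_cons_self _ _))
  refine achievable_replace (W := A ++ p :: B) (W' := A ++ p :: x :: p :: B) (M := M)
    ?_ ?_ ?_ ?_ ?_ ?_ ?_
  · intro y; simp; tauto
  · intro U hU; exact h1 U (by simp [hU])
  · exact isWalk_append.2 ⟨hW.1, isWalk_append (A := [p]).2 ⟨isWalk_pair hx,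
      isWalk_append (A := [x]).2 ⟨isWalk_pair hx.symm, hW.2⟩⟩⟩
  · rw [← h2]; cases A <;> simp
  · rw [← h3, Multiset.map_cons, Multiset.map_cons,
      show A ++ p :: x :: p :: B = (A ++ [p, x]) ++ p :: B by simp,
      List.getLast?_append_of_ne_nil _ (by simp), List.getLast?_append_of_ne_nil _ (by simp)]
  · rw [← h4]
    rw [Multiset.map_cons, Multiset.map_cons, Multiset.sum_cons, Multiset.sum_cons,
      walkLength_append A (x :: p :: B), walkLength_append A B]
    simp [walkLength, hne, hne.symm]
    omega
  · rintro y (rfl | hy)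
    · simp
    · exact Or.inr (h5 y hy)

theorem Achievable.stay_many {S E : Multiset V} {c : ℕ} {C : Set V} {x : V}
    (h : Achievable G S E c C) (k : ℕ) (hk : 0 < k) :
    Achievable G (Multiset.replicate k x + S) (Multiset.replicate k x + E) c (insert x C) := by
  induction k, hk using Nat.le_induction with
  | base => simpa using h.stay x
  | succ k _ ih => simpa [Multiset.replicate_succ] using ih.stay x

/-- Since `x` is already covered, `k = 0` is allowed here, in contrast to `Achievable.stay_many`. -/
theorem Achievable.stay_many' {S E : Multiset V} {c : ℕ} {C : Set V} {x : V}
    (h : Achievable G S E c (insert x C)) (k : ℕ) :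
    Achievable G (Multiset.replicate k x + S) (Multiset.replicate k x + E) c (insert x C) := by
  rcases Nat.eq_zero_or_pos k with rfl | hk
  · simpa using h
  · exact (h.stay_many k hk).mono (by simp)

theorem Achievable.cons_start_many {E : Multiset V} {C : Set V} {x p : V}
    (hx : G.Adj x p) (k : ℕ) : ∀ {S : Multiset V} {c : ℕ}, 0 < k →
    Achievable G (Multiset.replicate k p + S) E c C →
    Achievable G (Multiset.replicate k x + S) E (c + k) (insert x C) := by
  induction k with
  | zero => simp
  | succ k ih =>
    intro S c _ h
    rw [Multiset.replicate_succ, Multiset.cons_add] at h ⊢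
    rcases Nat.eq_zero_or_pos k with rfl | hk
    · simpa using Achievable.cons_start hx h
    · have h1 := (Achievable.cons_start hx h)
      -- The robot already moved to `x` joins the remaining ones, so that the induction hypothesis
      -- moves the other `k`.
      rw [← Multiset.add_cons] at h1
      obtain ⟨M, h2⟩ := h1
      have := ih hk (S := x ::ₘ S) (c := c + 1)
        (Achievable.mono ⟨M, h2⟩ (Set.subset_insert _ _))
      rw [Multiset.add_cons] at this
      convert this using 1
      omega

theorem Achievable.snoc_end_many {S : Multiset V} {C : Set V} {x p : V}
    (hx : G.Adj p x) (k : ℕ) : ∀ {E : Multiset V} {c : ℕ}, 0 < k →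
    Achievable G S (Multiset.replicate k p + E) c C →
    Achievable G S (Multiset.replicate k x + E) (c + k) (insert x C) := by
  induction k with
  | zero => simp
  | succ k ih =>
    intro E c _ h
    rw [Multiset.replicate_succ, Multiset.cons_add] at h ⊢
    rcases Nat.eq_zero_or_pos k with rfl | hk
    · simpa using Achievable.snoc_end hx h
    · have h1 := (Achievable.snoc_end hx h)
      rw [← Multiset.add_cons] at h1
      have := ih hk (E := x ::ₘ E) (c := c + 1) (h1.mono (Set.subset_insert _ _))
      rw [Multiset.add_cons] at this
      convert this using 1
      omega

end Walks

end TreeCover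

namespace TreeCover

/-! ## Strategies with prescribed numbers of end points -/

/-- Separates the robots at the last vertex `l`, which is a leaf of the tree on the first `l + 1`
vertices, from the others. -/
theorem exists_eq_replicate_add {S : Multiset ℕ} {l : ℕ} (h : ∀ x ∈ S, x < l + 1) :
    ∃ k S₀, S = Multiset.replicate k l + S₀ ∧ ∀ x ∈ S₀, x < l := by
  refine ⟨S.count l, S.filter (fun x => ¬ x = l), ?_, ?_⟩
  · rw [← Multiset.filter_eq', Multiset.filter_add_not]
  · intro x hx
    rw [Multiset.mem_filter] at hx
    have := h x hx.1
    omega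

section Upper

variable {n : ℕ} {T : SimpleGraph (Fin n)} {u : Fin n} {q : ℕ → Fin n} {pos : Fin n → ℕ}
  {pp : ℕ → ℕ}

theorem sum_anc_eq_zero {S : Multiset ℕ} {l : ℕ} (h : ∀ x ∈ S, x < l) :
    (S.map (anc pp l)).sum = 0 := by
  rw [Multiset.sum_eq_zero]
  intro a ha
  obtain ⟨x, hx, rfl⟩ := Multiset.mem_map.1 ha
  exact anc_of_lt (h x hx)

theorem sum_anc_replicate_add (k j l : ℕ) (S : Multiset ℕ) :
    ((Multiset.replicate k l + S).map (anc pp j)).sum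
      = k * anc pp j l + (S.map (anc pp j)).sum := by
  simp

/-- The cost of the edge above `j` for starting points `S` and end points `E`, where the
edges above the roots of the classes of `κ` are not used. -/
def flowCost (pp κ : ℕ → ℕ) (S E : Multiset ℕ) (j : ℕ) : ℕ :=
  if κ j = j then 0 else wt (gap (S.map (anc pp j)).sum (E.map (anc pp j)).sum)

theorem sum_flowCost_congr {κ : ℕ → ℕ} {S E S' E' : Multiset ℕ} {l : ℕ}
    (h : ∀ j, 0 < j → j < l → gap (S.map (anc pp j)).sum (E.map (anc pp j)).sum
      = gap (S'.map (anc pp j)).sum (E'.map (anc pp j)).sum) :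
    ∑ j ∈ Finset.Ico 1 l, flowCost pp κ S E j = ∑ j ∈ Finset.Ico 1 l, flowCost pp κ S' E' j := by
  refine Finset.sum_congr rfl fun j hj => ?_
  rw [Finset.mem_Ico] at hj
  rw [flowCost, flowCost, h j (by omega) hj.2]

theorem countP_replicate_add {κ : ℕ → ℕ} (c k l : ℕ) (S : Multiset ℕ) :
    (Multiset.replicate k l + S).countP (fun y => κ y = c)
      = (if κ l = c then k else 0) + S.countP (fun y => κ y = c) := by
  rw [Multiset.countP_add]
  congr 1
  split_ifs with h
  · rw [Multiset.countP_eq_card.2, Multiset.card_replicate]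
    intro y hy
    rw [Multiset.eq_of_mem_replicate hy, h]
  · rw [Multiset.countP_eq_zero]
    intro y hy
    rwa [Multiset.eq_of_mem_replicate hy]

theorem insert_image_Iio (l : ℕ) : insert (q l) (q '' Set.Iio l) = q '' Set.Iio (l + 1) := by
  rw [← Set.image_insert_eq]
  congr 1
  ext x
  simp only [Set.mem_insert_iff, Set.mem_Iio]
  omega

/-- Let `κ` map each vertex to the root of its component after the removal of some edges. If
every component contains as many starting points as end points, and at least one, then there is
a strategy that crosses each remaining edge as often as necessary. -/
theorem Rooting.achievable (h : Rooting T u q pos pp) {κ : ℕ → ℕ} (hκ0 : κ 0 = 0)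
    (hκ : ∀ j, 0 < j → j < n → κ j = κ (pp j) ∨ κ j = j) :
    ∀ m ≤ n, ∀ S E : Multiset ℕ, (∀ x ∈ S, x < m) → (∀ x ∈ E, x < m) →
      (∀ c < m, κ c = c → S.countP (fun y => κ y = c) = E.countP (fun y => κ y = c) ∧
        0 < S.countP (fun y => κ y = c)) →
      Achievable T (S.map q) (E.map q) (∑ j ∈ Finset.Ico 1 m, flowCost pp κ S E j)
        (q '' Set.Iio m) := by
  -- Class representatives are minimal in their classes, so no vertex before `l` can belong to a
  -- class with root `l`.
  have hle : ∀ y < n, κ y ≤ y := by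
    intro y
    induction y using Nat.strong_induction_on with
    | _ y ih =>
      intro hy
      rcases Nat.eq_zero_or_pos y with rfl | hy0
      · omega
      · have := h.pp_lt y hy0 hy
        rcases hκ y hy0 hy with h1 | h1
        · have := ih _ this (by omega)
          omega
        · omega
  intro m
  induction m with
  | zero =>
    intro _ S E hS hE _
    have hS : S = 0 := Multiset.eq_zero_of_forall_notMem fun x hx => by simpa using hS x hx
    have hE : E = 0 := Multiset.eq_zero_of_forall_notMem fun x hx => by simpa using hE x hx
    subst hS hE
    simpa using Achievable.empty
  | succ l ih =>
    intro hl S E hS hE hcount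
    obtain ⟨σ, S, rfl, hS'⟩ := exists_eq_replicate_add hS
    clear hS
    rename' hS' => hS
    obtain ⟨ε, E, rfl, hE'⟩ := exists_eq_replicate_add hE
    clear hE
    rename' hE' => hE
    have hS0 : (S.map (anc pp l)).sum = 0 := sum_anc_eq_zero hS
    have hE0 : (E.map (anc pp l)).sum = 0 := sum_anc_eq_zero hE
    simp only [countP_replicate_add] at hcount
    rw [← insert_image_Iio]
    -- If `l` is the root of its class, the rest of the class has already been folded into it: the
    -- class is now `{l}`, and its robots, at least one, just stay.
    by_cases hroot : κ l = l
    · have hSl : S.countP (fun y => κ y = l) = 0 := by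
        rw [Multiset.countP_eq_zero]
        intro y hy
        have := hS y hy
        have := hle y (by omega)
        omega
      have hEl : E.countP (fun y => κ y = l) = 0 := by
        rw [Multiset.countP_eq_zero]
        intro y hy
        have := hE y hy
        have := hle y (by omega)
        omega
      have h1 := hcount l (by omega) hroot
      rw [hSl, hEl, if_pos hroot, if_pos hroot] at h1
      obtain rfl : σ = ε := by omega
      have h2 := ih (by omega) S E hS hE fun c hc hcr => by
        have h3 := hcount c (by omega) hcr
        rwa [hroot, if_neg (by omega), zero_add, zero_add] at h3
      have h3 := h2.stay_many (x := q l) σ (by omega)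
      rw [Multiset.map_add, Multiset.map_add, Multiset.map_replicate]
      convert h3 using 1
      have hcg : ∑ j ∈ Finset.Ico 1 l, flowCost pp κ (Multiset.replicate σ l + S)
          (Multiset.replicate σ l + E) j = ∑ j ∈ Finset.Ico 1 l, flowCost pp κ S E j := by
        refine sum_flowCost_congr fun j hj hjl => ?_
        rw [sum_anc_replicate_add, sum_anc_replicate_add, gap_add_left]
      rw [← hcg]
      rcases Nat.eq_zero_or_pos l with rfl | hl0
      · simp
      · rw [Finset.sum_Ico_succ_top hl0, flowCost, if_pos hroot, add_zero]
    · have hl0 : 0 < l := by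
        rcases Nat.eq_zero_or_pos l with rfl | hl0
        · exact absurd hκ0 hroot
        · exact hl0
      have hp := h.pp_lt l hl0 (by omega)
      have hadj := h.adj l hl0 (by omega)
      have hκp : κ l = κ (pp l) := (hκ l hl0 (by omega)).resolve_right hroot
      have hanc : ∀ j, j < l → anc pp j l = anc pp j (pp l) := fun j hj => by
        rw [anc_of_pos hl0 hp, if_neg (by omega), zero_add]
      have hpC : q (pp l) ∈ q '' Set.Iio l := ⟨pp l, hp, rfl⟩
      have hlcost : flowCost pp κ (Multiset.replicate σ l + S) (Multiset.replicate ε l + E) l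
          = wt (gap σ ε) := by
        rw [flowCost, if_neg hroot, sum_anc_replicate_add, sum_anc_replicate_add, hS0, hE0,
          anc_self]
        simp
      rw [Finset.sum_Ico_succ_top hl0, hlcost]
      -- reduction to the tree without the leaf `l`
      have key : ∀ a b : ℕ, a + ε = b + σ → (0 < σ → ε ≤ σ → 0 < a) →
          Achievable T (Multiset.replicate a (q (pp l)) + S.map q)
            (Multiset.replicate b (q (pp l)) + E.map q)
            (∑ j ∈ Finset.Ico 1 l, flowCost pp κ (Multiset.replicate σ l + S)
              (Multiset.replicate ε l + E) j) (q '' Set.Iio l) := by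
        intro a b hab hpos
        have h2 := ih (by omega) (Multiset.replicate a (pp l) + S)
          (Multiset.replicate b (pp l) + E)
          (fun x hx => by
            rcases Multiset.mem_add.1 hx with hx | hx
            · rw [Multiset.eq_of_mem_replicate hx]; exact hp
            · exact hS x hx)
          (fun x hx => by
            rcases Multiset.mem_add.1 hx with hx | hx
            · rw [Multiset.eq_of_mem_replicate hx]; exact hp
            · exact hE x hx)
          -- The class of the parent keeps a starting point. Here `a = 0` is allowed only if `σ =
          -- 0`, where no start is lost, or if `σ < ε`, where the equality of the counts forces a
          -- start elsewhere in the class.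
          (fun c hc hcr => by
            have h3 := hcount c (by omega) hcr
            rw [countP_replicate_add, countP_replicate_add]
            rw [hκp] at h3
            split_ifs at h3 ⊢ <;> omega)
        rw [Multiset.map_add, Multiset.map_add, Multiset.map_replicate,
          Multiset.map_replicate] at h2
        convert h2 using 1
        refine sum_flowCost_congr fun j hj hjl => ?_
        rw [sum_anc_replicate_add, sum_anc_replicate_add, sum_anc_replicate_add,
          sum_anc_replicate_add, hanc j hjl]
        -- By `a + ε = b + σ`, replacing the robots at the leaf by those at its parent preserves
        -- every net flow further up.
        have h4 : anc pp j (pp l) = 0 ∨ anc pp j (pp l) = 1 := by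
          have := anc_le_one (pp := pp) j (pp l)
          omega
        rcases h4 with h4 | h4 <;> rw [h4] <;> unfold gap <;> omega
      rw [Multiset.map_add, Multiset.map_add, Multiset.map_replicate, Multiset.map_replicate]
      -- The surplus of ends over starts at the leaf has to enter it, a surplus of starts has to
      -- leave it, and in the balanced case the edge is crossed once in each direction.
      rcases lt_trichotomy σ ε with hlt | rfl | hlt
      · obtain ⟨d, rfl⟩ := Nat.exists_eq_add_of_lt hlt
        have h2 := key 0 (d + 1) (by omega) (by omega)
        rw [Multiset.replicate_zero, zero_add] at h2
        have h3 := (h2.snoc_end_many hadj.symm (d + 1) (by omega)).stay_many' σ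
        rw [← add_assoc, ← Multiset.replicate_add] at h3
        rw [show gap σ (σ + d + 1) = d + 1 by unfold gap; omega, wt_of_pos (by omega)]
        exact h3
      · rw [show gap σ σ = 0 by simp [gap], wt_zero]
        rcases Nat.eq_zero_or_pos σ with rfl | hσ
        · have h2 := key 0 0 (by omega) (by omega)
          exact h2.loop hadj.symm hpC
        -- A detour from the parent is not available in general, as all starts of the class may lie
        -- at `l`. So one robot leaves `l` and one arrives there, while the other `σ - 1` stay.
        · have h2 := key 1 1 (by omega) (by omega)
          have h3 := h2.snoc_end_many hadj.symm 1 (by omega)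
          have h4 := (h3.cons_start_many hadj 1 (by omega))
          rw [Set.insert_idem] at h4
          have h5 := h4.stay_many' (σ - 1)
          rw [← add_assoc, ← Multiset.replicate_add, ← add_assoc, ← Multiset.replicate_add] at h5
          rwa [show σ - 1 + 1 = σ by omega] at h5
      · obtain ⟨d, rfl⟩ := Nat.exists_eq_add_of_lt hlt
        have h2 := key (d + 1) 0 (by omega) (by omega)
        rw [Multiset.replicate_zero, zero_add] at h2
        have h3 := (h2.cons_start_many hadj (d + 1) (by omega)).stay_many' ε
        rw [← add_assoc, ← Multiset.replicate_add] at h3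
        rw [show gap (ε + d + 1) ε = d + 1 by unfold gap; omega, wt_of_pos (by omega)]
        exact h3

end Upper

end TreeCover

namespace TreeCover

/-! ### From multisets of walks to indexed strategies -/

section Families

variable {V : Type*} {G : SimpleGraph V}

theorem exists_add_of_map_eq_add {α β : Type*} {f : α → β} {A B : Multiset β} :
    ∀ {M : Multiset α}, M.map f = A + B →
      ∃ M₁ M₂, M = M₁ + M₂ ∧ M₁.map f = A ∧ M₂.map f = B := by
  classical
  induction A using Multiset.induction_on with
  | empty =>
    intro M h
    exact ⟨0, M, by simp, by simp, by simpa using h⟩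
  | cons a A ih =>
    intro M h
    rw [Multiset.cons_add] at h
    obtain ⟨x, hx, hxa, hM⟩ := (Multiset.map_eq_cons _ _ _ _).2 h
    obtain ⟨M, rfl⟩ := Multiset.exists_cons_of_mem hx
    rw [Multiset.erase_cons_head] at hM
    obtain ⟨M₁, M₂, rfl, h1, h2⟩ := ih hM
    exact ⟨x ::ₘ M₁, M₂, by simp, by simp [hxa, h1], h2⟩

/-- Robots with a common source are interchangeable, so a multiset of walks can be indexed by `Fin
k` at will, as `twoSourcesLengths` requires. -/
theorem exists_family_of_map_eq_replicate {α β : Type*} {f : α → β} {M : Multiset α} {k : ℕ}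
    {b : β} (h : M.map f = Multiset.replicate k b) :
    ∃ F : Fin k → α, Finset.univ.val.map F = M ∧ ∀ i, f (F i) = b := by
  induction M using Quotient.inductionOn with
  | h L =>
    have hk : L.length = k := by simpa using congrArg Multiset.card h
    subst hk
    refine ⟨L.get, ?_, fun i => ?_⟩
    · rw [Fin.univ_val_map, List.ofFn_get]
      rfl
    · have : f (L.get i) ∈ Multiset.map f (Quotient.mk _ L) :=
        Multiset.mem_map_of_mem f (List.get_mem L i)
      rw [h] at this
      exact Multiset.eq_of_mem_replicate this

theorem strategyLength_sum [DecidableEq V] {k l : ℕ} (F : Fin k → List V) (H : Fin l → List V) :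
    strategyLength (Sum.elim F H) = ((Finset.univ.val.map F).map walkLength).sum
      + ((Finset.univ.val.map H).map walkLength).sum := by
  rw [strategyLength, Fintype.sum_sum_type]
  simp only [Sum.elim_inl, Sum.elim_inr, Multiset.map_map]
  rfl

/-- If one of the robots starts at `x` and one of them ends at `x`, then the strategy can be
modified such that some robot starts and ends at `x`. -/
theorem Achievable.exists_round_trip [DecidableEq V] {S E : Multiset V} {c : ℕ} {C : Set V} {x : V}
    (h : Achievable G (x ::ₘ S) (x ::ₘ E) c C) :
    ∃ (W : List V) (M : Multiset (List V)), IsWalk G W ∧ W.head? = some x ∧ W.getLast? = some x ∧ (∀ U ∈ M, IsWalk G U) ∧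
      M.map List.head? = S.map some ∧ walkLength W + (M.map walkLength).sum = c ∧
      ∀ y ∈ C, y ∈ W ∨ ∃ U ∈ M, y ∈ U := by
  obtain ⟨M, h1, h2, h3, h4, h5⟩ := h
  rw [Multiset.map_cons] at h2
  obtain ⟨W, hWM, hWx, hM⟩ := (Multiset.map_eq_cons _ _ _ _).2 h2
  obtain ⟨M, rfl⟩ := Multiset.exists_cons_of_mem hWM
  rw [Multiset.erase_cons_head] at hM
  rw [Multiset.map_cons, Multiset.sum_cons] at h4
  by_cases hl : W.getLast? = some x
  · refine ⟨W, M, h1 W (by simp), hWx, hl, fun U hU => h1 U (by simp [hU]), hM, h4, ?_⟩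
    intro y hy
    simpa using h5 y hy
  · obtain ⟨B, rfl⟩ : ∃ B, W = x :: B := by
      cases W with
      | nil => simp at hWx
      | cons a B => simp at hWx; exact ⟨B, by rw [hWx]⟩
    have hx : some x ∈ ((x :: B) ::ₘ M).map List.getLast? := by rw [h3]; simp
    rw [Multiset.map_cons, Multiset.mem_cons] at hx
    obtain ⟨U, hU, hUx⟩ := Multiset.mem_map.1 (hx.resolve_left fun h => hl h.symm)
    obtain ⟨M, rfl⟩ := Multiset.exists_cons_of_mem hU
    obtain ⟨A, rfl⟩ := exists_eq_append_of_getLast? hUx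
    -- The walk that ends at `x` and the one that starts at `x` are concatenated. This costs nothing
    -- and frees a robot, which stays at `x`.
    refine ⟨[x], (A ++ x :: B) ::ₘ M, IsWalk.singleton x, by simp, by simp, ?_, ?_, ?_, ?_⟩
    · intro U hU
      rcases Multiset.mem_cons.1 hU with rfl | hU
      · exact isWalk_append.2 ⟨h1 _ (by simp), h1 _ (by simp)⟩
      · exact h1 U (by simp [hU])
    · rw [← hM]
      cases A <;> simp
    · rw [← h4, Multiset.map_cons, Multiset.sum_cons, Multiset.map_cons, Multiset.sum_cons,
        walkLength_append]
      simp only [walkLength]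
      omega
    · intro y hy
      obtain ⟨U, hU, hyU⟩ := h5 y hy
      simp only [Multiset.mem_cons] at hU
      right
      rcases hU with rfl | rfl | hU
      · exact ⟨_, Multiset.mem_cons_self _ _, by simp at hyU ⊢; tauto⟩
      · exact ⟨_, Multiset.mem_cons_self _ _, by simp at hyU ⊢; tauto⟩
      · exact ⟨U, by simp [hU], hyU⟩

/-- The additional robot in the two-source problem. -/
def extraRobot {α : Type*} (u v : α) (s t : ℕ) : Multiset α :=
  if s = 0 then {u} else if t = 0 then {v} else 0

/-- It is enough that as many additional walks start as end at the source of the extra robot;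
`Achievable.exists_round_trip` then makes one robot return. -/
theorem mem_twoSourcesLengths [DecidableEq V] {u v : V} {s t c : ℕ} {E : Multiset V}
    (h : Achievable G (extraRobot u v s t + (Multiset.replicate s u + Multiset.replicate t v))
      (extraRobot u v s t + E) c Set.univ) : c ∈ twoSourcesLengths G u v s t := by
  unfold extraRobot at h
  unfold twoSourcesLengths
  have walk_of : ∀ {k : ℕ} {F : Fin k → List V} {M : Multiset (List V)},
      Finset.univ.val.map F = M → (∀ U ∈ M, IsWalk G U) → ∀ i, IsWalk G (F i) := by
    rintro k F M rfl hM i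
    exact hM _ (Multiset.mem_map_of_mem _ (Finset.mem_univ i))
  have idx_of : ∀ {k : ℕ} {F : Fin k → List V} {M : Multiset (List V)} {U : List V},
      Finset.univ.val.map F = M → U ∈ M → ∃ i, F i = U := by
    rintro k F M U rfl hU
    obtain ⟨i, -, hi⟩ := Multiset.mem_map.1 hU
    exact ⟨i, hi⟩
  split_ifs at h ⊢ with hs ht
  · subst hs
    rw [Multiset.replicate_zero, zero_add, Multiset.singleton_add, Multiset.singleton_add] at h
    obtain ⟨W, M, h1, h2, h3, h4, h5, h6, h7⟩ := Achievable.exists_round_trip h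
    rw [Multiset.map_replicate] at h5
    obtain ⟨F, rfl, hF2⟩ := exists_family_of_map_eq_replicate h5
    refine ⟨Sum.elim (fun _ => W) F, ⟨?_, ?_⟩, fun i => ⟨h2, h3⟩, hF2, ?_⟩
    · rintro (i | i)
      exacts [h1, walk_of rfl h4 i]
    · intro x
      rcases h7 x trivial with hx | ⟨U, hU, hx⟩
      · exact ⟨Sum.inl 0, hx⟩
      · obtain ⟨i, rfl⟩ := idx_of rfl hU
        exact ⟨Sum.inr i, hx⟩
    · rw [strategyLength_sum, ← h6]
      simp
  · subst ht
    rw [Multiset.replicate_zero, add_zero, Multiset.singleton_add, Multiset.singleton_add] at h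
    obtain ⟨W, M, h1, h2, h3, h4, h5, h6, h7⟩ := Achievable.exists_round_trip h
    rw [Multiset.map_replicate] at h5
    obtain ⟨F, rfl, hF2⟩ := exists_family_of_map_eq_replicate h5
    refine ⟨Sum.elim F (fun _ => W), ⟨?_, ?_⟩, hF2, fun i => ⟨h2, h3⟩, ?_⟩
    · rintro (i | i)
      exacts [walk_of rfl h4 i, h1]
    · intro x
      rcases h7 x trivial with hx | ⟨U, hU, hx⟩
      · exact ⟨Sum.inr 0, hx⟩
      · obtain ⟨i, rfl⟩ := idx_of rfl hU
        exact ⟨Sum.inl i, hx⟩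
    · rw [strategyLength_sum, ← h6, add_comm]
      simp
  · rw [zero_add, zero_add] at h
    obtain ⟨M, h1, h2, h3, h4, h5⟩ := h
    rw [Multiset.map_add, Multiset.map_replicate, Multiset.map_replicate] at h2
    obtain ⟨M₁, M₂, rfl, h6, h7⟩ := exists_add_of_map_eq_add h2
    obtain ⟨F, rfl, hF2⟩ := exists_family_of_map_eq_replicate h6
    obtain ⟨H, rfl, hH2⟩ := exists_family_of_map_eq_replicate h7
    refine ⟨Sum.elim F H, ⟨?_, ?_⟩, hF2, hH2, ?_⟩
    · rintro (i | i)
      exacts [walk_of rfl (fun U hU => h1 U (Multiset.mem_add.2 (Or.inl hU))) i,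
        walk_of rfl (fun U hU => h1 U (Multiset.mem_add.2 (Or.inr hU))) i]
    · intro x
      obtain ⟨U, hU, hx⟩ := h5 x trivial
      rcases Multiset.mem_add.1 hU with hU | hU
      · obtain ⟨i, rfl⟩ := idx_of rfl hU
        exact ⟨Sum.inl i, hx⟩
      · obtain ⟨i, rfl⟩ := idx_of rfl hU
        exact ⟨Sum.inr i, hx⟩
    · rw [strategyLength_sum, ← h4, Multiset.map_add, Multiset.sum_add]

end Families

/-! ### The upper bound: flow costs are lengths of strategies -/

section Upper

variable {n : ℕ} {T : SimpleGraph (Fin n)} {u : Fin n} {q : ℕ → Fin n} {pos : Fin n → ℕ}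
  {pp : ℕ → ℕ}

/-- The number of robots that end in the subtree of `j`, if `E x` robots end at `x`. -/
def arrivals (pp : ℕ → ℕ) (n : ℕ) (E : ℕ → ℕ) (j : ℕ) : ℕ :=
  ∑ x ∈ Finset.range n, E x * anc pp j x

/-- The cost of the edge above `j` if `t` robots start at `w`, the other ones start at the root,
`E x` robots end at `x`, and the edge above `r` is not used. -/
def linkCost (pp : ℕ → ℕ) (n w t : ℕ) (E : ℕ → ℕ) (r j : ℕ) : ℕ :=
  if j = r then 0 else wt (gap (t * anc pp j w) (arrivals pp n E j))

/-- The edge above `r` may be left out (where `r = 0` stands for no edge). -/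
def Omissible (pp : ℕ → ℕ) (n w t : ℕ) (E : ℕ → ℕ) (r : ℕ) : Prop :=
  r < n ∧ (r = 0 ∨ anc pp r w = 1 ∧ arrivals pp n E r = t)

/-- For `κ y = r * anc pp r y` the classes are the subtree of `r`, with root `r`, and its
complement, with root `0`. The numbers of robots in them are read off from the flow sums. -/
theorem countP_class (r : ℕ) (hr : 0 < r) (S : Multiset ℕ) :
    S.countP (fun y => r * anc pp r y = r) = (S.map (anc pp r)).sum ∧
    S.countP (fun y => r * anc pp r y = 0) + (S.map (anc pp r)).sum = S.card := by
  induction S using Multiset.induction_on with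
  | empty => simp
  | cons a S ih =>
    have h : anc pp r a = 0 ∨ anc pp r a = 1 := by
      have := anc_le_one (pp := pp) r a
      omega
    rw [Multiset.countP_cons, Multiset.countP_cons, Multiset.map_cons, Multiset.sum_cons,
      Multiset.card_cons]
    rcases h with h | h <;> rw [h] <;>
      simp only [mul_zero, mul_one, if_true, hr.ne, hr.ne', if_false] <;> omega

theorem sum_map_sum_replicate (n : ℕ) (E f : ℕ → ℕ) :
    ((∑ x ∈ Finset.range n, Multiset.replicate (E x) x).map f).sum
      = ∑ x ∈ Finset.range n, E x * f x := by
  induction n with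
  | zero => simp
  | succ n ih => rw [Finset.sum_range_succ, Finset.sum_range_succ, Multiset.map_add,
      Multiset.sum_add, ih]; simp

theorem Rooting.linkCost_mem (h : Rooting T u q pos pp) {v : Fin n} {s t : ℕ} (hst : 0 < s + t)
    {E : ℕ → ℕ} (hE : ∑ x ∈ Finset.range n, E x = s + t) {r : ℕ}
    (hr : Omissible pp n (pos v) t E r) :
    ∑ j ∈ Finset.Ico 1 n, linkCost pp n (pos v) t E r j ∈ twoSourcesLengths T u v s t := by
  have hn : 0 < n := u.pos
  have hqu : q 0 = u := by rw [← h.pos_root, h.q_pos]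
  have hqC : q '' Set.Iio n = Set.univ := by
    ext x
    simpa using ⟨pos x, h.pos_lt x, h.q_pos x⟩
  set X : Multiset ℕ := extraRobot 0 (pos v) s t with hX
  have hXq : X.map q = extraRobot u v s t := by
    rw [hX]
    unfold extraRobot
    split_ifs <;> simp [hqu, h.q_pos]
  have hXlt : ∀ x ∈ X, x < n := by
    intro x hx
    rw [hX] at hx
    unfold extraRobot at hx
    split_ifs at hx <;> simp at hx <;> subst hx
    exacts [hn, h.pos_lt v]
  set E' : Multiset ℕ := ∑ x ∈ Finset.range n, Multiset.replicate (E x) x with hE'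
  have hEcard : E'.card = s + t := by
    have := sum_map_sum_replicate n E (fun _ => 1)
    simp only [Multiset.map_const', Multiset.sum_replicate, smul_eq_mul, mul_one] at this
    rw [hE', this, hE]
  have hEsum : ∀ j, (E'.map (anc pp j)).sum = arrivals pp n E j := fun j =>
    sum_map_sum_replicate n E (anc pp j)
  set S' : Multiset ℕ := Multiset.replicate s 0 + Multiset.replicate t (pos v) with hS'
  have hScard : S'.card = s + t := by simp [hS']
  have hSsum : ∀ j, 0 < j → (S'.map (anc pp j)).sum = t * anc pp j (pos v) := fun j hj => by
    simp [hS', anc_zero, hj.ne']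
  -- This `κ` describes the two components left after removing the edge above `r`; for `r = 0` there
  -- is a single class, and no edge is removed.
  have hmain := h.achievable (κ := fun y => r * anc pp r y) (by
      rcases Nat.eq_zero_or_pos r with rfl | hr0
      · simp
      · simp [anc_zero, hr0.ne'])
    (by
      intro j hj hjn
      have := h.pp_lt j hj hjn
      simp only [anc_of_pos hj this]
      by_cases hjr : r = j
      · subst hjr
        simp [anc_of_lt this]
      · simp [hjr]) n le_rfl (X + S') (X + E')
    (by
      intro x hx
      rw [hS', Multiset.mem_add, Multiset.mem_add] at hx
      rcases hx with hx | hx | hx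
      · exact hXlt x hx
      · rw [Multiset.eq_of_mem_replicate hx]; exact hn
      · rw [Multiset.eq_of_mem_replicate hx]; exact h.pos_lt v)
    (by
      intro x hx
      rw [Multiset.mem_add] at hx
      rcases hx with hx | hx
      · exact hXlt x hx
      · rw [hE', Multiset.mem_sum] at hx
        obtain ⟨y, hy, hx⟩ := hx
        rw [Multiset.eq_of_mem_replicate hx]
        simpa using hy)
    (by
      intro c hc hcr
      rcases Nat.eq_zero_or_pos r with rfl | hr0
      · obtain rfl : c = 0 := by simpa using hcr.symm
        rw [Multiset.countP_eq_card.2 (by simp), Multiset.countP_eq_card.2 (by simp),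
          Multiset.card_add X S', Multiset.card_add X E', hScard, hEcard]
        omega
      · have hr1 := hr.2.resolve_left hr0.ne'
        have hS1 := countP_class (pp := pp) r hr0 (X + S')
        have hE1 := countP_class (pp := pp) r hr0 (X + E')
        rw [Multiset.map_add, Multiset.sum_add, Multiset.card_add, hSsum r hr0, hr1.1,
          hScard] at hS1
        rw [Multiset.map_add, Multiset.sum_add, Multiset.card_add, hEsum r, hr1.2,
          hEcard] at hE1
        -- The round-trip robot is outside the subtree of `r` if `s = 0`, and inside it if `t = 0`.
        -- So both classes contain a start in all cases.
        have hX1 : (X.map (anc pp r)).sum ≤ X.card ∧ (s = 0 → (X.map (anc pp r)).sum < X.card) ∧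
            (t = 0 → 0 < (X.map (anc pp r)).sum) := by
          rw [hX]
          unfold extraRobot
          split_ifs <;> simp [anc_zero, hr0.ne', hr1.1] <;> omega
        have hc : c = 0 ∨ c = r := by
          have := anc_le_one (pp := pp) r c
          have h01 : anc pp r c = 0 ∨ anc pp r c = 1 := by omega
          rcases h01 with h01 | h01 <;> rw [h01] at hcr <;> omega
        rcases hc with rfl | rfl <;> omega)
  rw [hqC, Multiset.map_add, Multiset.map_add _ X E', hXq, hS', Multiset.map_add, Multiset.map_replicate,
    Multiset.map_replicate, hqu, h.q_pos] at hmain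
  have := mem_twoSourcesLengths hmain
  convert this using 1
  refine Finset.sum_congr rfl fun j hj => ?_
  have hj1 : 0 < j := by rw [Finset.mem_Ico] at hj; omega
  -- The only nonroot position that represents its own class is `r`, so `flowCost` and `linkCost`
  -- omit the same edge.
  have hcond : (r * anc pp r j = j) ↔ j = r := by
    constructor
    · intro hh
      have h01 : anc pp r j = 0 ∨ anc pp r j = 1 := by
        have := anc_le_one (pp := pp) r j
        omega
      rcases h01 with h01 | h01 <;> rw [h01] at hh <;> omega
    · rintro rfl
      rw [anc_self, mul_one]
  rw [linkCost, flowCost]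
  simp only [hcond]
  rw [← hS', Multiset.map_add, Multiset.map_add _ X E', Multiset.sum_add, Multiset.sum_add, hSsum j hj1,
    hEsum, gap_add_left]

theorem Rooting.two_mul_mem (h : Rooting T u q pos pp) (v : Fin n) :
    2 * (n - 1) ∈ twoSourcesLengths T u v 0 0 := by
  have hn : 0 < n := u.pos
  have hqu : q 0 = u := by rw [← h.pos_root, h.q_pos]
  have hqC : q '' Set.Iio n = Set.univ := by
    ext x
    simpa using ⟨pos x, h.pos_lt x, h.q_pos x⟩
  have hmain := h.achievable (κ := fun _ => 0) rfl (fun _ _ _ => Or.inl rfl) n le_rfl {0} {0}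
    (by simpa using hn) (by simpa using hn) (by rintro c - rfl; simp)
  rw [hqC, Multiset.map_singleton, hqu] at hmain
  apply mem_twoSourcesLengths (E := 0)
  simp only [extraRobot, if_true, Multiset.replicate_zero, add_zero]
  convert hmain using 1
  rw [Finset.sum_congr rfl (g := fun _ => 2) fun j hj => ?_]
  · simp [mul_comm]
  · rw [Finset.mem_Ico] at hj
    rw [flowCost, if_neg (by omega)]
    simp [gap, wt]

end Upper

end TreeCover

namespace TreeCover

/-! ## Lower bounds for strategies -/

section Crossings

variable {V : Type*} {G : SimpleGraph V}

/-- The number of times the value of `g` changes along a walk (weighted by the changes). -/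
def crossings (g : V → ℕ) : List V → ℕ
  | [] => 0
  | [_] => 0
  | x :: y :: W => gap (g x) (g y) + crossings g (y :: W)

/-- With `g j` the indicator of the subtree of `j`, each move along an edge changes just one
indicator. So the crossings of different edges add up to at most the length. -/
theorem sum_crossings_le [DecidableEq V] {J : Finset ℕ} {g : ℕ → V → ℕ}
    (hg : ∀ x y, G.Adj x y → ∑ j ∈ J, gap (g j x) (g j y) ≤ 1) :
    ∀ {W : List V}, W.IsChain (fun x y => G.Adj x y ∨ x = y) →
      ∑ j ∈ J, crossings (g j) W ≤ walkLength W
  | [], _ => by simp [crossings]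
  | [_], _ => by simp [crossings]
  | x :: y :: W, h => by
    rw [List.isChain_cons_cons] at h
    have ih := sum_crossings_le hg h.2
    simp only [crossings, walkLength, Finset.sum_add_distrib]
    refine Nat.add_le_add ?_ ih
    split_ifs with hxy
    · subst hxy
      simp [gap]
    · exact hg x y (h.1.resolve_right hxy)

/-- For an indicator, the parity statement upgrades a positive number of crossings to at least two
when the flow is zero; the last clause says that a robot which never crosses an edge stays on its
side. -/
theorem crossings_spec (g : V → ℕ) : ∀ (W : List V) (x y : V), W.head? = some x →
    W.getLast? = some y → gap (g x) (g y) ≤ crossings g W ∧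
      crossings g W % 2 = (g x + g y) % 2 ∧ (crossings g W = 0 → ∀ z ∈ W, g z = g x)
  | [], _, _, h, _ => by simp at h
  | [a], x, y, h1, h2 => by
    simp at h1 h2
    subst h1 h2
    simp [crossings, gap]
    omega
  | a :: b :: W, x, y, h1, h2 => by
    simp only [List.head?_cons, Option.some.injEq] at h1
    subst h1
    rw [List.getLast?_cons_cons] at h2
    obtain ⟨h3, h4, h5⟩ := crossings_spec g (b :: W) b y rfl h2
    simp only [crossings]
    refine ⟨by unfold gap at *; omega, by unfold gap at *; omega, fun h0 z hz => ?_⟩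
    have hab : g a = g b := by unfold gap at h0; omega
    rcases List.mem_cons.1 hz with rfl | hz
    · rfl
    · rw [hab]
      exact h5 (by omega) z hz

end Crossings

section Lower

variable {n : ℕ} {T : SimpleGraph (Fin n)} {u : Fin n} {q : ℕ → Fin n} {pos : Fin n → ℕ}
  {pp : ℕ → ℕ}

theorem Rooting.sum_gap_le (h : Rooting T u q pos pp) (x y : Fin n) (hxy : T.Adj x y) :
    ∑ j ∈ Finset.Ico 1 n, gap (anc pp j (pos x)) (anc pp j (pos y)) ≤ 1 := by
  have key : ∀ a b : ℕ, 0 < a → a < n → pp a = b → ∀ j,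
      gap (anc pp j a) (anc pp j b) = if j = a then 1 else 0 := by
    rintro a b ha han rfl j
    rw [anc_of_pos ha (h.pp_lt a ha han), add_comm]
    unfold gap
    split_ifs <;> omega
  have gap_comm : ∀ a b, gap a b = gap b a := fun a b => by unfold gap; omega
  rcases h.parent x y hxy with ⟨h1, h2⟩ | ⟨h1, h2⟩
  · rw [Finset.sum_congr rfl fun j _ => key _ _ h1 (h.pos_lt x) h2 j, Finset.sum_ite_eq']
    split_ifs <;> omega
  · rw [Finset.sum_congr rfl fun j _ => (gap_comm _ _).trans (key _ _ h1 (h.pos_lt y) h2 j),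
      Finset.sum_ite_eq']
    split_ifs <;> omega

/-- The lower bound for strategies all of whose robots start at `u` or `v`. -/
theorem Rooting.lower_bound (h : Rooting T u q pos pp) {v : Fin n} {ι : Type*} [Fintype ι]
    {S : ι → List (Fin n)} (hS : IsCoveringStrategy T S) {st en : ι → Fin n}
    (hst : ∀ i, StartsAt (st i) (S i)) (hen : ∀ i, EndsAt (en i) (S i))
    (huv : ∀ i, st i = u ∨ st i = v) :
    ∃ r < n, (r = 0 ∨ anc pp r (pos v) = 1 ∧ (∃ i, st i ≠ u) ∧
      ∑ i, anc pp r (pos (st i)) = ∑ i, anc pp r (pos (en i))) ∧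
      ∑ j ∈ Finset.Ico 1 n, (if j = r then 0 else
        wt (gap (∑ i, anc pp j (pos (st i))) (∑ i, anc pp j (pos (en i))))) ≤
          strategyLength S := by
  classical
  have hn : 0 < n := u.pos
  set X : ℕ → ℕ := fun j => ∑ i, crossings (fun x => anc pp j (pos x)) (S i) with hX
  have hspec := fun (j : ℕ) (i : ι) =>
    crossings_spec (fun x => anc pp j (pos x)) (S i) (st i) (en i) (hst i) (hen i)
  have hXle : ∑ j ∈ Finset.Ico 1 n, X j ≤ strategyLength S := by
    rw [hX, Finset.sum_comm]
    exact Finset.sum_le_sum fun i _ =>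
      sum_crossings_le (g := fun j x => anc pp j (pos x)) h.sum_gap_le (hS.1 i).2
  have hXgap : ∀ j, gap (∑ i, anc pp j (pos (st i))) (∑ i, anc pp j (pos (en i))) ≤ X j ∧
      X j % 2 = (∑ i, anc pp j (pos (st i)) + ∑ i, anc pp j (pos (en i))) % 2 := by
    intro j
    simp only [hX]
    induction (Finset.univ : Finset ι) using Finset.induction_on with
    | empty => simp [gap]
    | insert i s hi ih =>
      rw [Finset.sum_insert hi, Finset.sum_insert hi, Finset.sum_insert hi]
      have h1 := (hspec j i).1
      have h2 := (hspec j i).2.1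
      unfold gap at *
      omega
  have hX0 : ∀ j, X j = 0 → ∀ i, ∀ x ∈ S i, anc pp j (pos x) = anc pp j (pos (st i)) := by
    intro j hj i
    exact (hspec j i).2.2 ((Finset.sum_eq_zero_iff.1 hj) i (Finset.mem_univ i))
  -- If the edge above `j` is unused, whoever visits `q j` must have started below that edge, hence
  -- at `v`.
  have hXstart : ∀ j, 0 < j → j < n → X j = 0 → ∃ i, st i ≠ u ∧ anc pp j (pos v) = 1 := by
    intro j hj hjn h0
    obtain ⟨i, hi⟩ := hS.2 (q j)
    have h1 := hX0 j h0 i _ hi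
    rw [h.pos_q j hjn, anc_self] at h1
    have h2 : st i ≠ u := by
      intro h3
      rw [h3, h.pos_root, anc_zero, if_neg hj.ne'] at h1
      omega
    exact ⟨i, h2, by rw [← (huv i).resolve_left h2, ← h1]⟩
  -- With two unused edges, the visitor of `q j` starts below `j` but not below `j'`. The first
  -- excludes `u`, the second excludes `v`, which lies below `j'`.
  have hXuniq : ∀ j j', 0 < j → j < j' → j' < n → X j = 0 → X j' ≠ 0 := by
    intro j j' hj hjj hjn h0 h0'
    obtain ⟨i, hi⟩ := hS.2 (q j)
    have h1 := hX0 j h0 i _ hi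
    have h2 := hX0 j' h0' i _ hi
    rw [h.pos_q j (by omega), anc_self] at h1
    rw [h.pos_q j (by omega), anc_of_lt hjj] at h2
    obtain ⟨i', -, hv⟩ := hXstart j' (by omega) hjn h0'
    rcases huv i with h3 | h3
    · rw [h3, h.pos_root, anc_zero, if_neg hj.ne'] at h1
      omega
    · rw [h3, hv] at h2
      omega
  -- With zero flow the number of crossings is even, so being nonzero it is at least two.
  have hwt : ∀ j, X j ≠ 0 →
      wt (gap (∑ i, anc pp j (pos (st i))) (∑ i, anc pp j (pos (en i)))) ≤ X j := by
    intro j hj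
    have := hXgap j
    unfold wt
    unfold gap at *
    omega
  by_cases hr : ∃ r, 0 < r ∧ r < n ∧ X r = 0
  · obtain ⟨r, hr0, hrn, hXr⟩ := hr
    obtain ⟨i, hi, hv⟩ := hXstart r hr0 hrn hXr
    refine ⟨r, hrn, Or.inr ⟨hv, ⟨i, hi⟩, ?_⟩, (Finset.sum_le_sum fun j hj => ?_).trans hXle⟩
    · have := hXgap r
      unfold gap at this
      omega
    · rw [Finset.mem_Ico] at hj
      split_ifs with hjr
      · omega
      · refine hwt j fun h0 => ?_
        rcases lt_or_gt_of_ne hjr with hlt | hlt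
        · exact hXuniq j r (by omega) hlt hrn h0 hXr
        · exact hXuniq r j hr0 hlt hj.2 hXr h0
  · push Not at hr
    refine ⟨0, hn, Or.inl rfl, (Finset.sum_le_sum fun j hj => ?_).trans hXle⟩
    rw [Finset.mem_Ico] at hj
    rw [if_neg (by omega)]
    exact hwt j (hr j (by omega) hj.2)

theorem exists_endsAt {V : Type*} {ι : Type*} {S : ι → List V} (h : ∀ i, S i ≠ []) :
    ∃ en : ι → V, ∀ i, EndsAt (en i) (S i) :=
  ⟨fun i => (S i).getLast (h i), fun i => List.getLast?_eq_some_getLast (h i)⟩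

theorem arrivals_count {ι : Type*} [Fintype ι] {e : ι → ℕ} (he : ∀ i, e i < n) (j : ℕ) :
    arrivals pp n (fun x => ∑ i, if e i = x then 1 else 0) j = ∑ i, anc pp j (e i) := by
  unfold arrivals
  simp only [Finset.sum_mul]
  rw [Finset.sum_comm]
  refine Finset.sum_congr rfl fun i _ => ?_
  simp only [ite_mul, one_mul, zero_mul]
  rw [Finset.sum_ite_eq, if_pos (Finset.mem_range.2 (he i))]

theorem sum_count {ι : Type*} [Fintype ι] {e : ι → ℕ} (he : ∀ i, e i < n) :
    ∑ x ∈ Finset.range n, (∑ i, if e i = x then 1 else 0) = Fintype.card ι := by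
  rw [Finset.sum_comm, Finset.sum_congr rfl (g := fun _ => 1)]
  · simp
  · intro i _
    rw [Finset.sum_ite_eq, if_pos (Finset.mem_range.2 (he i))]

/-- The lower bound, if the end points of some robots (`e`) are counted, and the other ones do
not contribute to the net flows. -/
theorem Rooting.exists_linkCost_le_of_strategy (h : Rooting T u q pos pp) {v : Fin n} {t : ℕ}
    {ι κ : Type*} [Fintype ι] [Fintype κ]
    {S : ι → List (Fin n)} (hS : IsCoveringStrategy T S) {st en : ι → Fin n}
    (hst : ∀ i, StartsAt (st i) (S i)) (hen : ∀ i, EndsAt (en i) (S i))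
    (huv : ∀ i, st i = u ∨ st i = v) (e : κ → Fin n)
    (hnet : ∀ j, 0 < j → ∃ a, ∑ i, anc pp j (pos (st i)) = a + t * anc pp j (pos v) ∧
      ∑ i, anc pp j (pos (en i)) = a + ∑ i, anc pp j (pos (e i))) :
    ∃ E r, ∑ x ∈ Finset.range n, E x = Fintype.card κ ∧ Omissible pp n (pos v) t E r ∧
      ∑ j ∈ Finset.Ico 1 n, linkCost pp n (pos v) t E r j ≤ strategyLength S := by
  obtain ⟨r, hrn, hr, hle⟩ := h.lower_bound hS hst hen huv
  refine ⟨fun x => ∑ i, if pos (e i) = x then 1 else 0, r, sum_count fun i => h.pos_lt _,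
    ⟨hrn, ?_⟩, ?_⟩
  · rcases Nat.eq_zero_or_pos r with hr0 | hr0
    · exact Or.inl hr0
    · obtain ⟨h1, -, h2⟩ := hr.resolve_left hr0.ne'
      obtain ⟨a, h3, h4⟩ := hnet r hr0
      rw [arrivals_count fun i => h.pos_lt _]
      right
      rw [h1] at h3
      omega
  · refine le_trans (Finset.sum_le_sum fun j hj => ?_) hle
    rw [Finset.mem_Ico] at hj
    obtain ⟨a, h3, h4⟩ := hnet j (by omega)
    rw [linkCost, arrivals_count fun i => h.pos_lt _, h3, h4, gap_add_left]

/-- In each case `E` counts the ends of the `s + t` ordinary robots only, and the common term `a` of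
`hnet` absorbs the round-trip robot. -/
theorem Rooting.exists_linkCost_le (h : Rooting T u q pos pp) {v : Fin n} {s t : ℕ}
    {l : ℕ} (hl : l ∈ twoSourcesLengths T u v s t) :
    ∃ E r, ∑ x ∈ Finset.range n, E x = s + t ∧ Omissible pp n (pos v) t E r ∧
      ∑ j ∈ Finset.Ico 1 n, linkCost pp n (pos v) t E r j ≤ l := by
  unfold twoSourcesLengths at hl
  split_ifs at hl with hs ht
  · obtain ⟨S, hS, h1, h2, rfl⟩ := hl
    obtain ⟨en, hen⟩ := exists_endsAt fun i => (hS.1 i).1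
    have := h.exists_linkCost_le_of_strategy (v := v) (t := t) hS (st := Sum.elim (fun _ => u) fun _ => v)
      (by rintro (i | i); exacts [(h1 i).1, h2 i]) hen
      (by rintro (i | i); exacts [Or.inl rfl, Or.inr rfl]) (fun i => en (Sum.inr i))
      (fun j hj => by
        refine ⟨0, ?_, ?_⟩
        · simp [h.pos_root, anc_zero, hj.ne']
        · have h3 : en (Sum.inl 0) = u := by
            have h4 := (h1 0).2
            have h5 := hen (Sum.inl 0)
            unfold EndsAt at h4 h5
            rw [h4] at h5
            exact (Option.some.inj h5).symm
          simp [h3, h.pos_root, anc_zero, hj.ne'])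
    simpa [hs] using this
  · obtain ⟨S, hS, h1, h2, rfl⟩ := hl
    obtain ⟨en, hen⟩ := exists_endsAt fun i => (hS.1 i).1
    have := h.exists_linkCost_le_of_strategy (v := v) (t := t) hS (st := Sum.elim (fun _ => u) fun _ => v)
      (by rintro (i | i); exacts [h1 i, (h2 i).1]) hen
      (by rintro (i | i); exacts [Or.inl rfl, Or.inr rfl]) (fun i => en (Sum.inl i))
      (fun j hj => by
        -- The round-trip robot at `v` is counted once below `j` as a start and once as an end.
        refine ⟨anc pp j (pos v), ?_, ?_⟩
        · simp [h.pos_root, anc_zero, hj.ne', ht]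
        · have h3 : en (Sum.inr 0) = v := by
            have h4 := (h2 0).2
            have h5 := hen (Sum.inr 0)
            unfold EndsAt at h4 h5
            rw [h4] at h5
            exact (Option.some.inj h5).symm
          simp [h3, add_comm])
    simpa [ht] using this
  · obtain ⟨S, hS, h1, h2, rfl⟩ := hl
    obtain ⟨en, hen⟩ := exists_endsAt fun i => (hS.1 i).1
    have := h.exists_linkCost_le_of_strategy (v := v) (t := t) hS (st := Sum.elim (fun _ => u) fun _ => v)
      (by rintro (i | i); exacts [h1 i, h2 i]) hen
      (by rintro (i | i); exacts [Or.inl rfl, Or.inr rfl]) en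
      (fun j hj => by
        refine ⟨0, ?_, ?_⟩
        · simp [h.pos_root, anc_zero, hj.ne']
        · simp)
    simpa using this

theorem Rooting.two_mul_le (h : Rooting T u q pos pp) {v : Fin n}
    {l : ℕ} (hl : l ∈ twoSourcesLengths T u v 0 0) : 2 * (n - 1) ≤ l := by
  rw [twoSourcesLengths, if_pos rfl] at hl
  obtain ⟨S, hS, h1, -, rfl⟩ := hl
  have hu : ∀ i, StartsAt u (S i) ∧ EndsAt u (S i) := by
    rintro (i | i)
    exacts [h1 i, i.elim0]
  -- With `u` in the role of both sources no robot starts away from `u`, so no edge can be unused.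
  obtain ⟨r, -, hr, hle⟩ := h.lower_bound (v := u) hS (st := fun _ => u) (en := fun _ => u)
    (fun i => (hu i).1) (fun i => (hu i).2) fun i => Or.inl rfl
  have hr0 : r = 0 := by
    rcases hr with hr | ⟨-, ⟨i, hi⟩, -⟩
    · exact hr
    · exact absurd rfl hi
  refine le_trans (le_of_eq ?_) hle
  rw [Finset.sum_congr rfl (g := fun _ => 2) fun j hj => ?_]
  · simp [mul_comm]
  · rw [Finset.mem_Ico] at hj
    rw [if_neg (by omega)]
    simp [gap, wt]

end Lower

end TreeCover

namespace TreeCover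

/-! ## The dynamic program -/

/-- The minimum of `f 0, …, f a`. -/
def minUpTo (f : ℕ → ℕ) : ℕ → ℕ
  | 0 => f 0
  | a + 1 => min (minUpTo f a) (f (a + 1))

theorem minUpTo_le (f : ℕ → ℕ) {i a : ℕ} (h : i ≤ a) : minUpTo f a ≤ f i := by
  induction a with
  | zero => rw [Nat.le_zero.1 h, minUpTo]
  | succ a ih =>
    rw [minUpTo]
    rcases Nat.lt_or_ge i (a + 1) with h1 | h1
    · exact (min_le_left _ _).trans (ih (by omega))
    · rw [show i = a + 1 by omega]
      exact min_le_right _ _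

theorem exists_minUpTo_eq (f : ℕ → ℕ) (a : ℕ) : ∃ i ≤ a, minUpTo f a = f i := by
  induction a with
  | zero => exact ⟨0, le_rfl, rfl⟩
  | succ a ih =>
    obtain ⟨i, hi, h⟩ := ih
    rw [minUpTo]
    rcases min_choice (minUpTo f a) (f (a + 1)) with h1 | h1
    · exact ⟨i, by omega, h1.trans h⟩
    · exact ⟨a + 1, le_rfl, h1⟩

/-- A table assigns a value to each vertex, number of robots, and number (`0` or `1`) of edges
that may be left out. -/
abbrev Table := ℕ → ℕ → ℕ → ℕ

/-- The candidates for the minimum if no edge may be left out. -/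
def cand₀ (c : ℕ → ℕ → ℕ → ℕ) (G : Table) (j p e a : ℕ) : ℕ :=
  c j a 0 + G j a 0 + G p (e - a) 0

/-- The candidates for the minimum if one edge may be left out. -/
def cand₁ (c : ℕ → ℕ → ℕ → ℕ) (G : Table) (j p e a : ℕ) : ℕ :=
  min (min (c j a 0 + G j a 1 + G p (e - a) 0) (c j a 0 + G j a 0 + G p (e - a) 1))
    (c j a 1 + G j a 0 + G p (e - a) 0)

/-- Merge the table of the leaf `j` into the one of its parent `p`; here `c j a b` is the cost of
the edge above `j` if `a` robots end below it, and `b` is `1` if it may be left out. -/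
def mergeTable (c : ℕ → ℕ → ℕ → ℕ) (G : Table) (j p : ℕ) : Table :=
  Function.update G p fun e b => if b = 0 then minUpTo (cand₀ c G j p e) e
    else minUpTo (cand₁ c G j p e) e

/-- The table after the last `i` vertices have been merged. -/
def dpTable (c : ℕ → ℕ → ℕ → ℕ) (pp : ℕ → ℕ) (n : ℕ) : ℕ → Table
  | 0 => fun _ _ _ => 0
  | i + 1 => mergeTable c (dpTable c pp n i) (n - 1 - i) (pp (n - 1 - i))

section Merge

variable {c : ℕ → ℕ → ℕ → ℕ} {G : Table} {pp : ℕ → ℕ}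

theorem mergeTable_of_ne {j p x : ℕ} (h : x ≠ p) : mergeTable c G j p x = G x := by
  rw [mergeTable, Function.update_of_ne h]

theorem mergeTable_zero (j p e : ℕ) :
    mergeTable c G j p p e 0 = minUpTo (cand₀ c G j p e) e := by
  rw [mergeTable, Function.update_self, if_pos rfl]

theorem mergeTable_one (j p e : ℕ) :
    mergeTable c G j p p e 1 = minUpTo (cand₁ c G j p e) e := by
  rw [mergeTable, Function.update_self, if_neg one_ne_zero]

/-- Here `z`, `f`, `g` say whether the permission goes to the edge above `j`, to the part merged
into `j`, or to the part merged into `p`; `cand₁` lists the three possibilities. -/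
theorem mergeTable_le {j p a e z f g : ℕ} (hf : z + f + g ≤ 1) :
    mergeTable c G j p p (e + a) (z + f + g) ≤ c j a z + G j a f + G p e g := by
  have hae : a ≤ e + a := by omega
  have h0 : z + f + g = 0 ∨ z + f + g = 1 := by omega
  rcases h0 with h0 | h0
  · rw [h0, mergeTable_zero]
    obtain ⟨rfl, rfl, rfl⟩ : z = 0 ∧ f = 0 ∧ g = 0 := by omega
    refine (minUpTo_le _ hae).trans (le_of_eq ?_)
    rw [cand₀, Nat.add_sub_cancel]
  · rw [h0, mergeTable_one]
    refine (minUpTo_le _ hae).trans ?_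
    rw [cand₁, Nat.add_sub_cancel]
    have h1 : (z = 1 ∧ f = 0 ∧ g = 0) ∨ (z = 0 ∧ f = 1 ∧ g = 0) ∨ (z = 0 ∧ f = 0 ∧ g = 1) := by
      omega
    rcases h1 with ⟨rfl, rfl, rfl⟩ | ⟨rfl, rfl, rfl⟩ | ⟨rfl, rfl, rfl⟩
    · exact min_le_right _ _
    · exact (min_le_left _ _).trans (min_le_left _ _)
    · exact (min_le_left _ _).trans (min_le_right _ _)

theorem exists_mergeTable_eq {j p e b : ℕ} (hb : b ≤ 1) :
    ∃ a e' z f g, e = e' + a ∧ b = z + f + g ∧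
      mergeTable c G j p p e b = c j a z + G j a f + G p e' g := by
  have h0 : b = 0 ∨ b = 1 := by omega
  rcases h0 with rfl | rfl
  · obtain ⟨a, ha, h⟩ := exists_minUpTo_eq (cand₀ c G j p e) e
    exact ⟨a, e - a, 0, 0, 0, by omega, rfl, by rw [mergeTable_zero, h, cand₀]⟩
  · obtain ⟨a, ha, h⟩ := exists_minUpTo_eq (cand₁ c G j p e) e
    rw [cand₁] at h
    have : ∃ z f g, 1 = z + f + g ∧
        minUpTo (cand₁ c G j p e) e = c j a z + G j a f + G p (e - a) g := by
      rw [h]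
      rcases min_choice (min (c j a 0 + G j a 1 + G p (e - a) 0)
        (c j a 0 + G j a 0 + G p (e - a) 1)) (c j a 1 + G j a 0 + G p (e - a) 0) with h1 | h1
      · rw [h1]
        rcases min_choice (c j a 0 + G j a 1 + G p (e - a) 0)
          (c j a 0 + G j a 0 + G p (e - a) 1) with h2 | h2
        · exact ⟨0, 1, 0, rfl, h2⟩
        · exact ⟨0, 0, 1, rfl, h2⟩
      · exact ⟨1, 0, 0, rfl, h1⟩
    obtain ⟨z, f, g, h1, h2⟩ := this
    exact ⟨a, e - a, z, f, g, by omega, h1, by rw [mergeTable_one, h2]⟩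

/-- Feasible solutions for the first `m` vertices. -/
def Feasible (m R : ℕ) (E F z : ℕ → ℕ) : Prop :=
  ∑ x ∈ Finset.range m, E x = R ∧ ∑ x ∈ Finset.range m, (z x + F x) = 1 ∧ z 0 = 0

/-- The value of a feasible solution. -/
def objective (c : ℕ → ℕ → ℕ → ℕ) (pp : ℕ → ℕ) (G : Table) (m : ℕ) (E F z : ℕ → ℕ) : ℕ :=
  ∑ j ∈ Finset.Ico 1 m, c j (arrivals pp m E j) (z j) + ∑ x ∈ Finset.range m, G x (E x) (F x)

theorem sum_range_eq_add_of_eq {m p : ℕ} (hp : p < m) {f g : ℕ → ℕ} {a b : ℕ}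
    (h : ∀ x, x < m → x ≠ p → f x = g x) (hfg : f p + a = g p + b) :
    ∑ x ∈ Finset.range m, f x + a = ∑ x ∈ Finset.range m, g x + b := by
  have hs : ∑ x ∈ (Finset.range m).erase p, f x = ∑ x ∈ (Finset.range m).erase p, g x :=
    Finset.sum_congr rfl fun x hx => by
      rw [Finset.mem_erase, Finset.mem_range] at hx
      exact h x hx.2 hx.1
  rw [← Finset.add_sum_erase _ _ (Finset.mem_range.2 hp),
    ← Finset.add_sum_erase _ g (Finset.mem_range.2 hp), hs]
  omega

/-- For `j < m`, the vertex `j` is an ancestor of `m` exactly if it is one of `pp m`, so folding the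
arrivals at `m` into its parent is invisible to `j`. -/
theorem arrivals_succ_of_lt {m : ℕ} (hm : 0 < m) (hp : pp m < m) {E E' : ℕ → ℕ}
    (h : ∀ x, x < m → x ≠ pp m → E x = E' x) (hE : E (pp m) + E m = E' (pp m)) {j : ℕ}
    (hj : j < m) : arrivals pp (m + 1) E j = arrivals pp m E' j := by
  unfold arrivals
  rw [Finset.sum_range_succ, anc_of_pos hm hp, if_neg (by omega), zero_add]
  refine sum_range_eq_add_of_eq (b := 0) hp (fun x hx hxp => by rw [h x hx hxp]) ?_
  rw [← hE]
  ring

theorem arrivals_succ_self {m : ℕ} (E : ℕ → ℕ) : arrivals pp (m + 1) E m = E m := by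
  unfold arrivals
  rw [Finset.sum_range_succ, anc_self, mul_one, Finset.sum_eq_zero, zero_add]
  intro x hx
  rw [anc_of_lt (Finset.mem_range.1 hx), mul_zero]

/-- Solutions that agree up to the merge of the last vertex. -/
theorem objective_succ {m : ℕ} (hm : 0 < m) (hp : pp m < m) {G' : Table} {E E' F F' z z' : ℕ → ℕ}
    (hG : ∀ x, x < m → x ≠ pp m → G' x = G x)
    (hE : ∀ x, x < m → x ≠ pp m → E x = E' x) (hEp : E (pp m) + E m = E' (pp m))
    (hF : ∀ x, x < m → x ≠ pp m → F x = F' x) (hz : ∀ x, x < m → z x = z' x) :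
    objective c pp G (m + 1) E F z + G' (pp m) (E' (pp m)) (F' (pp m))
      = objective c pp G' m E' F' z' +
        (c m (E m) (z m) + G m (E m) (F m) + G (pp m) (E (pp m)) (F (pp m))) := by
  unfold objective
  have h1 : ∑ x ∈ Finset.range m, G x (E x) (F x) + G' (pp m) (E' (pp m)) (F' (pp m)) =
      ∑ x ∈ Finset.range m, G' x (E' x) (F' x) + G (pp m) (E (pp m)) (F (pp m)) := by
    refine sum_range_eq_add_of_eq hp (fun x hx hxp => ?_) (add_comm _ _)
    rw [hG x hx hxp, hE x hx hxp, hF x hx hxp]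
  have h2 : ∑ j ∈ Finset.Ico 1 m, c j (arrivals pp (m + 1) E j) (z j)
      = ∑ j ∈ Finset.Ico 1 m, c j (arrivals pp m E' j) (z' j) := by
    refine Finset.sum_congr rfl fun j hj => ?_
    rw [Finset.mem_Ico] at hj
    rw [arrivals_succ_of_lt hm hp hE hEp hj.2, hz j hj.2]
  rw [Finset.sum_Ico_succ_top hm, Finset.sum_range_succ, arrivals_succ_self, h2]
  omega

/-- The leaf `m` is folded into its parent together with its robots and its permissions, including
the one on the edge above it. -/
theorem exists_feasible_of_succ {m R : ℕ} (hm : 0 < m) (hp : pp m < m) {E F z : ℕ → ℕ}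
    (h : Feasible (m + 1) R E F z) :
    ∃ E' F' z', Feasible m R E' F' z' ∧
      objective c pp (mergeTable c G m (pp m)) m E' F' z' ≤ objective c pp G (m + 1) E F z := by
  obtain ⟨h1, h2, h3⟩ := h
  rw [Finset.sum_range_succ] at h1 h2
  set E' := Function.update E (pp m) (E (pp m) + E m) with hE'
  set F' := Function.update F (pp m) (z m + F m + F (pp m)) with hF'
  have hEp : E (pp m) + E m = E' (pp m) := by rw [hE', Function.update_self]
  have hFp : z m + F m + F (pp m) = F' (pp m) := by rw [hF', Function.update_self]
  have hE : ∀ x, x < m → x ≠ pp m → E x = E' x := fun x _ hx => by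
    rw [hE', Function.update_of_ne hx]
  have hF : ∀ x, x < m → x ≠ pp m → F x = F' x := fun x _ hx => by
    rw [hF', Function.update_of_ne hx]
  have hle : z (pp m) + F (pp m) ≤ ∑ x ∈ Finset.range m, (z x + F x) :=
    Finset.single_le_sum (f := fun x => z x + F x) (fun _ _ => Nat.zero_le _)
      (Finset.mem_range.2 hp)
  refine ⟨E', F', z, ⟨?_, ?_, h3⟩, ?_⟩
  · have := sum_range_eq_add_of_eq (a := E m) (b := 0) hp hE (by omega)
    omega
  · have := sum_range_eq_add_of_eq (f := fun x => z x + F x) (g := fun x => z x + F' x)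
      (a := z m + F m) (b := 0) hp (fun x hx hxp => by rw [hF x hx hxp]) (by omega)
    omega
  · have h4 := objective_succ (c := c) (G := G) (G' := mergeTable c G m (pp m)) hm hp
      (fun x _ hx => mergeTable_of_ne hx) hE hEp hF (fun _ _ => rfl) (z := z) (z' := z)
    have h5 := mergeTable_le (c := c) (G := G) (j := m) (p := pp m) (a := E m) (e := E (pp m))
      (z := z m) (f := F m) (g := F (pp m)) (by omega)
    rw [hEp, hFp] at h5
    omega

/-- The converse of folding: a minimizer for the merged entry tells how to split the robots and the
permission of the parent again. -/
theorem exists_feasible_succ {m R : ℕ} (hm : 0 < m) (hp : pp m < m) {E' F' z' : ℕ → ℕ}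
    (h : Feasible m R E' F' z') :
    ∃ E F z, Feasible (m + 1) R E F z ∧
      objective c pp G (m + 1) E F z ≤ objective c pp (mergeTable c G m (pp m)) m E' F' z' := by
  obtain ⟨h1, h2, h3⟩ := h
  have hle : z' (pp m) + F' (pp m) ≤ ∑ x ∈ Finset.range m, (z' x + F' x) :=
    Finset.single_le_sum (f := fun x => z' x + F' x) (fun _ _ => Nat.zero_le _)
      (Finset.mem_range.2 hp)
  obtain ⟨a, e, ζ, f, g, he, hb, hG⟩ := exists_mergeTable_eq (c := c) (G := G) (j := m)
    (p := pp m) (e := E' (pp m)) (b := F' (pp m)) (by omega)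
  set E := Function.update (Function.update E' (pp m) e) m a with hE
  set F := Function.update (Function.update F' (pp m) g) m f with hF
  set z := Function.update z' m ζ with hz
  have hne : pp m ≠ m := hp.ne
  have hEm : E m = a := by rw [hE, Function.update_self]
  have hFm : F m = f := by rw [hF, Function.update_self]
  have hzm : z m = ζ := by rw [hz, Function.update_self]
  have hEp : E (pp m) = e := by rw [hE, Function.update_of_ne hne, Function.update_self]
  have hFp : F (pp m) = g := by rw [hF, Function.update_of_ne hne, Function.update_self]
  have hEx : ∀ x, x < m → x ≠ pp m → E x = E' x := fun x hx hxp => by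
    rw [hE, Function.update_of_ne hx.ne, Function.update_of_ne hxp]
  have hFx : ∀ x, x < m → x ≠ pp m → F x = F' x := fun x hx hxp => by
    rw [hF, Function.update_of_ne hx.ne, Function.update_of_ne hxp]
  have hzx : ∀ x, x < m → z x = z' x := fun x hx => by
    rw [hz, Function.update_of_ne hx.ne]
  refine ⟨E, F, z, ⟨?_, ?_, by rw [hzx 0 hm, h3]⟩, ?_⟩
  · have := sum_range_eq_add_of_eq (a := a) (b := 0) hp hEx (by omega)
    rw [Finset.sum_range_succ, hEm]
    omega
  · have hzp := hzx (pp m) hp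
    have := sum_range_eq_add_of_eq (f := fun x => z x + F x) (g := fun x => z' x + F' x)
      (a := ζ + f) (b := 0) hp (fun x hx hxp => by rw [hFx x hx hxp, hzx x hx]) (by omega)
    rw [Finset.sum_range_succ, hzm, hFm]
    omega
  · have h4 := objective_succ (c := c) (G := G) (G' := mergeTable c G m (pp m)) hm hp
      (fun x _ hx => mergeTable_of_ne hx) hEx (by omega) hFx hzx
    rw [hG, hEm, hzm, hFm, hEp, hFp] at h4
    omega

/-- Merging preserves the optimum. In a solution, `E x` robots and `F x` permissions are assigned to
the part merged into `x`, and `z x` permissions to the edge above `x`. After `n - 1` merges only the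
root remains, and its table entry is the optimum. -/
theorem dpTable_spec {n R : ℕ} (hpp : ∀ j, 0 < j → j < n → pp j < j) {i : ℕ} (hi : i < n) :
    (∀ E F z, Feasible n R E F z → ∃ E' F' z', Feasible (n - i) R E' F' z' ∧
      objective c pp (dpTable c pp n i) (n - i) E' F' z' ≤
        objective c pp (fun _ _ _ => 0) n E F z) ∧
    (∀ E' F' z', Feasible (n - i) R E' F' z' → ∃ E F z, Feasible n R E F z ∧
      objective c pp (fun _ _ _ => 0) n E F z ≤
        objective c pp (dpTable c pp n i) (n - i) E' F' z') := by
  induction i with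
  | zero => exact ⟨fun E F z h => ⟨E, F, z, h, le_rfl⟩, fun E F z h => ⟨E, F, z, h, le_rfl⟩⟩
  | succ i ih =>
    obtain ⟨ih1, ih2⟩ := ih (by omega)
    obtain ⟨m, hm⟩ : ∃ m, n - i = m + 1 := ⟨n - i - 1, by omega⟩
    have hm' : n - (i + 1) = m := by omega
    have hm'' : n - 1 - i = m := by omega
    rw [hm] at ih1 ih2
    rw [dpTable, hm', hm'']
    have hp := hpp m (by omega) (by omega)
    refine ⟨fun E F z h => ?_, fun E' F' z' h => ?_⟩
    · obtain ⟨E1, F1, z1, h1, h2⟩ := ih1 E F z h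
      obtain ⟨E2, F2, z2, h3, h4⟩ := exists_feasible_of_succ (c := c) (G := dpTable c pp n i)
        (by omega) hp h1
      exact ⟨E2, F2, z2, h3, h4.trans h2⟩
    · obtain ⟨E1, F1, z1, h1, h2⟩ := exists_feasible_succ (c := c) (G := dpTable c pp n i)
        (by omega) hp h
      obtain ⟨E2, F2, z2, h3, h4⟩ := ih2 E1 F1 z1 h1
      exact ⟨E2, F2, z2, h3, h4.trans h2⟩

/-- All entries of the tables are small. -/
theorem dpTable_le {n K : ℕ} (hpp : ∀ j, 0 < j → j < n → pp j < j) (hc : ∀ j, c j 0 0 ≤ K)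
    {i : ℕ} (hi : i < n) :
    ∃ z : ℕ → ℕ, (∀ x a b, dpTable c pp n i x a b ≤ z x) ∧
      ∑ x ∈ Finset.range (n - i), z x ≤ i * K ∧ ∀ x, z x ≤ i * K := by
  induction i with
  | zero => exact ⟨fun _ => 0, by simp [dpTable]⟩
  | succ i ih =>
    obtain ⟨z, h1, h2, h3⟩ := ih (by omega)
    obtain ⟨m, hm⟩ : ∃ m, n - i = m + 1 := ⟨n - i - 1, by omega⟩
    have hm' : n - (i + 1) = m := by omega
    have hm'' : n - 1 - i = m := by omega
    have hp := hpp m (by omega) (by omega)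
    rw [hm, Finset.sum_range_succ] at h2
    rw [dpTable, hm', hm'']
    -- The sum of the bounds is what can be controlled: the bound of `m` moves to its parent, so
    -- each merge adds only `K`.
    have hsum : ∑ x ∈ Finset.range m, Function.update z (pp m) (K + z m + z (pp m)) x
        = ∑ x ∈ Finset.range m, z x + (K + z m) := by
      have := sum_range_eq_add_of_eq (f := Function.update z (pp m) (K + z m + z (pp m))) (g := z)
        (a := 0) (b := K + z m) hp (fun x _ hx => by rw [Function.update_of_ne hx])
        (by rw [Function.update_self]; omega)
      omega
    have hle : z (pp m) ≤ ∑ x ∈ Finset.range m, z x :=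
      Finset.single_le_sum (fun _ _ => Nat.zero_le _) (Finset.mem_range.2 hp)
    refine ⟨Function.update z (pp m) (K + z m + z (pp m)), fun x a b => ?_, ?_, fun x => ?_⟩
    · by_cases hx : x = pp m
      · subst hx
        rw [Function.update_self, mergeTable, Function.update_self]
        have hcm := hc m
        have e1 := h1 m 0 0
        have e2 := h1 m 0 1
        have e3 := h1 (pp m) a 0
        split_ifs
        -- The candidate that sends no robot below `m` bounds the minimum, whatever the number of
        -- robots; hence only `c j 0 0` matters for `K`.
        · refine (minUpTo_le _ (Nat.zero_le a)).trans ?_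
          rw [cand₀, Nat.sub_zero]
          omega
        · refine (minUpTo_le _ (Nat.zero_le a)).trans ?_
          rw [cand₁, Nat.sub_zero]
          refine (min_le_left _ _).trans ((min_le_left _ _).trans ?_)
          omega
      · rw [Function.update_of_ne hx, mergeTable_of_ne hx]
        exact h1 x a b
    · rw [hsum, Nat.succ_mul]
      omega
    · rw [Nat.succ_mul]
      by_cases hx : x = pp m
      · subst hx
        rw [Function.update_self]
        omega
      · rw [Function.update_of_ne hx]
        have := h3 x
        omega

end Merge

/-- The cost of the edge above `j` if `a` robots end below it and `t` robots start at `w`; with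
`b = 1` it may be left out if this is possible. -/
def edgeCost (on : ℕ → ℕ) (t j a b : ℕ) : ℕ :=
  gap (t * on j) a + 2 * (1 - gap (t * on j) a) * (1 - b * on j)

theorem edgeCost_zero_le {on : ℕ → ℕ} (h : ∀ j, on j ≤ 1) (t j : ℕ) :
    edgeCost on t j 0 0 ≤ t + 2 := by
  have : t * on j ≤ t * 1 := Nat.mul_le_mul_left t (h j)
  unfold edgeCost gap
  rw [zero_mul, Nat.sub_zero 1, mul_one]
  omega

/-- The value computed by the dynamic program. -/
def dpValue (pp : ℕ → ℕ) (n w s t : ℕ) : ℕ :=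
  dpTable (edgeCost (fun j => anc pp j w) t) pp n (n - 1) 0 (s + t) 1

/-! ### Correctness of the value computed by the dynamic program -/

section

variable {n : ℕ} {T : SimpleGraph (Fin n)} {u : Fin n} {q : ℕ → Fin n} {pos : Fin n → ℕ}
  {pp : ℕ → ℕ}

theorem dpValue_le (hn : 0 < n) (hpp : ∀ j, 0 < j → j < n → pp j < j) {w s t r : ℕ} {E : ℕ → ℕ}
    (hE : ∑ x ∈ Finset.range n, E x = s + t) (hr : Omissible pp n w t E r) :
    dpValue pp n w s t ≤ ∑ j ∈ Finset.Ico 1 n, linkCost pp n w t E r j := by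
  -- The permission is placed on the edge above `r`, or stored unused at the root if `r = 0`, as the
  -- root has no edge above it.
  have hfeas : Feasible n (s + t) E (fun x => if x = 0 ∧ r = 0 then 1 else 0)
      (fun x => if x = r ∧ r ≠ 0 then 1 else 0) := by
    refine ⟨hE, ?_, by simp only [ite_eq_right_iff]; omega⟩
    rw [Finset.sum_congr rfl (g := fun x => if x = r then 1 else 0) fun x _ => by
      simp only
      split_ifs <;> omega]
    rw [Finset.sum_ite_eq', if_pos (Finset.mem_range.2 hr.1)]
  obtain ⟨E', F', z', ⟨h1, h2, h3⟩, h4⟩ := (dpTable_spec (c := edgeCost (fun j => anc pp j w) t)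
    (i := n - 1) hpp (by omega)).1 _ _ _ hfeas
  rw [show n - (n - 1) = 1 by omega] at h1 h2 h4
  simp only [Finset.range_one, Finset.sum_singleton, h3, zero_add] at h1 h2
  simp only [objective, Finset.Ico_self, Finset.sum_empty, Finset.range_one,
    Finset.sum_singleton, zero_add, h1, h2, Finset.sum_const_zero, add_zero] at h4
  refine h4.trans (Finset.sum_le_sum fun j hj => ?_)
  rw [Finset.mem_Ico] at hj
  simp only [linkCost, edgeCost]
  by_cases hjr : j = r
  · subst hjr
    obtain ⟨h5, h6⟩ := hr.2.resolve_left (by omega)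
    rw [if_pos rfl, if_pos ⟨rfl, by omega⟩, h5, h6]
    simp [gap]
  · rw [if_neg hjr, if_neg (by omega)]
    simp [wt]

theorem exists_le_dpValue (hn : 0 < n) (hpp : ∀ j, 0 < j → j < n → pp j < j) {w s t : ℕ} :
    ∃ E r, ∑ x ∈ Finset.range n, E x = s + t ∧ Omissible pp n w t E r ∧
      ∑ j ∈ Finset.Ico 1 n, linkCost pp n w t E r j ≤ dpValue pp n w s t := by
  -- When only the root is left, all `s + t` robots and the permission sit there.
  obtain ⟨E, F, z, ⟨h1, h2, h3⟩, h4⟩ := (dpTable_spec (c := edgeCost (fun j => anc pp j w) t)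
    (i := n - 1) (R := s + t) hpp (by omega)).2 (fun _ => s + t) (fun _ => 1) (fun _ => 0) (by
      rw [show n - (n - 1) = 1 by omega]
      simp [Feasible])
  rw [show n - (n - 1) = 1 by omega] at h4
  simp only [objective, Finset.Ico_self, Finset.sum_empty, Finset.range_one,
    Finset.sum_singleton, zero_add, Finset.sum_const_zero, add_zero] at h4
  have hz : ∀ i j, i < n → j < n → i ≠ j → z i + z j ≤ 1 := by
    intro i j hi hj hij
    rw [← h2, ← Finset.sum_pair hij]
    refine (Finset.sum_le_sum fun x _ => Nat.le_add_right (z x) (F x)).trans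
      (Finset.sum_le_sum_of_subset ?_)
    intro x hx
    simp only [Finset.mem_insert, Finset.mem_singleton] at hx
    rw [Finset.mem_range]
    rcases hx with rfl | rfl <;> assumption
  have hone : ∀ j, anc pp j w ≤ 1 := fun j => anc_le_one j w
  by_cases hr : ∃ r, 0 < r ∧ r < n ∧ 0 < z r ∧ anc pp r w = 1 ∧ arrivals pp n E r = t
  · obtain ⟨r, hr0, hrn, hzr, hrw, hrt⟩ := hr
    refine ⟨E, r, h1, ⟨hrn, Or.inr ⟨hrw, hrt⟩⟩, (Finset.sum_le_sum fun j hj => ?_).trans h4⟩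
    rw [Finset.mem_Ico] at hj
    simp only [linkCost, edgeCost]
    split_ifs with hjr
    · exact Nat.zero_le _
    · have := hz j r hj.2 hrn hjr
      rw [show z j = 0 by omega]
      simp [wt]
  -- A permission spent where skipping is impossible saves nothing: off the path to `w` it has no
  -- effect, and an edge with positive flow costs its flow anyway.
  · push Not at hr
    refine ⟨E, 0, h1, ⟨hn, Or.inl rfl⟩, (Finset.sum_le_sum fun j hj => ?_).trans h4⟩
    rw [Finset.mem_Ico] at hj
    simp only [linkCost, edgeCost]
    rw [if_neg (by omega)]
    rcases Nat.eq_zero_or_pos (z j) with h0 | h0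
    · rw [h0]
      simp [wt]
    · have h5 := hone j
      have h6 : anc pp j w = 0 ∨ anc pp j w = 1 := by omega
      rcases h6 with h6 | h6
      · rw [h6, mul_zero, mul_zero, Nat.sub_zero, mul_one, wt]
      · have h7 := hr j (by omega) hj.2 h0 h6
        rw [h6, mul_one]
        have : 0 < gap t (arrivals pp n E j) := by unfold gap; omega
        rw [wt_of_pos this]
        omega

/-- The condition `0 < s + t` cannot be dropped: for `s = t = 0` the program would allow an edge
between `u` and `v` to be left out, although the only robot has to cross it. -/
theorem Rooting.isTwoSources (h : Rooting T u q pos pp) {v : Fin n} {s t : ℕ} (hst : 0 < s + t) :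
    IsTwoSources T u v s t (dpValue pp n (pos v) s t) := by
  have hlow : ∀ l ∈ twoSourcesLengths T u v s t, dpValue pp n (pos v) s t ≤ l := by
    intro l hl
    obtain ⟨E, r, hE, hr, hle⟩ := h.exists_linkCost_le hl
    exact (dpValue_le u.pos h.pp_lt hE hr).trans hle
  obtain ⟨E, r, hE, hr, hle⟩ := exists_le_dpValue (w := pos v) (s := s) (t := t) u.pos h.pp_lt
  have hmem := h.linkCost_mem hst hE hr
  refine ⟨?_, hlow⟩
  rwa [le_antisymm (hlow _ hmem) hle]

theorem Rooting.isTwoSources_zero (h : Rooting T u q pos pp) {v : Fin n} :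
    IsTwoSources T u v 0 0 (2 * (n - 1)) :=
  ⟨h.two_mul_mem v, fun _ hl => h.two_mul_le hl⟩

end

end TreeCover

namespace TreeCover

/-! ## Program logic -/

@[simp] theorem State.setReg_reg (σ : State) (x val y : ℕ) :
    (σ.setReg x val).reg y = if y = x then val else σ.reg y := by
  simp [State.setReg, Function.update_apply]

@[simp] theorem State.setReg_arr (σ : State) (x val : ℕ) : (σ.setReg x val).arr = σ.arr := rfl

@[simp] theorem State.setArr_reg (σ : State) (a i val : ℕ) : (σ.setArr a i val).reg = σ.reg := rfl

@[simp] theorem State.setArr_arr (σ : State) (a i val b j : ℕ) :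
    (σ.setArr a i val).arr b j = if b = a ∧ j = i then val else σ.arr b j := by
  by_cases h : b = a
  · subst h
    simp [State.setArr, Function.update_apply]
  · simp [State.setArr, h]

/-- All contents of registers and cells are at most `M`. -/
def State.Bounded (M : ℕ) (σ : State) : Prop :=
  (∀ x, σ.reg x ≤ M) ∧ ∀ a i, σ.arr a i ≤ M

theorem State.Bounded.setReg {M : ℕ} {σ : State} (h : σ.Bounded M) {x val : ℕ} (hv : val ≤ M) :
    (σ.setReg x val).Bounded M := by
  refine ⟨fun y => ?_, h.2⟩
  rw [State.setReg_reg]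
  split_ifs
  exacts [hv, h.1 y]

theorem State.Bounded.setArr {M : ℕ} {σ : State} (h : σ.Bounded M) {a i val : ℕ} (hv : val ≤ M) :
    (σ.setArr a i val).Bounded M := by
  refine ⟨h.1, fun b j => ?_⟩
  rw [State.setArr_arr]
  split_ifs
  exacts [hv, h.2 b j]

/-- The expression contains no constant above `2`. -/
def Expr.constsLe : Expr → Bool
  | const m => decide (m ≤ 2)
  | reg _ => true
  | cell _ e => e.constsLe
  | add e₁ e₂ => e₁.constsLe && e₂.constsLe
  | sub e₁ e₂ => e₁.constsLe && e₂.constsLe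
  | mul e₁ e₂ => e₁.constsLe && e₂.constsLe

/-- The expression is small enough to be evaluated without overflow. -/
def Expr.ok (e : Expr) : Bool := e.constsLe && decide (e.cost ≤ 500)

/-- Each constant or register contributes at most a factor `M`, and the extra unit of cost of an
addition pays for `2 ≤ M`. -/
theorem Expr.eval_le_pow {M : ℕ} (hM : 2 ≤ M) {σ : State} (hσ : σ.Bounded M) (e : Expr)
    (he : e.constsLe = true) : e.eval σ ≤ M ^ e.cost := by
  have hpos : ∀ m n : ℕ, m ≤ n → M ^ m ≤ M ^ n := fun m n h => Nat.pow_le_pow_right (by omega) h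
  induction e with
  | const m => simp [constsLe] at he; simp [eval, cost]; omega
  | reg x => simpa [eval, cost] using hσ.1 x
  | cell a e _ =>
    refine (hσ.2 a _).trans ?_
    simpa using hpos 1 _ (show 1 ≤ (cell a e).cost by simp [cost])
  | add e₁ e₂ ih1 ih2 =>
    simp only [constsLe, Bool.and_eq_true] at he
    have h1 := (ih1 he.1).trans (hpos _ (e₁.cost + e₂.cost) (by omega))
    have h2 := (ih2 he.2).trans (hpos _ (e₁.cost + e₂.cost) (by omega))
    simp only [eval, cost, pow_succ]
    nlinarith [Nat.zero_le (M ^ (e₁.cost + e₂.cost))]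
  | sub e₁ e₂ ih1 ih2 =>
    simp only [constsLe, Bool.and_eq_true] at he
    simp only [eval]
    exact (Nat.sub_le _ _).trans ((ih1 he.1).trans (hpos _ _ (by simp only [cost]; omega)))
  | mul e₁ e₂ ih1 ih2 =>
    simp only [constsLe, Bool.and_eq_true] at he
    simp only [eval]
    refine (Nat.mul_le_mul (ih1 he.1) (ih2 he.2)).trans ?_
    rw [← pow_add]
    exact hpos _ _ (by simp only [cost]; omega)

theorem Expr.fits_of_pow {M w : ℕ} (hM : 2 ≤ M) {σ : State} (hσ : σ.Bounded M) {N : ℕ}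
    (hN : M ^ N < 2 ^ w) (e : Expr) (he : e.constsLe = true) (hc : e.cost ≤ N) : e.Fits w σ := by
  have hlt : ∀ e : Expr, e.constsLe = true → e.cost ≤ N → e.eval σ < 2 ^ w := fun e h1 h2 =>
    (e.eval_le_pow hM hσ h1).trans_lt ((Nat.pow_le_pow_right (by omega) h2).trans_lt hN)
  have hself := hlt e he hc
  induction e with
  | const m => exact hself
  | reg x => exact hself
  | cell a e ih =>
    have hc' : e.cost ≤ N := by simp only [cost] at hc; omega
    exact ⟨ih he hc' (hlt e he hc'), hself⟩
  | add e₁ e₂ ih1 ih2 =>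
    simp only [constsLe, Bool.and_eq_true] at he
    simp only [cost] at hc
    exact ⟨ih1 he.1 (by omega) (hlt _ he.1 (by omega)),
      ih2 he.2 (by omega) (hlt _ he.2 (by omega)), hself⟩
  | sub e₁ e₂ ih1 ih2 =>
    simp only [constsLe, Bool.and_eq_true] at he
    simp only [cost] at hc
    exact ⟨ih1 he.1 (by omega) (hlt _ he.1 (by omega)),
      ih2 he.2 (by omega) (hlt _ he.2 (by omega))⟩
  | mul e₁ e₂ ih1 ih2 =>
    simp only [constsLe, Bool.and_eq_true] at he
    simp only [cost] at hc
    exact ⟨ih1 he.1 (by omega) (hlt _ he.1 (by omega)),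
      ih2 he.2 (by omega) (hlt _ he.2 (by omega)), hself⟩

/-- Words of `w` bits suffice if registers and cells are bounded by `M`. -/
def Roomy (w M : ℕ) : Prop := 2 ≤ M ∧ M ^ 500 < 2 ^ w

theorem Roomy.fits {w M : ℕ} (h : Roomy w M) {σ : State} (hσ : σ.Bounded M) {e : Expr}
    (he : e.ok = true) : e.Fits w σ := by
  simp only [Expr.ok, Bool.and_eq_true, decide_eq_true_eq] at he
  exact Expr.fits_of_pow h.1 hσ h.2 e he.1 he.2

/-- Started in a bounded state, the program `p` halts within `c` time units in a bounded state
that satisfies `Q`. -/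
def Runs (w M : ℕ) (p : Program) (σ : State) (c : ℕ) (Q : State → Prop) : Prop :=
  σ.Bounded M → ∃ τ σ', Exec w p σ τ σ' ∧ τ ≤ c ∧ σ'.Bounded M ∧ Q σ'

section Rules

variable {w M : ℕ} {σ : State} {Q : State → Prop} {c : ℕ}

theorem Runs.mono {p : Program} {c' : ℕ} {Q' : State → Prop} (h : Runs w M p σ c Q) (hc : c ≤ c')
    (hQ : ∀ σ', σ'.Bounded M → Q σ' → Q' σ') : Runs w M p σ c' Q' := by
  intro hσ
  obtain ⟨τ, σ', h1, h2, h3, h4⟩ := h hσ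
  exact ⟨τ, σ', h1, h2.trans hc, h3, hQ σ' h3 h4⟩

theorem Runs.skip (hQ : Q σ) : Runs w M .skip σ 1 Q := fun hσ =>
  ⟨1, σ, Exec.skip σ, le_rfl, hσ, hQ⟩

theorem Runs.set (hw : Roomy w M) {x : ℕ} {e : Expr} (he : e.ok = true) (hle : e.eval σ ≤ M)
    (hQ : Q (σ.setReg x (e.eval σ))) : Runs w M (.set x e) σ (e.cost + 1) Q := fun hσ =>
  ⟨_, _, Exec.set σ x e (hw.fits hσ he), le_rfl, hσ.setReg hle, hQ⟩

theorem Runs.write (hw : Roomy w M) {a : ℕ} {i e : Expr} (hi : i.ok = true) (he : e.ok = true)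
    (hle : e.eval σ ≤ M) (hQ : Q (σ.setArr a (i.eval σ) (e.eval σ))) :
    Runs w M (.write a i e) σ (i.cost + e.cost + 1) Q := fun hσ =>
  ⟨_, _, Exec.write σ a i e (hw.fits hσ hi) (hw.fits hσ he), le_rfl, hσ.setArr hle, hQ⟩

/-- The postcondition of `p` is a statement about `q`, so repeated application executes a program
symbolically. The exact cost is collected by unification and rounded up afterwards with
`Runs.weaken`. -/
theorem Runs.seq {p q : Program} {c₁ c₂ : ℕ}
    (h : Runs w M p σ c₁ fun σ' => Runs w M q σ' c₂ Q) : Runs w M (.seq p q) σ (c₁ + c₂) Q := by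
  intro hσ
  obtain ⟨τ₁, σ₁, h1, h2, h3, h4⟩ := h hσ
  obtain ⟨τ₂, σ₂, h5, h6, h7, h8⟩ := h4 h3
  exact ⟨_, _, Exec.seq _ _ _ _ _ _ _ h1 h5, Nat.add_le_add h2 h6, h7, h8⟩

theorem Runs.ifLt (hw : Roomy w M) {e₁ e₂ : Expr} {p q : Program} (h₁ : e₁.ok = true)
    (h₂ : e₂.ok = true) (hp : e₁.eval σ < e₂.eval σ → Runs w M p σ c Q)
    (hq : ¬ e₁.eval σ < e₂.eval σ → Runs w M q σ c Q) :
    Runs w M (.ifLt e₁ e₂ p q) σ (e₁.cost + e₂.cost + 1 + c) Q := by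
  intro hσ
  by_cases hlt : e₁.eval σ < e₂.eval σ
  · obtain ⟨τ, σ', h1, h2, h3, h4⟩ := hp hlt hσ
    exact ⟨_, _, Exec.if_true _ _ _ _ _ _ _ (hw.fits hσ h₁) (hw.fits hσ h₂) hlt h1,
      Nat.add_le_add_left h2 _, h3, h4⟩
  · obtain ⟨τ, σ', h1, h2, h3, h4⟩ := hq hlt hσ
    exact ⟨_, _, Exec.if_false _ _ _ _ _ _ _ (hw.fits hσ h₁) (hw.fits hσ h₂) hlt h1,
      Nat.add_le_add_left h2 _, h3, h4⟩

/-- Loops whose running time is bounded by a potential `Φ`. -/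
theorem Runs.while_potential (hw : Roomy w M) {e₁ e₂ : Expr} {p : Program} (h₁ : e₁.ok = true)
    (h₂ : e₂.ok = true) {Inv : State → Prop} {Φ : State → ℕ}
    (hbody : ∀ σ, Inv σ → e₁.eval σ < e₂.eval σ → ∃ c, Runs w M p σ c fun σ' =>
      Inv σ' ∧ Φ σ' + c + (e₁.cost + e₂.cost + 1) ≤ Φ σ)
    (hInv : Inv σ) :
    Runs w M (.whileLt e₁ e₂ p) σ (Φ σ + (e₁.cost + e₂.cost + 1)) fun σ' =>
      Inv σ' ∧ ¬ e₁.eval σ' < e₂.eval σ' := by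
  obtain ⟨N, hN⟩ : ∃ N, Φ σ ≤ N := ⟨_, le_rfl⟩
  induction N using Nat.strong_induction_on generalizing σ with
  | _ N ih =>
    intro hσ
    by_cases hlt : e₁.eval σ < e₂.eval σ
    · obtain ⟨c, hc⟩ := hbody σ hInv hlt
      obtain ⟨τ₁, σ₁, h1, h2, h3, h4, h5⟩ := hc hσ
      obtain ⟨τ₂, σ₂, h6, h7, h8, h9⟩ := ih (Φ σ₁) (by omega) h4 le_rfl h3
      exact ⟨_, _, Exec.while_true _ _ _ _ _ _ _ _ (hw.fits hσ h₁) (hw.fits hσ h₂) hlt h1 h6,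
        by omega, h8, h9⟩
    · exact ⟨_, _, Exec.while_false _ _ _ _ (hw.fits hσ h₁) (hw.fits hσ h₂) hlt,
        by omega, hσ, hInv, hlt⟩

/-- Loops with a known number `N` of iterations; the invariant refers to the number of remaining
iterations. -/
theorem Runs.while_count (hw : Roomy w M) {e₁ e₂ : Expr} {p : Program} (h₁ : e₁.ok = true)
    (h₂ : e₂.ok = true) {Inv : ℕ → State → Prop} {N : ℕ}
    (hbody : ∀ r σ, r < N → Inv (r + 1) σ → e₁.eval σ < e₂.eval σ ∧ Runs w M p σ c (Inv r))
    (hend : ∀ σ, Inv 0 σ → ¬ e₁.eval σ < e₂.eval σ) (hInv : Inv N σ) :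
    Runs w M (.whileLt e₁ e₂ p) σ
      (N * (c + (e₁.cost + e₂.cost + 1)) + (e₁.cost + e₂.cost + 1)) (Inv 0) := by
  induction N generalizing σ with
  | zero =>
    intro hσ
    exact ⟨_, _, Exec.while_false _ _ _ _ (hw.fits hσ h₁) (hw.fits hσ h₂) (hend σ hInv),
      by omega, hσ, hInv⟩
  | succ N ih =>
    intro hσ
    obtain ⟨hlt, hrun⟩ := hbody N σ (by omega) hInv
    obtain ⟨τ₁, σ₁, h1, h2, h3, h4⟩ := hrun hσ
    obtain ⟨τ₂, σ₂, h5, h6, h7, h8⟩ := ih (fun r σ hr => hbody r σ (by omega)) h4 h3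
    refine ⟨_, _, Exec.while_true _ _ _ _ _ _ _ _ (hw.fits hσ h₁) (hw.fits hσ h₂) hlt h1 h5,
      ?_, h7, h8⟩
    rw [Nat.succ_mul]
    omega

end Rules

end TreeCover

namespace TreeCover

/-! ## Adjacency lists -/

section AdjacencyLists

variable {n : ℕ} {T : SimpleGraph (Fin n)} {adj : Fin n → List (Fin n)}

/-- The offset of the list of the `i`-th vertex. -/
def offset (adj : Fin n → List (Fin n)) (i : ℕ) : ℕ :=
  (((List.finRange n).take i).flatMap adj).length

theorem finRange_eq_append (x : Fin n) :
    List.finRange n = (List.finRange n).take x ++ x :: (List.finRange n).drop (x + 1) := by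
  have h : x.val < (List.finRange n).length := by simp
  conv_lhs => rw [← List.take_append_drop x.val (List.finRange n)]
  rw [List.drop_eq_getElem_cons h]
  simp

theorem offset_succ (x : Fin n) : offset adj (x + 1) = offset adj x + (adj x).length := by
  have h : x.val < (List.finRange n).length := by simp
  unfold offset
  rw [List.take_add_one, List.getElem?_eq_getElem h]
  simp

theorem getD_flatMap (x : Fin n) {l : ℕ} (hl : l < (adj x).length) :
    (((List.finRange n).flatMap adj).map Fin.val).getD (offset adj x + l) 0
      = ((adj x)[l]).val := by
  conv_lhs => rw [finRange_eq_append x]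
  rw [List.flatMap_append, List.flatMap_cons, List.map_append, List.map_append,
    List.getD_append_right _ _ _ _ (by simp [offset])]
  rw [List.getD_append _ _ _ _ (by simp [offset, hl])]
  simp [offset, hl]

theorem length_adj [DecidableRel T.Adj] (h : IsAdjacencyLists T adj) (x : Fin n) :
    (adj x).length = T.degree x := by
  rw [← List.toFinset_card_of_nodup (h x).1, ← SimpleGraph.card_neighborFinset_eq_degree]
  congr 1
  ext y
  simp [(h x).2 y]

theorem offset_eq_sum {i : ℕ} (hi : i ≤ n) :
    offset adj i = ∑ x ∈ Finset.range i, (offset adj (x + 1) - offset adj x) := by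
  induction i with
  | zero => simp [offset]
  | succ i ih =>
    rw [Finset.sum_range_succ, ← ih (by omega), offset_succ ⟨i, by omega⟩]
    simp

/-- The lists have total length equal to the sum of the degrees, which is twice the number of edges.
-/
theorem offset_le (hT : T.IsTree) (h : IsAdjacencyLists T adj) : offset adj n ≤ 2 * n := by
  classical
  have h1 : offset adj n = ∑ x : Fin n, (adj x).length := by
    unfold offset
    rw [List.take_of_length_le (by simp), List.length_flatMap, ← List.ofFn_eq_map, List.sum_ofFn]
  have h2 := hT.card_edgeFinset
  rw [h1, Finset.sum_congr rfl fun x _ => length_adj h x, T.sum_degrees_eq_twice_card_edges]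
  simp at h2
  omega

/-- In a tree the edges between the vertices and their parents are all edges. -/
theorem Rooting.of_isTree (hT : T.IsTree) {u : Fin n} {q : ℕ → Fin n} {pos : Fin n → ℕ}
    {pp : ℕ → ℕ} (pos_lt : ∀ x, pos x < n) (q_pos : ∀ x, q (pos x) = x)
    (pos_q : ∀ i < n, pos (q i) = i) (pos_root : pos u = 0)
    (pp_lt : ∀ j, 0 < j → j < n → pp j < j)
    (hadj : ∀ j, 0 < j → j < n → T.Adj (q j) (q (pp j))) : Rooting T u q pos pp := by
  classical
  refine ⟨pos_lt, q_pos, pos_q, pos_root, pp_lt, hadj, fun x y hxy => ?_⟩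
  have qinj : ∀ i j, i < n → j < n → q i = q j → i = j := fun i j hi hj h => by
    rw [← pos_q i hi, h, pos_q j hj]
  -- The `n - 1` parent edges are distinct, because `pp j < j` prevents the same edge from occurring
  -- in both directions; a tree has no further edges.
  have himg : (Finset.Ico 1 n).image (fun j => s(q j, q (pp j))) = T.edgeFinset := by
    refine Finset.eq_of_subset_of_card_le ?_ ?_
    · intro e he
      obtain ⟨j, hj, rfl⟩ := Finset.mem_image.1 he
      rw [Finset.mem_Ico] at hj
      rw [SimpleGraph.mem_edgeFinset]
      exact hadj j (by omega) hj.2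
    · have h2 := hT.card_edgeFinset
      rw [Finset.card_image_of_injOn]
      · simp at h2 ⊢
        omega
      · intro i hi j hj hij
        simp only [Finset.coe_Ico, Set.mem_Ico] at hi hj
        have hpi := pp_lt i (by omega) hi.2
        have hpj := pp_lt j (by omega) hj.2
        rcases Sym2.eq_iff.1 hij with ⟨h3, -⟩ | ⟨h3, h4⟩
        · exact qinj _ _ hi.2 hj.2 h3
        · have h5 := qinj _ _ hi.2 (by omega) h3
          have h6 := qinj _ _ (by omega) hj.2 h4
          omega
  have hmem : s(x, y) ∈ T.edgeFinset := by rwa [SimpleGraph.mem_edgeFinset]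
  rw [← himg] at hmem
  obtain ⟨j, hj, hjxy⟩ := Finset.mem_image.1 hmem
  rw [Finset.mem_Ico] at hj
  have hpj := pp_lt j (by omega) hj.2
  rcases Sym2.eq_iff.1 hjxy with ⟨h3, h4⟩ | ⟨h3, h4⟩
  · left
    rw [← h3, ← h4, pos_q j hj.2, pos_q _ (by omega)]
    exact ⟨by omega, rfl⟩
  · right
    rw [← h3, ← h4, pos_q j hj.2, pos_q _ (by omega)]
    exact ⟨by omega, rfl⟩

end AdjacencyLists

end TreeCover

namespace TreeCover

/-! ## Breadth-first search

Array `3` holds the vertices in the order in which they are found, array `4` the positions of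
their parents, and array `5` holds for each vertex its position plus one, or zero if the vertex
has not been found yet. -/

/-- Process the neighbour with index `reg 6` in array `1`. -/
def searchStep : Program :=
  .seq (.set 8 (.cell 1 (.reg 6)))
  (.seq (.ifLt (.cell 5 (.reg 8)) (.const 1)
    (.seq (.write 5 (.reg 8) (.add (.reg 5) (.const 1)))
    (.seq (.write 3 (.reg 5) (.reg 8))
    (.seq (.write 4 (.reg 5) (.reg 4))
      (.set 5 (.add (.reg 5) (.const 1))))))
    .skip)
  (.set 6 (.add (.reg 6) (.const 1))))

/-- Process all neighbours of the vertex at position `reg 4`. -/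
def searchVertex : Program :=
  .seq (.set 6 (.cell 0 (.cell 3 (.reg 4))))
  (.seq (.set 7 (.cell 0 (.add (.cell 3 (.reg 4)) (.const 1))))
  (.seq (.whileLt (.reg 6) (.reg 7) searchStep)
  (.set 4 (.add (.reg 4) (.const 1)))))

/-- Breadth-first search from the vertex in register `2`. -/
def search : Program :=
  .seq (.write 3 (.const 0) (.reg 2))
  (.seq (.write 5 (.reg 2) (.const 1))
  (.seq (.set 5 (.const 1))
  (.whileLt (.reg 4) (.reg 5) searchVertex)))

theorem Runs.weaken {w M : ℕ} {p : Program} {σ : State} {c c' : ℕ} {Q : State → Prop}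
    (h : Runs w M p σ c Q) (hc : c ≤ c') : Runs w M p σ c' Q :=
  h.mono hc fun _ _ h => h

section

variable {n : ℕ} (T : SimpleGraph (Fin n)) (u : Fin n) (σ₀ : State)

/-- The invariant of the search: `hd` vertices have been processed, `tl` have been found. -/
structure SearchInv (hd tl : ℕ) (σ : State) : Prop where
  frame : ∀ x < 4, σ.reg x = σ₀.reg x
  arr_zero : σ.arr 0 = σ₀.arr 0
  arr_one : σ.arr 1 = σ₀.arr 1
  arr_six : σ.arr 6 = σ₀.arr 6
  head : σ.reg 4 = hd
  tail : σ.reg 5 = tl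
  head_le : hd ≤ tl
  tail_pos : 0 < tl
  root : σ.arr 3 0 = u
  order : ∀ i < tl, σ.arr 3 i < n ∧ σ.arr 5 (σ.arr 3 i) = i + 1
  found : ∀ x < n, σ.arr 5 x ≠ 0 → ∃ i < tl, σ.arr 3 i = x
  parent : ∀ j, 0 < j → j < tl → σ.arr 4 j < j ∧
    ∃ x y : Fin n, x.val = σ.arr 3 j ∧ y.val = σ.arr 3 (σ.arr 4 j) ∧ T.Adj x y
  closed : ∀ i < hd, ∀ x y : Fin n, x.val = σ.arr 3 i → T.Adj x y → σ.arr 5 y ≠ 0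

variable {T u σ₀}

theorem SearchInv.injOn {hd tl : ℕ} {σ : State} (h : SearchInv T u σ₀ hd tl σ) {i j : ℕ}
    (hi : i < tl) (hj : j < tl) (hij : σ.arr 3 i = σ.arr 3 j) : i = j := by
  have h1 := (h.order i hi).2
  have h2 := (h.order j hj).2
  rw [hij] at h1
  omega

theorem SearchInv.tail_le {hd tl : ℕ} {σ : State} (h : SearchInv T u σ₀ hd tl σ) : tl ≤ n := by
  have : Finset.card (Finset.range tl) ≤ Finset.card (Finset.range n) :=
    Finset.card_le_card_of_injOn (σ.arr 3)
      (fun i hi => by simpa using (h.order i (by simpa using hi)).1)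
      (fun i hi j hj hij => h.injOn (by simpa using hi) (by simpa using hj) hij)
  simpa using this

/-- The found vertices are distinct and miss `y`. So the counter can be increased without exceeding
`n`. -/
theorem SearchInv.tail_lt {hd tl : ℕ} {σ : State} (h : SearchInv T u σ₀ hd tl σ) {y : ℕ}
    (hy : y < n) (h0 : σ.arr 5 y = 0) : tl < n := by
  have : Finset.card (Finset.range tl) < Finset.card (Finset.range n) := by
    refine lt_of_le_of_lt (b := Finset.card ((Finset.range n).erase y)) ?_
      (Finset.card_erase_lt_of_mem (by simpa using hy))
    refine Finset.card_le_card_of_injOn (σ.arr 3) (fun i hi => ?_)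
      (fun i hi j hj hij => h.injOn (by simpa using hi) (by simpa using hj) hij)
    have h1 := h.order i (by simpa using hi)
    simp only [Finset.coe_erase, Finset.coe_range, Set.mem_sdiff, Set.mem_Iio,
      Set.mem_singleton_iff]
    refine ⟨h1.1, fun h2 => ?_⟩
    rw [h2, h0] at h1
    omega
  simpa using this

theorem SearchInv.congr {hd tl : ℕ} {σ σ' : State} (h : SearchInv T u σ₀ hd tl σ)
    (harr : σ'.arr = σ.arr) (hreg : ∀ x < 6, σ'.reg x = σ.reg x) :
    SearchInv T u σ₀ hd tl σ' := by
  obtain ⟨h1, h2, h3, h4, h5, h6, h7, h8, h9, h10, h11, h12, h13⟩ := h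
  constructor
  all_goals first | (rw [harr]; assumption) | skip
  · intro x hx
    rw [hreg x (by omega), h1 x hx]
  · rw [hreg 4 (by omega), h5]
  · rw [hreg 5 (by omega), h6]
  · exact h7
  · exact h8

/-- A new vertex is found. -/
theorem SearchInv.push {hd tl : ℕ} {σ σ' : State} (h : SearchInv T u σ₀ hd tl σ) {x y : Fin n}
    (hhd : hd < tl) (hx : σ.arr 3 hd = x) (hxy : T.Adj x y) (h0 : σ.arr 5 y = 0)
    (hreg : ∀ z < 5, σ'.reg z = σ.reg z) (hreg5 : σ'.reg 5 = tl + 1)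
    (harr : ∀ a i, σ'.arr a i = if a = 4 ∧ i = tl then hd else if a = 3 ∧ i = tl then y.val else
      if a = 5 ∧ i = y.val then tl + 1 else σ.arr a i) :
    SearchInv T u σ₀ hd (tl + 1) σ' := by
  have h3 : ∀ i, σ'.arr 3 i = if i = tl then y.val else σ.arr 3 i := fun i => by
    rw [harr]; simp
  have h4 : ∀ i, σ'.arr 4 i = if i = tl then hd else σ.arr 4 i := fun i => by
    rw [harr]; simp
  have h5 : ∀ i, σ'.arr 5 i = if i = y.val then tl + 1 else σ.arr 5 i := fun i => by
    rw [harr]; simp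
  have hy : ∀ i < tl, σ.arr 3 i ≠ y.val := by
    intro i hi he
    have := (h.order i hi).2
    rw [he, h0] at this
    omega
  have htl := h.tail_pos
  constructor
  · intro z hz
    rw [hreg z (by omega), h.frame z hz]
  · rw [← h.arr_zero]; funext i; rw [harr]; simp
  · rw [← h.arr_one]; funext i; rw [harr]; simp
  · rw [← h.arr_six]; funext i; rw [harr]; simp
  · rw [hreg 4 (by omega), h.head]
  · exact hreg5
  · omega
  · omega
  · rw [h3, if_neg (by omega), h.root]
  · intro i hi
    rw [h3]
    by_cases hi' : i = tl
    · rw [if_pos hi', h5, if_pos rfl, hi']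
      exact ⟨y.isLt, rfl⟩
    · rw [if_neg hi', h5, if_neg (hy i (by omega))]
      exact h.order i (by omega)
  · intro z hz hz0
    rw [h5] at hz0
    split_ifs at hz0 with hzy
    · exact ⟨tl, by omega, by rw [h3, if_pos rfl, hzy]⟩
    · obtain ⟨i, hi, hiz⟩ := h.found z hz hz0
      exact ⟨i, by omega, by rw [h3, if_neg (by omega), hiz]⟩
  · intro j hj hjt
    by_cases hj' : j = tl
    · rw [h4, if_pos hj', h3, if_pos hj', h3, if_neg (by omega)]
      exact ⟨by omega, y, x, rfl, hx.symm, hxy.symm⟩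
    · obtain ⟨h6, h7⟩ := h.parent j hj (by omega)
      rw [h4, if_neg hj', h3, if_neg hj', h3, if_neg (by omega)]
      exact ⟨h6, h7⟩
  · intro i hi a b ha hab
    rw [h3, if_neg (by omega)] at ha
    rw [h5]
    split_ifs
    · omega
    · exact h.closed i hi a b ha hab

variable {adj : Fin n → List (Fin n)} {w M : ℕ}

theorem searchStep_runs (hw : Roomy w M) (hadj : IsAdjacencyLists T adj)
    (h0 : ∀ (x : Fin n) l (hl : l < (adj x).length),
      σ₀.arr 1 (offset adj x + l) = ((adj x)[l]).val)
    {hd tl l : ℕ} {σ : State} (h : SearchInv T u σ₀ hd tl σ) {x : Fin n} (hhd : hd < tl)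
    (hx : σ.arr 3 hd = x) (hl : l < (adj x).length) (h6 : σ.reg 6 = offset adj x + l)
    (hnM : n ≤ M) (hoM : offset adj x + l + 1 ≤ M) :
    Runs w M searchStep σ 40 fun σ' => (∃ tl', tl ≤ tl' ∧ SearchInv T u σ₀ hd tl' σ') ∧
      (∀ i < tl, σ'.arr 3 i = σ.arr 3 i) ∧ σ'.reg 6 = offset adj x + l + 1 ∧
      σ'.reg 7 = σ.reg 7 ∧ (∀ y, σ.arr 5 y ≠ 0 → σ'.arr 5 y ≠ 0) ∧
      σ'.arr 5 ((adj x)[l]).val ≠ 0 := by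
  set y := (adj x)[l] with hy
  have hcell : σ.arr 1 (σ.reg 6) = y.val := by rw [h.arr_one, h6, h0 x l hl]
  have hxy : T.Adj x y := ((hadj x).2 y).1 (List.getElem_mem hl)
  have h5 := h.tail
  have h4 := h.head
  have hyn := y.isLt
  unfold searchStep
  apply Runs.weaken
  · apply Runs.seq
    apply Runs.set hw rfl
    · simp only [Expr.eval, hcell]
      omega
    apply Runs.seq
    simp only [Expr.eval, hcell]
    apply Runs.ifLt hw rfl rfl (c := 20)
    · intro hlt
      have hlt0 : σ.arr 5 y.val = 0 := by simpa [Expr.eval] using hlt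
      have htl := h.tail_lt hyn hlt0
      apply Runs.weaken
      · apply Runs.seq
        apply Runs.write hw rfl rfl
        · simp [Expr.eval, h5]; omega
        apply Runs.seq
        apply Runs.write hw rfl rfl
        · simp [Expr.eval]; omega
        apply Runs.seq
        apply Runs.write hw rfl rfl
        · simp [Expr.eval, h4]; omega
        apply Runs.set hw rfl
        · simp [Expr.eval, h5]; omega
        apply Runs.set hw rfl
        · simp [Expr.eval, h6]; omega
        refine ⟨⟨tl + 1, by omega, h.push hhd hx hxy hlt0 ?_ ?_ ?_⟩, ?_, ?_, ?_, ?_, ?_⟩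
        · intro z hz
          have h8 : z ≠ 8 := by omega
          have h6' : z ≠ 6 := by omega
          have h5' : z ≠ 5 := by omega
          simp [h8, h6', h5']
        · simp [Expr.eval, h5]
        · intro a i
          simp [Expr.eval, h5, h4]
        · intro i hi
          have : i ≠ tl := by omega
          simp [Expr.eval, h5, this]
        · simp [Expr.eval, h6]
        · simp
        · intro z hz
          simp [Expr.eval]
          split_ifs <;> simp [hz]
        · simp [Expr.eval]
      · decide
    · intro hlt
      have hlt0 : σ.arr 5 y.val ≠ 0 := by simpa [Expr.eval] using hlt
      apply Runs.weaken
      · apply Runs.skip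
        apply Runs.set hw rfl
        · simp [Expr.eval, h6]; omega
        refine ⟨⟨tl, le_rfl, h.congr rfl ?_⟩, ?_, ?_, ?_, ?_, ?_⟩
        · intro z hz
          have h8 : z ≠ 8 := by omega
          have h6' : z ≠ 6 := by omega
          simp [h8, h6']
        · intro i hi
          rfl
        · simp [Expr.eval, h6]
        · simp
        · intro z hz
          exact hz
        · exact hlt0
      · decide
  · decide

theorem searchVertex_runs (hw : Roomy w M) (hadj : IsAdjacencyLists T adj)
    (h0 : ∀ (x : Fin n) l (hl : l < (adj x).length),
      σ₀.arr 1 (offset adj x + l) = ((adj x)[l]).val)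
    (hoff : ∀ i ≤ n, σ₀.arr 0 i = offset adj i)
    {hd tl : ℕ} {σ : State} (h : SearchInv T u σ₀ hd tl σ) {x : Fin n} (hhd : hd < tl)
    (hx : σ.arr 3 hd = x) (hnM : n < M) (hoM : ∀ i ≤ n, offset adj i ≤ M) :
    Runs w M searchVertex σ ((adj x).length * 43 + 30) fun σ' =>
      (∃ tl', SearchInv T u σ₀ (hd + 1) tl' σ') ∧
      (∀ i < tl, σ'.arr 3 i = σ.arr 3 i) := by
  have hox : σ.arr 0 x.val = offset adj x := by rw [h.arr_zero, hoff _ (by omega)]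
  have hox1 : σ.arr 0 (x.val + 1) = offset adj x + (adj x).length := by
    rw [h.arr_zero, hoff _ (by omega), offset_succ]
  have hxM := hoM x (by omega)
  have hxM1 := hoM (x + 1) (by omega)
  rw [offset_succ] at hxM1
  have h4 := h.head
  unfold searchVertex
  apply Runs.weaken
  · apply Runs.seq
    apply Runs.set hw rfl
    · simp [Expr.eval, h4, hx, hox]; omega
    apply Runs.seq
    apply Runs.set hw rfl
    · simp [Expr.eval, h4, hx, hox1]; omega
    apply Runs.seq
    refine Runs.mono (Runs.while_count hw rfl rfl (c := 40) (N := (adj x).length)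
      (Inv := fun r σ' => ∃ l, l + r = (adj x).length ∧
        (∃ tl', tl ≤ tl' ∧ SearchInv T u σ₀ hd tl' σ') ∧
        (∀ i < tl, σ'.arr 3 i = σ.arr 3 i) ∧ σ'.reg 6 = offset adj x + l ∧
        σ'.reg 7 = offset adj x + (adj x).length ∧
        ∀ l', ∀ (hl' : l' < (adj x).length), l' < l → σ'.arr 5 ((adj x)[l']).val ≠ 0)
      ?_ ?_ ?_) le_rfl ?_
    · rintro r σ' hr ⟨l, hl, ⟨tl', htl', hinv⟩, h3, h6, h7, hdone⟩
      refine ⟨by simp [Expr.eval, h6, h7]; omega, ?_⟩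
      refine Runs.mono (searchStep_runs hw hadj h0 hinv (x := x) (l := l) (by omega)
        (by rw [h3 hd hhd, hx]) (by omega) h6 (by omega) (by omega)) le_rfl ?_
      rintro σ'' - ⟨⟨tl'', htl'', hinv'⟩, h3', h6', h7', hkeep, hnew⟩
      refine ⟨l + 1, by omega, ⟨tl'', by omega, hinv'⟩, ?_, by rw [h6', add_assoc],
        by rw [h7', h7], ?_⟩
      · intro i hi
        rw [h3' i (by omega), h3 i hi]
      · intro l' hl' hll
        by_cases hl1 : l' = l
        · subst hl1
          exact hnew
        · exact hkeep _ (hdone l' hl' (by omega))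
    · rintro σ' ⟨l, hl, -, -, h6, h7, -⟩
      simp [Expr.eval, h6, h7]
      omega
    · refine ⟨0, by omega, ⟨tl, le_rfl, h.congr rfl ?_⟩, ?_, ?_, ?_, ?_⟩
      · intro z hz
        have h7 : z ≠ 7 := by omega
        have h6' : z ≠ 6 := by omega
        simp [h7, h6']
      · intro i _
        rfl
      · simp [Expr.eval, h4, hx, hox]
      · simp [Expr.eval, h4, hx, hox1]
      · intro l' _ hl'
        omega
    · rintro σ' - ⟨l, hl, ⟨tl', htl', hinv⟩, h3, h6, h7, hdone⟩
      have h4' := hinv.head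
      have htn := hinv.tail_le
      apply Runs.set hw rfl
      · simp [Expr.eval, h4']; omega
      refine ⟨⟨tl', ?_⟩, ?_⟩
      · obtain ⟨g1, g2, g3, g4, g5, g6, g7, g8, g9, g10, g11, g12, g13⟩ := hinv
        refine ⟨?_, g2, g3, g4, ?_, ?_, by omega, g8, g9, g10, g11, g12, ?_⟩
        · intro z hz
          have : z ≠ 4 := by omega
          simp [this, g1 z hz]
        · simp [Expr.eval, h4']
        · simp [g6]
        -- Only position `hd` is new here; the completed inner loop has found every entry of the
        -- list of its vertex.
        · intro i hi a b ha hab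
          by_cases hi' : i < hd
          · exact g13 i hi' a b ha hab
          · obtain rfl : i = hd := by omega
            simp only [State.setReg_arr] at ha ⊢
            rw [h3 i hhd, hx] at ha
            obtain rfl : a = x := Fin.ext ha
            have hb := ((hadj a).2 b).2 hab
            obtain ⟨l', hl', rfl⟩ := List.getElem_of_mem hb
            exact hdone l' hl' (by omega)
      · intro i hi
        exact h3 i hi
  · simp only [Expr.cost]
    omega

end

end TreeCover

namespace TreeCover

section

variable {n : ℕ} {T : SimpleGraph (Fin n)} {u : Fin n} {σ₀ : State}
  {adj : Fin n → List (Fin n)} {w M : ℕ}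

/-- The vertices in the queue are distinct, so their degrees sum to at most the total length of the
lists. This keeps the potential of the search from being truncated at zero. -/
theorem SearchInv.sum_degrees_le {hd tl : ℕ} {σ : State} (h : SearchInv T u σ₀ hd tl σ) {m : ℕ}
    (hm : m ≤ tl) :
    ∑ i ∈ Finset.range m, (offset adj (σ.arr 3 i + 1) - offset adj (σ.arr 3 i)) ≤ offset adj n := by
  rw [offset_eq_sum le_rfl, ← Finset.sum_image (s := Finset.range m) (g := σ.arr 3)
    (f := fun x => offset adj (x + 1) - offset adj x)]
  · refine Finset.sum_le_sum_of_subset fun x hx => ?_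
    obtain ⟨i, hi, rfl⟩ := Finset.mem_image.1 hx
    rw [Finset.mem_range] at hi ⊢
    exact (h.order i (by omega)).1
  · intro i hi j hj hij
    simp only [Finset.coe_range, Set.mem_Iio] at hi hj
    exact h.injOn (by omega) (by omega) hij

/-- When all found vertices have been processed, the search has found all vertices. -/
theorem SearchInv.exists_rooting (hT : T.IsTree) {hd tl : ℕ} {σ : State}
    (h : SearchInv T u σ₀ hd tl σ) (hle : tl ≤ hd) :
    ∃ q pos, Rooting T u q pos (σ.arr 4) ∧ ∀ x : Fin n, σ.arr 5 x = pos x + 1 := by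
  obtain rfl : hd = tl := le_antisymm h.head_le hle
  have hall : ∀ x : Fin n, σ.arr 5 x ≠ 0 := by
    -- When the queue is exhausted, the set of found vertices is closed under adjacency, so by
    -- connectedness it is everything.
    have hwalk : ∀ a b : Fin n, T.Walk a b → σ.arr 5 a ≠ 0 → σ.arr 5 b ≠ 0 := by
      intro a b p
      induction p with
      | nil => exact id
      | cons hab p ih =>
        intro ha
        obtain ⟨i, hi, hia⟩ := h.found _ (Fin.isLt _) ha
        exact ih (h.closed i hi _ _ hia.symm hab)
    intro x
    obtain ⟨p⟩ := hT.connected.preconnected u x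
    refine hwalk u x p ?_
    have h1 := h.order 0 h.tail_pos
    rw [h.root] at h1
    omega
  choose! f hf1 hf2 using fun (x : Fin n) => h.found x x.isLt (hall x)
  have hpos : ∀ x : Fin n, σ.arr 5 x = f x + 1 := fun x => by
    have := (h.order (f x) (hf1 x)).2
    rwa [hf2] at this
  have htl : hd = n := by
    refine le_antisymm h.tail_le ?_
    have : Fintype.card (Fin n) ≤ Fintype.card (Fin hd) :=
      Fintype.card_le_of_injective (fun x => ⟨f x, hf1 x⟩) fun x y hxy => by
        have h1 : f x = f y := by simpa using hxy
        have h2 := hf2 x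
        rw [h1, hf2 y] at h2
        exact (Fin.ext h2).symm
    simpa using this
  have hq : ∀ i, i < n → σ.arr 3 i < n := fun i hi => (h.order i (by omega)).1
  set q : ℕ → Fin n := fun i => if hi : i < n then ⟨σ.arr 3 i, hq i hi⟩ else u with hqdef
  have hqv : ∀ i, i < n → (q i).val = σ.arr 3 i := fun i hi => by
    rw [hqdef]; simp [hi]
  have hposq : ∀ i < n, f (q i) = i := fun i hi => by
    have h1 := hpos (q i)
    rw [hqv i hi, (h.order i (by omega)).2] at h1
    omega
  refine ⟨q, f, Rooting.of_isTree hT ?_ ?_ hposq ?_ ?_ ?_, hpos⟩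
  · intro x
    have := hf1 x
    omega
  · intro x
    have := hf1 x
    exact Fin.ext (by rw [hqv _ (by omega), hf2])
  · have h1 := (h.order 0 h.tail_pos).2
    rw [h.root, hpos] at h1
    omega
  · intro j hj hjn
    exact (h.parent j hj (by omega)).1
  · intro j hj hjn
    obtain ⟨h1, x, y, hx, hy, hxy⟩ := h.parent j hj (by omega)
    rw [← hqv j hjn] at hx
    rw [← hqv _ (by omega)] at hy
    rwa [← Fin.ext hx, ← Fin.ext hy]

theorem search_runs (hw : Roomy w M) (hT : T.IsTree) (hadj : IsAdjacencyLists T adj)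
    (h0 : ∀ (x : Fin n) l (hl : l < (adj x).length),
      σ₀.arr 1 (offset adj x + l) = ((adj x)[l]).val)
    (hoff : ∀ i ≤ n, σ₀.arr 0 i = offset adj i) (hu : σ₀.reg 2 = u)
    (h4 : σ₀.reg 4 = 0) (h5 : ∀ i, σ₀.arr 5 i = 0) (hnM : n < M)
    (hoM : ∀ i ≤ n, offset adj i ≤ M) :
    Runs w M search σ₀ (140 * n + 20) fun σ => (∀ x < 4, σ.reg x = σ₀.reg x) ∧
      σ.arr 6 = σ₀.arr 6 ∧
      ∃ q pos, Rooting T u q pos (σ.arr 4) ∧ ∀ x : Fin n, σ.arr 5 x = pos x + 1 := by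
  have hn : 0 < n := u.pos
  have hM := hw.1
  have hdeg : ∀ x : Fin n, offset adj (x + 1) - offset adj x = (adj x).length := fun x => by
    rw [offset_succ]; omega
  have hun := u.isLt
  unfold search
  apply Runs.weaken
  · apply Runs.seq
    apply Runs.write hw rfl rfl
    · simp [Expr.eval, hu]; omega
    apply Runs.seq
    apply Runs.write hw rfl rfl
    · simp [Expr.eval]; omega
    apply Runs.seq
    apply Runs.set hw rfl
    · simp [Expr.eval]; omega
    refine Runs.mono (Runs.while_potential hw rfl rfl
      (Inv := fun σ => ∃ hd tl, SearchInv T u σ₀ hd tl σ)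
      -- Amortization: `43` units for each list entry not yet scanned, and `33 = 30 + 3` for each
      -- vertex not yet processed, where `3` pays for the loop test.
      (Φ := fun σ => 33 * (n - σ.reg 4) + 43 * (offset adj n - ∑ i ∈ Finset.range (σ.reg 4),
        (offset adj (σ.arr 3 i + 1) - offset adj (σ.arr 3 i)))) ?_ ?_) (c' := 33 * n + 43 * (2 * n) + 3) ?_ ?_
    · rintro σ ⟨hd, tl, hinv⟩ hlt
      have hlt' : hd < tl := by simpa [Expr.eval, hinv.head, hinv.tail] using hlt
      have hx := (hinv.order hd hlt').1
      refine ⟨_, Runs.mono (searchVertex_runs hw hadj h0 hoff hinv (x := ⟨σ.arr 3 hd, hx⟩) hlt' rfl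
        hnM hoM) le_rfl ?_⟩
      rintro σ' - ⟨⟨tl', hinv'⟩, h3⟩
      refine ⟨⟨_, _, hinv'⟩, ?_⟩
      have hs := hinv.sum_degrees_le (adj := adj) (m := hd + 1) (by omega)
      have htn := hinv.tail_le
      have hd1 := hdeg ⟨σ.arr 3 hd, hx⟩
      simp only at hd1
      rw [hinv.head, hinv'.head, Finset.sum_congr rfl (s₁ := Finset.range (hd + 1))
        (g := fun i => offset adj (σ.arr 3 i + 1) - offset adj (σ.arr 3 i)) fun i hi => by
          rw [h3 i (by rw [Finset.mem_range] at hi; omega)]]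
      rw [Finset.sum_range_succ, hd1] at hs ⊢
      simp only [Expr.cost]
      omega
    · refine ⟨0, 1, ?_⟩
      simp only [Expr.eval, hu]
      constructor
      · intro x hx
        have : x ≠ 5 := by omega
        simp [this]
      · funext i; simp
      · funext i; simp
      · funext i; simp
      · simp [h4]
      · simp
      · omega
      · omega
      · simp
      · intro i hi
        obtain rfl : i = 0 := by omega
        simp [hu]
      · intro x hx hx0
        refine ⟨0, by omega, ?_⟩
        simp [hu] at hx0
        by_contra hne
        have hxu : ¬ x = u.val := fun hh => hne (by simp [hh])
        rw [if_neg hxu, h5] at hx0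
        exact hx0 rfl
      · intro j hj hj1
        omega
      · intro i hi
        omega
    · have := offset_le hT hadj
      simp only [Expr.cost]
      simp
      rw [h4, Finset.range_zero, Finset.sum_empty]
      omega
    · rintro σ - ⟨⟨hd, tl, hinv⟩, hge⟩
      have hge' : tl ≤ hd := by simpa [Expr.eval, hinv.head, hinv.tail] using hge
      exact ⟨hinv.frame, hinv.arr_six, hinv.exists_rooting hT hge'⟩
  · simp only [Expr.cost]
    omega

end

end TreeCover

namespace TreeCover

/-! ## The program for the dynamic program

Array `6` holds the indicator of the ancestors of `v`; arrays `7` and `8` hold the tables (no edge,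
or one edge may be left out), where row `x` starts at index `x * (2 * k + 1)`. -/

/-- Mark the ancestors of `v`. -/
def climb : Program :=
  .seq (.set 10 (.sub (.cell 5 (.reg 3)) (.const 1)))
  (.whileLt (.const 0) (.reg 10)
    (.seq (.write 6 (.reg 10) (.add (.cell 6 (.reg 10)) (.const 1)))
      (.set 10 (.cell 4 (.reg 10)))))

theorem climb_runs {w M : ℕ} (hw : Roomy w M) {n b : ℕ} {pp : ℕ → ℕ} {σ : State}
    (hpp : ∀ j, 0 < j → j < n → pp j < j) (h4 : σ.arr 4 = pp)
    (h5 : σ.arr 5 (σ.reg 3) = b + 1) (hb : b < n) (h6 : ∀ i, σ.arr 6 i = 0) (hnM : n ≤ M) :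
    Runs w M climb σ (12 * n + 10) fun σ' => (∀ x < 10, σ'.reg x = σ.reg x) ∧
      σ'.arr 4 = pp ∧ ∀ x, 0 < x → σ'.arr 6 x = anc pp x b := by
  unfold climb
  apply Runs.weaken
  · apply Runs.seq
    apply Runs.set hw rfl
    · simp [Expr.eval, h5]; omega
    refine Runs.mono (Runs.while_potential hw rfl rfl
      (Inv := fun σ' => (∀ x < 10, σ'.reg x = σ.reg x) ∧ σ'.arr 4 = pp ∧ σ'.reg 10 < n ∧
        -- The marks set so far account for the path from `b` down to, but excluding, the current
        -- vertex; the ancestors still to be marked are those of the current vertex.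
        ∀ x, 0 < x → σ'.arr 6 x + anc pp x (σ'.reg 10) = anc pp x b)
      (Φ := fun σ' => 12 * σ'.reg 10) ?_ ?_) (c' := 12 * n + 3) ?_ ?_
    · rintro τ ⟨i1, i2, i3, i4⟩ hlt
      have hpos : 0 < τ.reg 10 := hlt
      have hp := hpp _ hpos i3
      have h60 := i4 _ hpos
      rw [anc_self] at h60
      have := anc_le_one (pp := pp) (τ.reg 10) b
      refine ⟨9, Runs.weaken (c := 6 + 3) ?_ (by decide)⟩
      apply Runs.seq
      apply Runs.write hw rfl rfl
      · simp [Expr.eval]; omega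
      apply Runs.set hw rfl
      · simp [Expr.eval, i2]; omega
      refine ⟨⟨?_, ?_, ?_, ?_⟩, ?_⟩
      · intro x hx
        have : x ≠ 10 := by omega
        simp [this, i1 x hx]
      · rw [← i2]; funext i; simp
      · simp [Expr.eval, i2]; omega
      · intro x hx
        have h7 := i4 x hx
        rw [anc_of_pos hpos hp] at h7
        simp [Expr.eval, i2]
        split_ifs at h7 ⊢ with h8 <;> first | omega | (rw [← h8]; rw [← h8] at h7; omega)
      · simp [Expr.eval, i2, Expr.cost]
        omega
    · refine ⟨?_, ?_, ?_, ?_⟩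
      · intro x hx
        have : x ≠ 10 := by omega
        simp [this]
      · exact h4
      · simp [Expr.eval, h5]; omega
      · intro x hx
        simp [Expr.eval, h5, h6]
    · simp [Expr.eval, h5, Expr.cost]; omega
    · rintro σ' - ⟨⟨i1, i2, i3, i4⟩, hge⟩
      have h0 : σ'.reg 10 = 0 := by simpa [Expr.eval] using hge
      refine ⟨i1, i2, fun x hx => ?_⟩
      have := i4 x hx
      rwa [h0, anc_zero, if_neg (by omega), add_zero] at this
  · simp only [Expr.cost]
    omega

/-- The expression for the minimum of two numbers. -/
def Expr.min (x y : Expr) : Expr := .sub x (.sub x y)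

theorem Expr.eval_min (σ : State) (x y : Expr) :
    (Expr.min x y).eval σ = Min.min (x.eval σ) (y.eval σ) := by
  simp only [Expr.min, Expr.eval]
  omega

/-- The entry of a table in row `reg x` and column `i`. -/
def Expr.entry (a x : ℕ) (i : Expr) : Expr := .cell a (.add (.mul (.reg x) (.reg 9)) i)

/-- The flow through the edge above `reg 14`, if `reg 17` robots end below it. -/
def Expr.flow : Expr :=
  .add (.sub (.mul (.reg 12) (.cell 6 (.reg 14))) (.reg 17))
    (.sub (.reg 17) (.mul (.reg 12) (.cell 6 (.reg 14))))

/-- Compute the candidates for `reg 17` robots that end below `reg 14`. -/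
def candidates : Program :=
  .seq (.set 20 (.add .flow (.mul (.const 2) (.sub (.const 1) .flow))))
  (.seq (.set 21 (.add .flow (.mul (.mul (.const 2) (.sub (.const 1) .flow))
    (.sub (.const 1) (.cell 6 (.reg 14))))))
  (.seq (.set 22 (.add (.add (.reg 20) (.entry 7 14 (.reg 17)))
    (.entry 7 15 (.sub (.reg 16) (.reg 17)))))
  (.set 23 (.min (.min
    (.add (.add (.reg 20) (.entry 8 14 (.reg 17))) (.entry 7 15 (.sub (.reg 16) (.reg 17))))
    (.add (.add (.reg 20) (.entry 7 14 (.reg 17))) (.entry 8 15 (.sub (.reg 16) (.reg 17)))))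
    (.add (.add (.reg 21) (.entry 7 14 (.reg 17)))
      (.entry 7 15 (.sub (.reg 16) (.reg 17))))))))

/-- Compute the new entries in row `reg 15` and column `reg 16`. -/
def computeEntry : Program :=
  .seq (.set 17 (.const 0))
  (.seq candidates
  (.seq (.set 18 (.reg 22))
  (.seq (.set 19 (.reg 23))
  (.whileLt (.reg 17) (.reg 16)
    (.seq (.set 17 (.add (.reg 17) (.const 1)))
    (.seq candidates
    (.seq (.set 18 (.min (.reg 18) (.reg 22)))
      (.set 19 (.min (.reg 19) (.reg 23))))))))))

/-- Merge row `reg 14` into row `reg 15`. -/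
def mergeRow : Program :=
  .seq (.set 16 (.add (.reg 13) (.const 1)))
  (.whileLt (.const 0) (.reg 16)
    (.seq (.set 16 (.sub (.reg 16) (.const 1)))
    (.seq computeEntry
    (.seq (.write 8 (.add (.mul (.reg 15) (.reg 9)) (.reg 16)) (.reg 19))
      (.write 7 (.add (.mul (.reg 15) (.reg 9)) (.reg 16)) (.reg 18))))))

/-- Merge all rows. -/
def mergeAll : Program :=
  .seq (.set 14 (.reg 0))
  (.whileLt (.const 1) (.reg 14)
    (.seq (.set 14 (.sub (.reg 14) (.const 1)))
    (.seq (.set 15 (.cell 4 (.reg 14)))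
      mergeRow)))

/-- Set the entries of the tables to zero. -/
def clearTables : Program :=
  .seq (.set 14 (.const 0))
  (.whileLt (.reg 14) (.mul (.reg 0) (.reg 9))
    (.seq (.write 7 (.reg 14) (.const 0))
    (.seq (.write 8 (.reg 14) (.const 0))
      (.set 14 (.add (.reg 14) (.const 1))))))

/-- Compute the value for `reg 11` and `reg 12` robots. -/
def solvePair : Program :=
  .seq (.set 13 (.add (.reg 11) (.reg 12)))
  (.seq clearTables
  (.seq mergeAll
    (.write 2 (.add (.mul (.reg 11) (.add (.reg 1) (.const 1))) (.reg 12)) (.cell 8 (.reg 13)))))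

/-- The whole algorithm. -/
def twoSources : Program :=
  .seq search
  (.seq climb
  (.seq (.set 9 (.add (.mul (.const 2) (.reg 1)) (.const 1)))
  (.seq (.set 11 (.const 0))
  (.seq
    (.whileLt (.reg 11) (.add (.reg 1) (.const 1))
      (.seq (.set 12 (.const 0))
      (.seq
        (.whileLt (.reg 12) (.add (.reg 1) (.const 1))
          (.seq solvePair (.set 12 (.add (.reg 12) (.const 1)))))
        (.set 11 (.add (.reg 11) (.const 1))))))
    (.write 2 (.const 0) (.mul (.const 2) (.sub (.reg 0) (.const 1))))))))

/-- Different entries of a two-dimensional table never share a cell of the array. -/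
theorem index_inj {W x y a b : ℕ} (ha : a < W) (hb : b < W) (h : x * W + a = y * W + b) :
    x = y ∧ a = b := by
  rcases lt_trichotomy x y with hlt | rfl | hlt
  · have := Nat.mul_le_mul_right W (Nat.succ_le_of_lt hlt)
    rw [Nat.succ_mul] at this
    omega
  · exact ⟨rfl, by omega⟩
  · have := Nat.mul_le_mul_right W (Nat.succ_le_of_lt hlt)
    rw [Nat.succ_mul] at this
    omega

/-! ### Computing a single entry -/

section

variable {w M : ℕ}

theorem edgeCost_zero_eq (on : ℕ → ℕ) (t j a : ℕ) :
    edgeCost on t j a 0 = gap (t * on j) a + 2 * (1 - gap (t * on j) a) := by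
  simp [edgeCost]

theorem edgeCost_one_eq (on : ℕ → ℕ) (t j a : ℕ) :
    edgeCost on t j a 1 = gap (t * on j) a + 2 * (1 - gap (t * on j) a) * (1 - on j) := by
  simp [edgeCost]

theorem edgeCost_le {on : ℕ → ℕ} (hon : ∀ j, on j ≤ 1) (t j a b : ℕ) :
    edgeCost on t j a b ≤ t + a + 2 := by
  have h1 : t * on j ≤ t * 1 := Nat.mul_le_mul_left t (hon j)
  have h2 : 2 * (1 - gap (t * on j) a) * (1 - b * on j) ≤ 2 * (1 - gap (t * on j) a) * 1 :=
    Nat.mul_le_mul_left _ (by omega)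
  unfold edgeCost
  unfold gap at *
  omega

/-- The data that are needed for the computation of one entry. -/
structure EntryInv (on : ℕ → ℕ) (G : Table) (W t j p e : ℕ) (σ : State) : Prop where
  width : σ.reg 9 = W
  robots : σ.reg 12 = t
  child : σ.reg 14 = j
  parent : σ.reg 15 = p
  column : σ.reg 16 = e
  on_path : σ.arr 6 j = on j
  child_zero : ∀ a ≤ e, σ.arr 7 (j * W + a) = G j a 0
  child_one : ∀ a ≤ e, σ.arr 8 (j * W + a) = G j a 1
  parent_zero : ∀ a ≤ e, σ.arr 7 (p * W + a) = G p a 0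
  parent_one : ∀ a ≤ e, σ.arr 8 (p * W + a) = G p a 1

theorem EntryInv.congr {on : ℕ → ℕ} {G : Table} {W t j p e : ℕ} {σ σ' : State}
    (h : EntryInv on G W t j p e σ) (harr : σ'.arr = σ.arr)
    (hreg : ∀ x < 17, σ'.reg x = σ.reg x) : EntryInv on G W t j p e σ' := by
  obtain ⟨h1, h2, h3, h4, h5, h6, h7, h8, h9, h10⟩ := h
  constructor
  all_goals first
    | (rw [harr]; assumption)
    | (rw [hreg _ (by omega)]; assumption)

variable {on : ℕ → ℕ} {G : Table} {W t j p e B : ℕ} {σ : State}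

theorem candidates_runs (hw : Roomy w M) (hon : ∀ j, on j ≤ 1) (hG : ∀ x a b, G x a b ≤ B)
    (h : EntryInv on G W t j p e σ) {a : ℕ} (ha : a ≤ e) (h17 : σ.reg 17 = a)
    (hM : t + e + 2 + 2 * B ≤ M) :
    Runs w M candidates σ 300 fun σ' => σ'.arr = σ.arr ∧ (∀ x < 20, σ'.reg x = σ.reg x) ∧
      σ'.reg 22 = cand₀ (edgeCost on t) G j p e a ∧
      σ'.reg 23 = cand₁ (edgeCost on t) G j p e a := by
  obtain ⟨h1, h2, h3, h4, h5, h6, h7, h8, h9, h10⟩ := h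
  have hc0 := edgeCost_le hon t j a 0
  have hc1 := edgeCost_le hon t j a 1
  have g1 := hG j a 0
  have g2 := hG j a 1
  have g3 := hG p (e - a) 0
  have g4 := hG p (e - a) 1
  have e1 : Expr.eval σ (.add .flow (.mul (.const 2) (.sub (.const 1) .flow)))
      = edgeCost on t j a 0 := by
    rw [edgeCost_zero_eq]
    simp [Expr.flow, Expr.eval, h2, h3, h6, h17, gap]
  have e2 : ∀ v, Expr.eval (σ.setReg 20 v) (.add .flow (.mul (.mul (.const 2)
      (.sub (.const 1) .flow)) (.sub (.const 1) (.cell 6 (.reg 14))))) = edgeCost on t j a 1 := by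
    intro v
    rw [edgeCost_one_eq]
    simp [Expr.flow, Expr.eval, h2, h3, h6, h17, gap]
  unfold candidates
  apply Runs.weaken
  · apply Runs.seq
    apply Runs.set hw rfl
    · rw [e1]; omega
    rw [e1]
    apply Runs.seq
    apply Runs.set hw rfl
    · rw [e2]; omega
    rw [e2]
    apply Runs.seq
    apply Runs.set hw rfl
    · simp [Expr.entry, Expr.eval, h1, h3, h4, h5, h17, h7 a ha, h9 (e - a) (by omega)]
      omega
    apply Runs.set hw rfl
    · simp [Expr.eval_min, Expr.entry, Expr.eval, h1, h3, h4, h5, h17, h7 a ha, h8 a ha,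
        h9 (e - a) (by omega), h10 (e - a) (by omega)]
      omega
    refine ⟨?_, ?_, ?_, ?_⟩
    · simp
    · intro x hx
      have i1 : x ≠ 20 := by omega
      have i2 : x ≠ 21 := by omega
      have i3 : x ≠ 22 := by omega
      have i4 : x ≠ 23 := by omega
      simp [i1, i2, i3, i4]
    · simp [Expr.entry, Expr.eval, h1, h3, h4, h5, h17, h7 a ha, h9 (e - a) (by omega), cand₀]
    · simp [Expr.eval_min, Expr.entry, Expr.eval, h1, h3, h4, h5, h17, h7 a ha, h8 a ha,
        h9 (e - a) (by omega), h10 (e - a) (by omega), cand₁]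
  · decide

/-- For `cand₁` it is enough to bound one of the three terms of the minimum. -/
theorem cand_le (hon : ∀ j, on j ≤ 1) (hG : ∀ x a b, G x a b ≤ B) {a : ℕ} (ha : a ≤ e) :
    cand₀ (edgeCost on t) G j p e a ≤ t + e + 2 + 2 * B ∧
    cand₁ (edgeCost on t) G j p e a ≤ t + e + 2 + 2 * B := by
  have hc0 := edgeCost_le hon t j a 0
  have g1 := hG j a 0
  have g2 := hG j a 1
  have g3 := hG p (e - a) 0
  constructor
  · unfold cand₀
    omega
  · refine (min_le_left _ _).trans ((min_le_left _ _).trans ?_)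
    omega

theorem computeEntry_runs (hw : Roomy w M) (hon : ∀ j, on j ≤ 1) (hG : ∀ x a b, G x a b ≤ B)
    (h : EntryInv on G W t j p e σ) (hM : t + e + 2 + 2 * B ≤ M) :
    Runs w M computeEntry σ (400 * (e + 1)) fun σ' => σ'.arr = σ.arr ∧
      (∀ x < 17, σ'.reg x = σ.reg x) ∧
      σ'.reg 18 = minUpTo (cand₀ (edgeCost on t) G j p e) e ∧
      σ'.reg 19 = minUpTo (cand₁ (edgeCost on t) G j p e) e := by
  have hcand := fun a (ha : a ≤ e) => cand_le (t := t) (j := j) (p := p) hon hG ha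
  have hmin : ∀ a ≤ e, minUpTo (cand₀ (edgeCost on t) G j p e) a ≤ M ∧
      minUpTo (cand₁ (edgeCost on t) G j p e) a ≤ M := fun a ha =>
    ⟨(minUpTo_le _ (Nat.zero_le a)).trans ((hcand 0 (by omega)).1.trans hM),
      (minUpTo_le _ (Nat.zero_le a)).trans ((hcand 0 (by omega)).2.trans hM)⟩
  unfold computeEntry
  apply Runs.weaken
  · apply Runs.seq
    apply Runs.set hw rfl
    · simp [Expr.eval]
    apply Runs.seq
    refine Runs.mono (candidates_runs
      (σ := σ.setReg 17 (Expr.eval σ (.const 0))) hw hon hG (h.congr rfl ?_) (Nat.zero_le e) ?_ hM) le_rfl ?_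
    · intro x hx
      have : x ≠ 17 := by omega
      simp [this]
    · simp [Expr.eval]
    rintro τ - ⟨h1, h2, h3, h4⟩
    apply Runs.seq
    apply Runs.set hw rfl
    · simp only [Expr.eval, h3]
      exact (hcand 0 (Nat.zero_le _)).1.trans hM
    apply Runs.seq
    apply Runs.set hw rfl
    · simp [Expr.eval, h4]
      exact (hcand 0 (Nat.zero_le _)).2.trans hM
    refine Runs.mono (Runs.while_count hw rfl rfl (c := 360) (N := e)
      (Inv := fun r σ' => ∃ a, a + r = e ∧ σ'.arr = σ.arr ∧ (∀ x < 17, σ'.reg x = σ.reg x) ∧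
        σ'.reg 17 = a ∧ σ'.reg 18 = minUpTo (cand₀ (edgeCost on t) G j p e) a ∧
        σ'.reg 19 = minUpTo (cand₁ (edgeCost on t) G j p e) a) ?_ ?_ ?_) le_rfl ?_
    · rintro r σ' hr ⟨a, hae, i1, i2, i3, i4, i5⟩
      have h16 : σ'.reg 16 = e := by rw [i2 16 (by omega), h.column]
      refine ⟨by simp [Expr.eval, h16, i3]; omega, ?_⟩
      apply Runs.weaken
      · apply Runs.seq
        apply Runs.set hw rfl
        · simp [Expr.eval, i3]; omega
        apply Runs.seq
        refine Runs.mono (candidates_runs hw hon hG (h.congr ?_ ?_) (a := a + 1) (by omega) ?_ hM)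
          le_rfl ?_
        · exact i1
        · intro x hx
          have : x ≠ 17 := by omega
          simp [this, i2 x hx]
        · simp [Expr.eval, i3]
        rintro τ' - ⟨k1, k2, k3, k4⟩
        have k18 : τ'.reg 18 = minUpTo (cand₀ (edgeCost on t) G j p e) a := by
          rw [k2 18 (by omega)]; simp [i4]
        have k19 : τ'.reg 19 = minUpTo (cand₁ (edgeCost on t) G j p e) a := by
          rw [k2 19 (by omega)]; simp [i5]
        have hma := hmin a (by omega)
        apply Runs.seq
        apply Runs.set hw rfl
        · rw [Expr.eval_min]
          exact (min_le_left _ _).trans (by simpa [Expr.eval, k18] using hma.1)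
        apply Runs.set hw rfl
        · rw [Expr.eval_min]
          exact (min_le_left _ _).trans (by simpa [Expr.eval, k19] using hma.2)
        refine ⟨a + 1, by omega, ?_, ?_, ?_, ?_, ?_⟩
        · simp [k1, i1]
        · intro x hx
          have j1 : x ≠ 17 := by omega
          have j2 : x ≠ 18 := by omega
          have j3 : x ≠ 19 := by omega
          simp [j2, j3, k2 x (by omega), j1, i2 x hx]
        · simp [k2 17 (by omega), Expr.eval, i3]
        · simp [Expr.eval_min, Expr.eval, k18, k3, minUpTo]
        · simp [Expr.eval_min, Expr.eval, k19, k4, minUpTo]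
      · decide
    · rintro σ' ⟨a, hae, i1, i2, i3, i4, i5⟩
      have h16 : σ'.reg 16 = e := by rw [i2 16 (by omega), h.column]
      simp [Expr.eval, h16, i3]
      omega
    · refine ⟨0, by omega, ?_, ?_, ?_, ?_, ?_⟩
      · simp [h1]
      · intro x hx
        have j1 : x ≠ 17 := by omega
        have j2 : x ≠ 18 := by omega
        have j3 : x ≠ 19 := by omega
        simp [j2, j3, h2 x (by omega), j1]
      · simp [h2 17 (by omega), Expr.eval]
      · simp [Expr.eval, h3, minUpTo]
      · simp [Expr.eval, h4, minUpTo]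
    · rintro σ' - ⟨a, hae, i1, i2, i3, i4, i5⟩
      obtain rfl : a = e := by omega
      exact ⟨i1, i2, i4, i5⟩
  · simp only [Expr.cost]
    omega

end

end TreeCover

namespace TreeCover

/-! ### Merging rows and solving one pair -/

section

variable {w M : ℕ}

/-- Arrays `7` and `8` hold the table `G`, for at most `R` robots. -/
def HoldsTable (n W R : ℕ) (G : Table) (σ : State) : Prop :=
  ∀ x < n, ∀ a ≤ R, σ.arr 7 (x * W + a) = G x a 0 ∧ σ.arr 8 (x * W + a) = G x a 1

variable {on : ℕ → ℕ} {G : Table} {n W R t j p B : ℕ} {σ : State}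

theorem mergeRow_runs (hw : Roomy w M) (hon : ∀ j, on j ≤ 1) (hG : ∀ x a b, G x a b ≤ B)
    (hj : j < n) (hp : p < n) (hpj : p ≠ j) (hRW : R < W) (h6 : σ.arr 6 j = on j)
    (h9 : σ.reg 9 = W) (h12 : σ.reg 12 = t) (h13 : σ.reg 13 = R) (h14 : σ.reg 14 = j)
    (h15 : σ.reg 15 = p) (hT : HoldsTable n W R G σ) (hM : t + R + 2 + 2 * B ≤ M) :
    Runs w M mergeRow σ (450 * (R + 1) * (R + 1) + 10) fun σ' => (∀ x < 16, σ'.reg x = σ.reg x) ∧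
      (∀ a < 7, σ'.arr a = σ.arr a) ∧
      HoldsTable n W R (mergeTable (edgeCost on t) G j p) σ' := by
  unfold mergeRow
  apply Runs.weaken
  · apply Runs.seq
    apply Runs.set hw rfl
    · simp [Expr.eval, h13]; omega
    refine Runs.mono (Runs.while_count hw rfl rfl (c := 400 * (R + 1) + 30) (N := R + 1)
      (Inv := fun r σ' => (∀ x < 16, σ'.reg x = σ.reg x) ∧ (∀ a < 7, σ'.arr a = σ.arr a) ∧
        σ'.reg 16 = r ∧ ∀ x < n, ∀ a ≤ R,
          σ'.arr 7 (x * W + a) = (if x = p ∧ r ≤ a then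
            minUpTo (cand₀ (edgeCost on t) G j p a) a else G x a 0) ∧
          σ'.arr 8 (x * W + a) = (if x = p ∧ r ≤ a then
            minUpTo (cand₁ (edgeCost on t) G j p a) a else G x a 1)) ?_ ?_ ?_) le_rfl ?_
    · rintro r σ' hr ⟨i1, i2, i3, i4⟩
      refine ⟨by simp [Expr.eval, i3], ?_⟩
      apply Runs.weaken
      · apply Runs.seq
        apply Runs.set hw rfl
        · simp [Expr.eval, i3]; omega
        apply Runs.seq
        refine Runs.mono (computeEntry_runs (on := on) (G := G) (W := W) (t := t) (j := j) (p := p)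
          (e := r) (B := B) (σ := σ'.setReg 16 (Expr.eval σ' (.sub (.reg 16) (.const 1))))
          hw hon hG ?_ (by omega)) (c' := 400 * (R + 1)) (Nat.mul_le_mul_left _ (by omega)) ?_
        · constructor
          · simp [i1 9, h9]
          · simp [i1 12, h12]
          · simp [i1 14, h14]
          · simp [i1 15, h15]
          · simp [Expr.eval, i3]
          · simp [i2 6, h6]
          · intro a ha
            rw [State.setReg_arr, (i4 j hj a (by omega)).1, if_neg (by omega)]
          · intro a ha
            rw [State.setReg_arr, (i4 j hj a (by omega)).2, if_neg (by omega)]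
          · intro a ha
            rw [State.setReg_arr, (i4 p hp a (by omega)).1, if_neg (by omega)]
          · intro a ha
            rw [State.setReg_arr, (i4 p hp a (by omega)).2, if_neg (by omega)]
        rintro τ hτ ⟨k1, k2, k3, k4⟩
        have k9 : τ.reg 9 = W := by rw [k2 9 (by omega)]; simp [i1 9, h9]
        have k15 : τ.reg 15 = p := by rw [k2 15 (by omega)]; simp [i1 15, h15]
        have k16 : τ.reg 16 = r := by rw [k2 16 (by omega)]; simp [Expr.eval, i3]
        apply Runs.seq
        apply Runs.write hw rfl rfl
        -- The value comes from a register of a bounded state, so nothing has to be computed about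
        -- it.
        · exact hτ.1 19
        apply Runs.write hw rfl rfl
        · simpa [Expr.eval] using hτ.1 18
        simp only [Expr.eval, State.setArr_reg, k9, k15, k16, k3, k4]
        refine ⟨?_, ?_, ?_, ?_⟩
        · intro x hx
          have : x ≠ 16 := by omega
          simp [k2 x (by omega), this, i1 x hx]
        · intro a ha
          have j7 : a ≠ 7 := by omega
          have j8 : a ≠ 8 := by omega
          rw [← i2 a ha]
          funext i
          simp [j7, j8, k1]
        · simp
        · intro x hx a ha
          have hidx : x * W + a = p * W + r ↔ x = p ∧ a = r :=
            ⟨fun h => index_inj (by omega) (by omega) h, by rintro ⟨rfl, rfl⟩; rfl⟩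
          have i5 := i4 x hx a ha
          simp only [State.setArr_arr, hidx, true_and, k1, State.setReg_arr, i5]
          constructor
          · by_cases h : x = p ∧ a = r
            · obtain ⟨rfl, rfl⟩ := h
              simp
            · rw [if_neg h, if_neg (by simp)]
              by_cases h' : x = p ∧ r + 1 ≤ a
              · rw [if_pos h', if_pos (by omega)]
              · rw [if_neg h', if_neg (by omega)]
          · by_cases h : x = p ∧ a = r
            · obtain ⟨rfl, rfl⟩ := h
              simp
            · rw [if_neg (by simp), if_neg h]
              by_cases h' : x = p ∧ r + 1 ≤ a
              · rw [if_pos h', if_pos (by omega)]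
              · rw [if_neg h', if_neg (by omega)]
      · simp only [Expr.cost]
        omega
    · rintro σ' ⟨-, -, i3, -⟩
      simp [Expr.eval, i3]
    · refine ⟨?_, ?_, ?_, ?_⟩
      · intro x hx
        have : x ≠ 16 := by omega
        simp [this]
      · intro a _
        rfl
      · simp [Expr.eval, h13]
      · intro x hx a ha
        rw [if_neg (by omega), if_neg (by omega)]
        exact hT x hx a ha
    · rintro σ' - ⟨i1, i2, i3, i4⟩
      refine ⟨i1, i2, fun x hx a ha => ?_⟩
      have i5 := i4 x hx a ha
      by_cases h : x = p
      · subst h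
        rw [i5.1, i5.2, mergeTable_zero, mergeTable_one]
        simp
      · rw [i5.1, i5.2, mergeTable_of_ne h]
        simp [h]
  · simp only [Expr.cost]
    nlinarith

theorem mergeAll_runs {pp : ℕ → ℕ} (hw : Roomy w M) (hon : ∀ j, on j ≤ 1) (hn : 0 < n)
    (hpp : ∀ j, 0 < j → j < n → pp j < j) (hRW : R < W) (h0 : σ.reg 0 = n)
    (h4 : σ.arr 4 = pp) (h6 : ∀ j, 0 < j → σ.arr 6 j = on j)
    (h9 : σ.reg 9 = W) (h12 : σ.reg 12 = t) (h13 : σ.reg 13 = R)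
    (hT : HoldsTable n W R (fun _ _ _ => 0) σ) (hM : t + R + 2 + 2 * (n * (t + 2)) ≤ M)
    (hnM : n ≤ M) :
    Runs w M mergeAll σ (n * (500 * (R + 1) * (R + 1)) + 10) fun σ' =>
      (∀ x < 14, σ'.reg x = σ.reg x) ∧ (∀ a < 7, σ'.arr a = σ.arr a) ∧
      HoldsTable n W R (dpTable (edgeCost on t) pp n (n - 1)) σ' := by
  unfold mergeAll
  apply Runs.weaken
  · apply Runs.seq
    apply Runs.set hw rfl
    · simp [Expr.eval, h0, hnM]
    refine Runs.mono (Runs.while_count hw rfl rfl (c := 450 * (R + 1) * (R + 1) + 30) (N := n - 1)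
      (Inv := fun r σ' => (∀ x < 14, σ'.reg x = σ.reg x) ∧ (∀ a < 7, σ'.arr a = σ.arr a) ∧
        σ'.reg 14 = r + 1 ∧ HoldsTable n W R (dpTable (edgeCost on t) pp n (n - 1 - r)) σ')
      ?_ ?_ ?_) le_rfl ?_
    · rintro r σ' hr ⟨i1, i2, i3, i4⟩
      refine ⟨by simp [Expr.eval, i3], ?_⟩
      have hp := hpp (r + 1) (by omega) (by omega)
      -- Only the absence of overflow needs this bound on the table entries.
      obtain ⟨z, hz1, -, hz3⟩ := dpTable_le (c := edgeCost on t) (K := t + 2) hpp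
        (edgeCost_zero_le hon t) (i := n - 1 - (r + 1)) (by omega)
      have hB : ∀ x a b, dpTable (edgeCost on t) pp n (n - 1 - (r + 1)) x a b ≤ n * (t + 2) :=
        fun x a b => (hz1 x a b).trans ((hz3 x).trans (Nat.mul_le_mul_right _ (by omega)))
      -- Rows are merged in decreasing order of position, so the children of a vertex are merged
      -- into it before its own turn.
      have hdp : dpTable (edgeCost on t) pp n (n - 1 - r) = mergeTable (edgeCost on t)
          (dpTable (edgeCost on t) pp n (n - 1 - (r + 1))) (r + 1) (pp (r + 1)) := by
        rw [show n - 1 - r = (n - 1 - (r + 1)) + 1 by omega, dpTable,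
          show n - 1 - (n - 1 - (r + 1)) = r + 1 by omega]
      apply Runs.weaken
      · apply Runs.seq
        apply Runs.set hw rfl
        · simp [Expr.eval, i3]; omega
        apply Runs.seq
        apply Runs.set hw rfl
        · simp [Expr.eval, i3, i2 4, h4]; omega
        refine Runs.mono (mergeRow_runs (n := n) (W := W) (R := R) (t := t) (j := r + 1)
          (p := pp (r + 1)) hw hon hB (by omega) (by omega) (by omega) hRW
          ?_ ?_ ?_ ?_ ?_ ?_ ?_ hM) le_rfl ?_
        · simp [i2 6, h6]
        · simp [i1 9, h9]
        · simp [i1 12, h12]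
        · simp [i1 13, h13]
        · simp [Expr.eval, i3]
        · simp [Expr.eval, i3, i2 4, h4]
        · exact i4
        · rintro σ'' - ⟨k1, k2, k3⟩
          refine ⟨?_, ?_, ?_, ?_⟩
          · intro x hx
            have j1 : x ≠ 14 := by omega
            have j2 : x ≠ 15 := by omega
            rw [k1 x (by omega)]
            simp [j1, j2, i1 x hx]
          · intro a ha
            rw [k2 a ha]
            exact i2 a ha
          · rw [k1 14 (by omega)]
            simp [Expr.eval, i3]
          · rw [hdp]
            exact k3
      · simp only [Expr.cost]
        omega
    · rintro σ' ⟨-, -, i3, -⟩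
      simp [Expr.eval, i3]
    · refine ⟨?_, ?_, ?_, ?_⟩
      · intro x hx
        have : x ≠ 14 := by omega
        simp [this]
      · intro a _
        rfl
      · simp [Expr.eval, h0]; omega
      · rw [Nat.sub_self]
        exact hT
    · rintro σ' - ⟨i1, i2, i3, i4⟩
      exact ⟨i1, i2, i4⟩
  · simp only [Expr.cost]
    have h1 : 450 * (R + 1) * (R + 1) + 30 + (1 + 1 + 1) ≤ 500 * (R + 1) * (R + 1) := by nlinarith
    have h2 := Nat.mul_le_mul (show n - 1 ≤ n by omega) h1
    omega

theorem clearTables_runs (hw : Roomy w M) (h0 : σ.reg 0 = n) (h9 : σ.reg 9 = W)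
    (hM : n * W ≤ M) :
    Runs w M clearTables σ (20 * (n * W) + 10) fun σ' =>
      (∀ x < 14, σ'.reg x = σ.reg x) ∧ (∀ a < 7, σ'.arr a = σ.arr a) ∧
      ∀ i < n * W, σ'.arr 7 i = 0 ∧ σ'.arr 8 i = 0 := by
  unfold clearTables
  apply Runs.weaken
  · apply Runs.seq
    apply Runs.set hw rfl
    · simp [Expr.eval]
    refine Runs.mono (Runs.while_count hw rfl rfl (c := 10) (N := n * W)
      (Inv := fun r σ' => (∀ x < 14, σ'.reg x = σ.reg x) ∧ (∀ a < 7, σ'.arr a = σ.arr a) ∧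
        σ'.reg 14 + r = n * W ∧ ∀ i < σ'.reg 14, σ'.arr 7 i = 0 ∧ σ'.arr 8 i = 0)
      ?_ ?_ ?_) le_rfl ?_
    · rintro r σ' hr ⟨i1, i2, i3, i4⟩
      refine ⟨by simp [Expr.eval, i1 0, i1 9, h0, h9]; omega, ?_⟩
      apply Runs.weaken
      · apply Runs.seq
        apply Runs.write hw rfl rfl
        · simp [Expr.eval]
        apply Runs.seq
        apply Runs.write hw rfl rfl
        · simp [Expr.eval]
        apply Runs.set hw rfl
        · simp [Expr.eval]; omega
        refine ⟨?_, ?_, ?_, ?_⟩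
        · intro x hx
          have : x ≠ 14 := by omega
          simp [this, i1 x hx]
        · intro a ha
          have j7 : a ≠ 7 := by omega
          have j8 : a ≠ 8 := by omega
          rw [← i2 a ha]
          funext i
          simp [j7, j8]
        · simp [Expr.eval]; omega
        · intro i hi
          simp [Expr.eval] at hi ⊢
          by_cases h : i = σ'.reg 14
          · simp [h]
          · have := i4 i (by omega)
            simp [this]
      · decide
    · rintro σ' ⟨i1, -, i3, -⟩
      simp [Expr.eval, i1 0, i1 9, h0, h9]
      omega
    · refine ⟨?_, ?_, ?_, ?_⟩
      · intro x hx
        have : x ≠ 14 := by omega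
        simp [this]
      · intro a _
        rfl
      · simp [Expr.eval]
      · intro i hi
        simp [Expr.eval] at hi
    · rintro σ' - ⟨i1, i2, i3, i4⟩
      exact ⟨i1, i2, fun i hi => i4 i (by omega)⟩
  · simp only [Expr.cost]
    omega

theorem solvePair_runs {pp : ℕ → ℕ} {k b s : ℕ} (hw : Roomy w M) (hn : 0 < n)
    (hpp : ∀ j, 0 < j → j < n → pp j < j) (hs : s ≤ k) (ht : t ≤ k)
    (h0 : σ.reg 0 = n) (h1 : σ.reg 1 = k) (h4 : σ.arr 4 = pp)
    (h6 : ∀ j, 0 < j → σ.arr 6 j = anc pp j b)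
    (h9 : σ.reg 9 = 2 * k + 1) (h11 : σ.reg 11 = s) (h12 : σ.reg 12 = t)
    (hM : 8 * (n * (k + 2)) ≤ M) :
    Runs w M solvePair σ (n * (600 * (2 * k + 1) * (2 * k + 1)) + 40) fun σ' =>
      (∀ x < 13, σ'.reg x = σ.reg x) ∧ σ'.arr 4 = σ.arr 4 ∧ σ'.arr 6 = σ.arr 6 ∧
      ∀ i, σ'.arr 2 i = if i = s * (k + 1) + t then dpValue pp n b s t else σ.arr 2 i := by
  have hN1 : k + 2 ≤ n * (k + 2) := Nat.le_mul_of_pos_left _ hn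
  have hN2 : n * (t + 2) ≤ n * (k + 2) := Nat.mul_le_mul_left _ (by omega)
  have hN3 : n * (2 * k + 1) ≤ n * (2 * (k + 2)) := Nat.mul_le_mul_left _ (by omega)
  have hN4 : n * (2 * (k + 2)) = 2 * (n * (k + 2)) := by ring
  have hN5 : n ≤ n * (k + 2) := Nat.le_mul_of_pos_right _ (by omega)
  unfold solvePair
  apply Runs.weaken
  · apply Runs.seq
    apply Runs.set hw rfl
    · simp [Expr.eval, h11, h12]; omega
    apply Runs.seq
    refine Runs.mono (clearTables_runs (n := n) (W := 2 * k + 1) hw ?_ ?_ (by omega)) le_rfl ?_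
    · simp [h0]
    · simp [h9]
    rintro σ₁ - ⟨i1, i2, i3⟩
    apply Runs.seq
    refine Runs.mono (mergeAll_runs (on := fun j => anc pp j b) (n := n) (W := 2 * k + 1)
      (R := s + t) (t := t) hw (fun j => anc_le_one j b) hn hpp (by omega) ?_ ?_ ?_ ?_ ?_ ?_ ?_
      (by omega) (by omega))
      (c' := n * (500 * (2 * k + 1) * (2 * k + 1)) + 10) ?_ ?_
    · simp [i1 0, h0]
    · simp [i2 4, h4]
    · intro j hj
      simp [i2 6, h6 j hj]
    · simp [i1 9, h9]
    · simp [i1 12, h12]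
    · simp [i1 13, Expr.eval, h11, h12]
    · intro x hx a ha
      have h5 := Nat.mul_le_mul_right (2 * k + 1) (Nat.succ_le_of_lt hx)
      rw [Nat.succ_mul] at h5
      exact i3 _ (by omega)
    · refine Nat.add_le_add_right (Nat.mul_le_mul_left _ ?_) _
      exact Nat.mul_le_mul (Nat.mul_le_mul_left _ (by omega)) (by omega)
    · rintro σ₂ hσ₂ ⟨k1, k2, k3⟩
      -- Row `0` belongs to the root and starts at index `0`, so the answer is in cell `s + t` of
      -- array `8`, the table with one permission.
      have hval := (k3 0 hn (s + t) le_rfl).2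
      rw [zero_mul, zero_add] at hval
      apply Runs.write hw rfl rfl
      · exact hσ₂.2 _ _
      simp only [Expr.eval, k1 1 (by omega), k1 11 (by omega), k1 12 (by omega), k1 13 (by omega),
        i1 1 (by omega), i1 11 (by omega), i1 12 (by omega), i1 13 (by omega),
        State.setReg_reg, h1, h11, h12]
      refine ⟨?_, ?_, ?_, ?_⟩
      · intro x hx
        have : x ≠ 13 := by omega
        simp [k1 x (by omega), i1 x (by omega), this]
      · have : (σ₂.arr 4) = σ.arr 4 := by rw [k2 4 (by omega), i2 4 (by omega)]; rfl
        rw [← this]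
        funext i
        simp
      · have : (σ₂.arr 6) = σ.arr 6 := by rw [k2 6 (by omega), i2 6 (by omega)]; rfl
        rw [← this]
        funext i
        simp
      · intro i
        simp [hval, dpValue, k2 2, i2 2]
  · simp only [Expr.cost]
    have h1 : 500 * (2 * k + 1) * (2 * k + 1) + 20 * (2 * k + 1)
        ≤ 600 * (2 * k + 1) * (2 * k + 1) := by nlinarith
    have h2 := Nat.mul_le_mul_left n h1
    rw [mul_add] at h2
    have h3 : n * (20 * (2 * k + 1)) = 20 * (n * (2 * k + 1)) := by ring
    omega

end

end TreeCover

namespace TreeCover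

/-! ### The loop over all pairs and the whole algorithm -/

section

variable {w M : ℕ} {σ : State}

/-- Registers and arrays that are not changed by the main loop. -/
def SameData (σ σ' : State) (r : ℕ) : Prop :=
  (∀ x < r, σ'.reg x = σ.reg x) ∧ σ'.arr 4 = σ.arr 4 ∧ σ'.arr 6 = σ.arr 6

theorem pairs_runs {n k b : ℕ} {pp : ℕ → ℕ} (hw : Roomy w M) (hn : 0 < n)
    (hpp : ∀ j, 0 < j → j < n → pp j < j)
    (h0 : σ.reg 0 = n) (h1 : σ.reg 1 = k) (h4 : σ.arr 4 = pp)
    (h6 : ∀ j, 0 < j → σ.arr 6 j = anc pp j b)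
    (h9 : σ.reg 9 = 2 * k + 1) (h11 : σ.reg 11 = 0)
    (hM : 8 * (n * (k + 2)) ≤ M) :
    Runs w M
      (.whileLt (.reg 11) (.add (.reg 1) (.const 1))
        (.seq (.set 12 (.const 0))
        (.seq
          (.whileLt (.reg 12) (.add (.reg 1) (.const 1))
            (.seq solvePair (.set 12 (.add (.reg 12) (.const 1)))))
          (.set 11 (.add (.reg 11) (.const 1)))))) σ
      ((k + 1) * ((k + 1) * (n * (600 * (2 * k + 1) * (2 * k + 1)) + 49) + 16) + 5)
      fun σ' => (∀ x < 9, σ'.reg x = σ.reg x) ∧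
        ∀ s ≤ k, ∀ t ≤ k, σ'.arr 2 (s * (k + 1) + t) = dpValue pp n b s t := by
  have hN1 : k + 2 ≤ n * (k + 2) := Nat.le_mul_of_pos_left _ hn
  refine Runs.mono (Runs.while_count hw rfl rfl
    (c := (k + 1) * (n * (600 * (2 * k + 1) * (2 * k + 1)) + 49) + 11) (N := k + 1)
    (Inv := fun r σ' => SameData σ σ' 11 ∧ σ'.reg 11 + r = k + 1 ∧
      ∀ s < σ'.reg 11, ∀ t ≤ k, σ'.arr 2 (s * (k + 1) + t) = dpValue pp n b s t)
    ?_ ?_ ?_) ?_ ?_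
  · rintro r τ hr ⟨⟨i1, i2, i3⟩, i4, i5⟩
    refine ⟨by simp [Expr.eval, i1 1, h1]; omega, ?_⟩
    apply Runs.weaken
    · apply Runs.seq
      apply Runs.set hw rfl
      · simp [Expr.eval]
      apply Runs.seq
      refine Runs.mono (Runs.while_count hw rfl rfl
        (c := n * (600 * (2 * k + 1) * (2 * k + 1)) + 44) (N := k + 1)
        (Inv := fun r' σ' => SameData σ σ' 11 ∧ σ'.reg 11 = τ.reg 11 ∧ σ'.reg 12 + r' = k + 1 ∧
          (∀ s < τ.reg 11, ∀ t ≤ k, σ'.arr 2 (s * (k + 1) + t) = dpValue pp n b s t) ∧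
          ∀ t < σ'.reg 12, σ'.arr 2 (τ.reg 11 * (k + 1) + t) = dpValue pp n b (τ.reg 11) t)
        ?_ ?_ ?_) le_rfl ?_
      · rintro r' υ hr' ⟨⟨j1, j2, j3⟩, j4, j5, j6, j7⟩
        refine ⟨by simp [Expr.eval, j1 1, h1]; omega, ?_⟩
        apply Runs.weaken
        · apply Runs.seq
          refine Runs.mono (solvePair_runs (n := n) (pp := pp) (k := k) (b := b) (s := τ.reg 11)
            (t := υ.reg 12) hw hn hpp (by omega) (by omega) (by rw [j1 0 (by omega), h0])
            (by rw [j1 1 (by omega), h1]) (by rw [j2, h4]) (fun j hj => by rw [j3, h6 j hj])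
            (by rw [j1 9 (by omega), h9]) j4 rfl hM) le_rfl ?_
          rintro υ' - ⟨l1, l2, l3, l4⟩
          apply Runs.set hw rfl
          · simp [Expr.eval, l1 12]; omega
          refine ⟨⟨?_, ?_, ?_⟩, ?_, ?_, ?_, ?_⟩
          · intro x hx
            have : x ≠ 12 := by omega
            simp [this, l1 x (by omega), j1 x hx]
          · rw [State.setReg_arr, l2, j2]
          · rw [State.setReg_arr, l3, j3]
          · simp [l1 11, j4]
          · simp [Expr.eval, l1 12]; omega
          · intro s hs t ht
            -- Results in earlier rows survive, since the new value goes to a different row of the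
            -- output.
            rw [State.setReg_arr, l4, if_neg, j6 s hs t ht]
            intro hh
            have := (index_inj (by omega) (by omega) hh).1
            omega
          · intro t ht
            simp [Expr.eval, l1 12] at ht
            rw [State.setReg_arr, l4]
            by_cases hh : t = υ.reg 12
            · rw [hh, if_pos rfl]
            · rw [if_neg (by omega), j7 t (by omega)]
        · simp only [Expr.cost]
          omega
      · rintro υ ⟨⟨j1, j2, j3⟩, j4, j5, j6, j7⟩
        simp [Expr.eval, j1 1, h1]
        omega
      · refine ⟨⟨?_, ?_, ?_⟩, ?_, ?_, ?_, ?_⟩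
        · intro x hx
          have : x ≠ 12 := by omega
          simp [this, i1 x hx]
        · exact i2
        · exact i3
        · simp
        · simp [Expr.eval]
        · exact i5
        · intro t ht
          simp [Expr.eval] at ht
      · rintro υ - ⟨⟨j1, j2, j3⟩, j4, j5, j6, j7⟩
        apply Runs.set hw rfl
        · simp [Expr.eval, j4]; omega
        refine ⟨⟨?_, ?_, ?_⟩, ?_, ?_⟩
        · intro x hx
          have : x ≠ 11 := by omega
          simp [this, j1 x hx]
        · exact j2
        · exact j3
        · simp [Expr.eval, j4]; omega
        · intro s hs t ht
          simp [Expr.eval, j4] at hs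
          rw [State.setReg_arr]
          by_cases hh : s = τ.reg 11
          · rw [hh]
            exact j7 t (by omega)
          · exact j6 s (by omega) t ht
    · simp only [Expr.cost, add_assoc, Nat.reduceAdd]
      omega
  · rintro τ ⟨⟨i1, i2, i3⟩, i4, i5⟩
    simp [Expr.eval, i1 1, h1]
    omega
  · refine ⟨⟨fun _ _ => rfl, rfl, rfl⟩, by omega, fun s hs => by omega⟩
  · simp only [Expr.cost, add_assoc, Nat.reduceAdd]
    omega
  · rintro τ - ⟨⟨i1, i2, i3⟩, i4, i5⟩
    exact ⟨fun x hx => i1 x (by omega), fun s hs t ht => i5 s (by omega) t ht⟩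

end

theorem twoSources_runs {w M n k : ℕ} {T : SimpleGraph (Fin n)} {u v : Fin n}
    {adj : Fin n → List (Fin n)} (hw : Roomy w M) (hT : T.IsTree)
    (hadj : IsAdjacencyLists T adj) (hM : 8 * (n * (k + 2)) ≤ M) :
    Runs w M twoSources (inputState n k u v adj)
      (140 * n + 20 + (12 * n + 10) +
        ((k + 1) * ((k + 1) * (n * (600 * (2 * k + 1) * (2 * k + 1)) + 49) + 16) + 5) + 30)
      fun σ => ∀ s ≤ k, ∀ t ≤ k, IsTwoSources T u v s t (σ.arr 2 (s * (k + 1) + t)) := by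
  have hn : 0 < n := u.pos
  have hN1 : k + 2 ≤ n * (k + 2) := Nat.le_mul_of_pos_left _ hn
  have hN5 : n * 2 ≤ n * (k + 2) := Nat.mul_le_mul_left _ (by omega)
  have hoffle : ∀ i ≤ n, offset adj i ≤ 2 * n := fun i hi => by
    refine le_trans ?_ (offset_le hT hadj)
    -- Offsets are monotone, being partial sums of list lengths.
    rw [offset_eq_sum hi, offset_eq_sum le_rfl]
    exact Finset.sum_le_sum_of_subset (Finset.range_subset_range.2 hi)
  unfold twoSources
  apply Runs.weaken
  · apply Runs.seq
    refine Runs.mono (search_runs (u := u) hw hT hadj ?_ ?_ ?_ ?_ ?_ ?_ ?_) le_rfl ?_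
    · intro x l hl
      simpa [inputState] using getD_flatMap x hl
    · intro i hi
      simp [inputState, hi, offset]
    · simp [inputState]
    · simp [inputState]
    · intro i
      simp [inputState]
    · omega
    · intro i hi
      have := hoffle i hi
      omega
    rintro σ₁ - ⟨a1, a2, q, pos, hroot, hpos⟩
    have a0 : σ₁.reg 0 = n := by rw [a1 0 (by omega)]; simp [inputState]
    have a1' : σ₁.reg 1 = k := by rw [a1 1 (by omega)]; simp [inputState]
    have a3 : σ₁.reg 3 = v := by rw [a1 3 (by omega)]; simp [inputState]
    have hpp := hroot.pp_lt
    apply Runs.seq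
    refine Runs.mono (climb_runs (n := n) (b := pos v) hw hpp rfl ?_ (hroot.pos_lt v) ?_ ?_)
      le_rfl ?_
    · rw [a3, hpos]
    · intro i
      rw [a2]
      simp [inputState]
    · omega
    rintro σ₂ - ⟨b1, b2, b3⟩
    have b0 : σ₂.reg 0 = n := by rw [b1 0 (by omega), a0]
    have b1' : σ₂.reg 1 = k := by rw [b1 1 (by omega), a1']
    apply Runs.seq
    apply Runs.set hw rfl
    · simp [Expr.eval, b1']; omega
    apply Runs.seq
    apply Runs.set hw rfl
    · simp [Expr.eval]
    apply Runs.seq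
    refine Runs.mono (pairs_runs (n := n) (k := k) (b := pos v) (pp := σ₁.arr 4) hw hn hpp
      ?_ ?_ ?_ ?_ ?_ ?_ hM) le_rfl ?_
    · simp [b0]
    · simp [b1']
    · simp [b2]
    · simpa using b3
    · simp [Expr.eval, b1']
    · simp [Expr.eval]
    rintro σ₃ - ⟨c1, c2⟩
    have c0 : σ₃.reg 0 = n := by rw [c1 0 (by omega)]; simp [b0]
    -- The last instruction overwrites the entry for `s = t = 0`, which the dynamic program does not
    -- compute correctly in general.
    apply Runs.write hw rfl rfl
    · simp [Expr.eval, c0]; omega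
    intro s hs t ht
    simp only [Expr.eval, State.setArr_arr, c0, true_and]
    by_cases hst : s = 0 ∧ t = 0
    · obtain ⟨rfl, rfl⟩ := hst
      simp only [zero_mul, add_zero, if_true]
      exact hroot.isTwoSources_zero
    · have hne : ¬ s * (k + 1) + t = 0 := by
        intro hh
        rw [Nat.add_eq_zero_iff, Nat.mul_eq_zero] at hh
        omega
      rw [if_neg hne, c2 s hs t ht]
      exact hroot.isTwoSources (by omega)
  · simp only [Expr.cost]
    omega

/-! ### Word size and running time -/

/-- The threshold `4000` is `8 * 500`: numbers are at most `(n + k) ^ 8`, and expressions cost at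
most `500`. -/
theorem roomy_of_le {n k c : ℕ} (hn : 1 ≤ n) (hk : 1 ≤ k) (hc : 4000 ≤ c) :
    Roomy (c * Nat.size (n + k)) ((n + k) ^ 8) := by
  have h2 : 2 ≤ n + k := by omega
  constructor
  · calc 2 ≤ n + k := h2
      _ = (n + k) ^ 1 := (pow_one _).symm
      _ ≤ (n + k) ^ 8 := Nat.pow_le_pow_right (by omega) (by omega)
  · have key : ∀ e, e ≠ 0 → e ≤ c → (n + k) ^ e < 2 ^ (c * Nat.size (n + k)) := by
      intro e he hec
      rw [mul_comm c, pow_mul]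
      exact (Nat.pow_lt_pow_left (Nat.lt_size_self _) he).trans_le
        (Nat.pow_le_pow_right (by positivity) hec)
    rw [← pow_mul]
    exact key _ (by omega) (by omega)

theorem twoSources_bound {n k : ℕ} (hk : 1 ≤ k) : 8 * (n * (k + 2)) ≤ (n + k) ^ 8 := by
  rcases Nat.eq_zero_or_pos n with rfl | hn
  · simp
  obtain ⟨N, hN⟩ : ∃ N, N = n + k := ⟨_, rfl⟩
  rw [← hN]
  have h2 : 2 ≤ N := by omega
  have h3 : n * (k + 2) ≤ N * (2 * N) := Nat.mul_le_mul (by omega) (by omega)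
  calc 8 * (n * (k + 2)) ≤ 2 ^ 4 * N ^ 2 := by nlinarith
    _ ≤ N ^ 4 * N ^ 2 := Nat.mul_le_mul_right _ (Nat.pow_le_pow_left h2 4)
    _ = N ^ 6 := by ring
    _ ≤ N ^ 8 := Nat.pow_le_pow_right (by omega) (by omega)

theorem time_bound {n k : ℕ} (hn : 1 ≤ n) (hk : 1 ≤ k) :
    140 * n + 20 + (12 * n + 10) +
      ((k + 1) * ((k + 1) * (n * (600 * (2 * k + 1) * (2 * k + 1)) + 49) + 16) + 5) + 30
      ≤ 30000 * (k ^ 4 * n) := by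
  have hkn : 1 ≤ k ^ 4 * n := Nat.mul_pos (pow_pos hk 4) hn
  have hk2 : k ≤ k ^ 4 * n := by
    calc k = k ^ 1 * 1 := by ring
      _ ≤ k ^ 4 * n := Nat.mul_le_mul (Nat.pow_le_pow_right hk (by omega)) hn
  have hkk : k ^ 2 ≤ k ^ 4 * n := by
    calc k ^ 2 = k ^ 2 * 1 := by ring
      _ ≤ k ^ 4 * n := Nat.mul_le_mul (Nat.pow_le_pow_right hk (by omega)) hn
  have hnk : n ≤ k ^ 4 * n := Nat.le_mul_of_pos_left _ (pow_pos hk 4)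
  -- From `1 ≤ k` one has `k + 1 ≤ 2 * k` and `2 * k + 1 ≤ 3 * k`; the leading coefficient becomes
  -- `4 * 600 * 9 = 21600`, and all lower-order terms are absorbed by `k ^ 4 * n`.
  have h1 : (k + 1) * ((k + 1) * (n * (600 * (2 * k + 1) * (2 * k + 1)) + 49) + 16)
      ≤ (2 * k) * ((2 * k) * (n * (600 * (3 * k) * (3 * k)) + 49) + 16) := by
    gcongr <;> omega
  have h2 : (2 * k) * ((2 * k) * (n * (600 * (3 * k) * (3 * k)) + 49) + 16)
      = 21600 * (k ^ 4 * n) + 196 * k ^ 2 + 32 * k := by ring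
  omega

end TreeCover

/-- There are one program and one constant `c` such that on every instance (a tree `T` on `n`
vertices given by adjacency lists, `k ≥ 1`, and vertices `u`, `v`), on words of `O(log (n + k))`
bits, the program halts within `c * (k ^ 4 * n)` time units, and then array `2` contains, in cell
`s * (k + 1) + t`, the two-source optimum for `s`, `t`, for all `0 ≤ s, t ≤ k`. -/
theorem mainTheorem2 :
    ∃ (P : TreeCover.Program) (c : ℕ),
      ∀ (n k : ℕ) (T : SimpleGraph (Fin n)) (u v : Fin n) (adj : Fin n → List (Fin n)),
        1 ≤ k → T.IsTree → TreeCover.IsAdjacencyLists T adj →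
        ∃ (τ : ℕ) (σ : TreeCover.State),
          TreeCover.Exec (c * Nat.size (n + k)) P (TreeCover.inputState n k u v adj) τ σ ∧
          τ ≤ c * (k ^ 4 * n) ∧
          ∀ s ≤ k, ∀ t ≤ k, TreeCover.IsTwoSources T u v s t (σ.arr 2 (s * (k + 1) + t)) := by
  -- The same constant serves for the word length, where `4000` would do, and for the running time.
  refine ⟨TreeCover.twoSources, 30000, fun n k T u v adj hk hT hadj => ?_⟩
  have hn : 0 < n := u.pos
  have hM := TreeCover.twoSources_bound (n := n) hk
  have hoff : ∀ i ≤ n, TreeCover.offset adj i ≤ 2 * n := fun i hi => by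
    refine le_trans ?_ (TreeCover.offset_le hT hadj)
    rw [TreeCover.offset_eq_sum hi, TreeCover.offset_eq_sum le_rfl]
    exact Finset.sum_le_sum_of_subset (Finset.range_subset_range.2 hi)
  have hkM : n + k + 2 * n ≤ (n + k) ^ 8 := by
    have h1 : k + 2 ≤ n * (k + 2) := Nat.le_mul_of_pos_left _ hn
    have h2 : n * 2 ≤ n * (k + 2) := Nat.mul_le_mul_left _ (by omega)
    omega
  have hbdd : (TreeCover.inputState n k u v adj).Bounded ((n + k) ^ 8) := by
    constructor
    · intro x
      simp only [TreeCover.inputState]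
      split_ifs <;> omega
    · intro a i
      simp only [TreeCover.inputState]
      split_ifs with h1 h2 h3
      · exact (hoff i h2).trans (by omega)
      · omega
      · rw [List.getD_eq_getElem?_getD]
        cases hx : (((List.finRange n).flatMap adj).map Fin.val)[i]? with
        | none => simp
        | some y =>
          have hy := List.mem_of_getElem? hx
          obtain ⟨z, -, rfl⟩ := List.mem_map.1 hy
          have := z.isLt
          simp only [Option.getD_some]
          omega
      · omega
  obtain ⟨τ, σ, h1, h2, -, h4⟩ := TreeCover.twoSources_runs (v := v) (u := u)
    (TreeCover.roomy_of_le (c := 30000) hn hk (by norm_num)) hT hadj hM hbdd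
  exact ⟨τ, σ, h1, h2.trans (TreeCover.time_bound hn hk), h4⟩
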